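/- A dissociation set in a finite simple graph $G$ is a set of vertices inducing a subgraph with maximum degree at most one; a maximum dissociation set is one of maximum cardinality, and $m(G)$ denotes the number of maximum dissociation sets of $G$. A potted graph is a connected graph containing exactly one cycle, such that exactly one vertex of this cycle has degree larger than $2$. Let $\mathcal P(n,k)$ be the set of potted graphs of order $n$ whose cycle has order $k$. Let $P_r$ and $C_r$ be the path and the cycle of order $r$. For vertex-disjoint trees $T_1,\dots,T_r$ let $G_w(T_1,\dots,T_r)$ be a tree obtained from $T_1\cup\dots\cup T_r$ by identifying $r$ leaves, one from each $T_i$, into a single vertex $w$ (so $G_w(T_1)$ is $T_1$ with $w$ one of its leaves). Let $C_k+_e G_w(T_1,\dots,T_r)$ be obtained from the disjoint union of $C_k$ and $G_w(T_1,\dots,T_r)$ by adding an edge between $w$ and a vertex of $C_k$, and let $C_k\odot G_w(T_1,\dots,T_r)$ be obtained from it by identifying $w$ with a vertex of $C_k$. Define the following families of graphs (up to isomorphism), where $l\ge 0$ is arbitrary and, in $\mathcal G_2,\mathcal G_6,\mathcal G_7,\mathcal G_9$, each of $T_1,\dots,T_l$ is $P_4$ or $K_{1,3}$: - $\mathcal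 G_1=\{C_k+_e G_w(P_3,P_4,\dots,P_4)\}$ with $l$ copies of $P_4$; - $\mathcal G_2=\{C_k+_e G_w(P_2,P_3,T_1,\dots,T_l)\}$; - $\mathcal G_6=\{C_k\odot G_w(P_3,T_1,\dots,T_l)\}$; - $\mathcal G_7=\{C_k\odot G_w(P_2,P_2,T_1,\dots,T_l)\}$; - $\mathcal G_8=\{C_k\odot G_w(P_4,\dots,P_4)\}$ with at least one copy of $P_4$; - $\mathcal G_9=\{C_k\odot G_w(P_2,T_1,\dots,T_l)\}$. Put $$x_1=k\cdot 3^{(n-k-1)/3-1}+\tfrac13(k+1),\qquad x_2=(k+1)\cdot 3^{(n-k-1)/3-1}+1,$$ $$x_3=k\cdot 3^{(n-k)/3-1}+\tfrac13(k+1)\left[\tfrac13(n-k)+1\right]+1,\qquad x_4=(k+1)\cdot 3^{(n-k)/3-1}+\tfrac13(n+k-1).$$ **Theorem 1.2.** Let $n,k$ be positive integers with $n\ge k+3$ and $k\equiv 2\pmod 3$, and let $G\in\mathcal P(n,k)$. Then $$m(G)\le\begin{cases}\max\{x_1,x_2\}, & n\equiv 0\pmod 3,\\ (k+1)\cdot 3^{(n-k-2)/3-1},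 & n\equiv 1\pmod 3,\\ \max\{x_3,x_4\}, & n\equiv 2\pmod 3.\end{cases}$$ Moreover, equality holds if and only if one of the following holds: 1. $n\equiv 0\pmod 3$, and either $G\in\mathcal G_2$ and $x_1=\max\{x_1,x_2\}$, or $G\in\mathcal G_9$ and $x_2=\max\{x_1,x_2\}$; 2. $n\equiv 1\pmod 3$ and $G\in\mathcal G_6\cup\mathcal G_7$; 3. $n\equiv 2\pmod 3$, and either $G\in\mathcal G_1$ and $x_3=\max\{x_3,x_4\}$, or $G\in\mathcal G_8$ and $x_4=\max\{x_3,x_4\}$. -/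

import Mathlib

namespace Potted

universe u

/-- `S` is a dissociation set of `G`: every vertex of `S` has degree at most one in `G[S]`. -/
def IsDissociationSet {V : Type u} [Finite V] (G : SimpleGraph V) (S : Finset V) : Prop :=
  ∀ v ∈ S, {w | w ∈ S ∧ G.Adj v w}.ncard ≤ 1

/-- A dissociation set of maximum cardinality. -/
def IsMaximumDissociationSet {V : Type u} [Finite V] (G : SimpleGraph V) (S : Finset V) : Prop :=
  IsDissociationSet G S ∧ ∀ T : Finset V, IsDissociationSet G T → T.card ≤ S.card

/-- `m(G)`: the number of maximum dissociation sets of `G`. -/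
noncomputable def numMaxDissociationSets {V : Type u} [Finite V] (G : SimpleGraph V) : ℕ :=
  {S : Finset V | IsMaximumDissociationSet G S}.ncard

/-- The subgraph `C` of `G` is a cycle of order `k` (necessarily `k ≥ 3`). -/
def IsCycleSubgraph {V : Type u} {G : SimpleGraph V} (C : G.Subgraph) (k : ℕ) : Prop :=
  ∃ (v : V) (p : G.Walk v v), p.IsCycle ∧ p.length = k ∧ p.toSubgraph = C

/-- `G` is a potted graph whose cycle has order `k`: `G` is connected, it contains exactly one
cycle, this cycle has order `k`, and exactly one vertex of the cycle has degree larger than `2`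
in `G`. -/
def IsPottedGraph {V : Type u} [Finite V] (G : SimpleGraph V) (k : ℕ) : Prop :=
  G.Connected ∧ ∃ C : G.Subgraph, IsCycleSubgraph C k ∧
    (∀ (C' : G.Subgraph) (l : ℕ), IsCycleSubgraph C' l → C' = C) ∧
    ∃! w : V, w ∈ C.verts ∧ 2 < (G.neighborSet w).ncard

/-- A graph with a distinguished vertex. -/
structure PointedGraph where
  /-- the vertices -/
  Vert : Type
  /-- the graph -/
  graph : SimpleGraph Vert
  /-- the distinguished vertex -/
  base : Vert

/-- The path of order two, with a leaf distinguished. -/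
def P2 : PointedGraph := ⟨Fin 2, SimpleGraph.pathGraph 2, 0⟩

/-- The path of order three, with a leaf distinguished. -/
def P3 : PointedGraph := ⟨Fin 3, SimpleGraph.pathGraph 3, 0⟩

/-- The path of order four, with a leaf distinguished. -/
def P4 : PointedGraph := ⟨Fin 4, SimpleGraph.pathGraph 4, 0⟩

/-- The star `K_{1,3}`, with a leaf distinguished. -/
def K13 : PointedGraph :=
  ⟨Fin 1 ⊕ Fin 3, completeBipartiteGraph (Fin 1) (Fin 3), Sum.inr 0⟩

/-- The adjacency relation of the graph obtained from the disjoint union of the `T i` by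
identifying all the distinguished vertices: `none` is the identified vertex and `some ⟨i, x⟩` is
the vertex `x` of `T i`, for `x` other than the distinguished one. -/
inductive GlueAdj {ι : Type} (T : ι → PointedGraph) :
    Option (Σ i, {x : (T i).Vert // x ≠ (T i).base}) →
      Option (Σ i, {x : (T i).Vert // x ≠ (T i).base}) → Prop
  | inner (i : ι) (x y : {x : (T i).Vert // x ≠ (T i).base})
      (h : (T i).graph.Adj x.1 y.1) : GlueAdj T (some ⟨i, x⟩) (some ⟨i, y⟩)
  | fromBase (i : ι) (x : {x : (T i).Vert // x ≠ (T i).base})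
      (h : (T i).graph.Adj (T i).base x.1) : GlueAdj T none (some ⟨i, x⟩)
  | toBase (i : ι) (x : {x : (T i).Vert // x ≠ (T i).base})
      (h : (T i).graph.Adj x.1 (T i).base) : GlueAdj T (some ⟨i, x⟩) none

/-- The graph obtained from the disjoint union of the pointed graphs `T i` by identifying all
their distinguished vertices, pointed at the identified vertex. -/
def glue {ι : Type} (T : ι → PointedGraph) : PointedGraph where
  Vert := Option (Σ i, {x : (T i).Vert // x ≠ (T i).base})
  graph :=
    { Adj := GlueAdj T
      symm := ⟨fun _ _ h => match h with
        | .inner i x y h => .inner i y x h.symm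
        | .fromBase i x h => .toBase i x h.symm
        | .toBase i x h => .fromBase i x h.symm⟩
      loopless := ⟨fun _ h => match h with
        | .inner i x _ h => (T i).graph.loopless.irrefl x.1 h⟩ }
  base := none

/-- `G_w(T₁, …, T_r)`, pointed at the identified vertex `w`. -/
def glueList (L : List PointedGraph) : PointedGraph :=
  glue fun i : Fin L.length => L.get i

/-- `G` is (isomorphic to) `C_k +_e T`: the disjoint union of the cycle `C_k` and `T` with an edge
added between a vertex of `C_k` and the distinguished vertex of `T`. -/
def IsCycleJoin {V : Type u} (G : SimpleGraph V) (k : ℕ) (T : PointedGraph) : Prop :=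
  ∃ c : Fin k, Nonempty (G ≃g
    (SimpleGraph.sum (SimpleGraph.cycleGraph k) T.graph ⊔
      SimpleGraph.edge (Sum.inl c) (Sum.inr T.base)))

/-- `G` is (isomorphic to) `C_k ⊙ T`: the graph obtained from the disjoint union of the cycle
`C_k` and `T` by identifying a vertex of `C_k` and the distinguished vertex of `T`. -/
def IsCycleGlue {V : Type u} (G : SimpleGraph V) (k : ℕ) (T : PointedGraph) : Prop :=
  ∃ c : Fin k, Nonempty (G ≃g (glueList [⟨Fin k, SimpleGraph.cycleGraph k, c⟩, T]).graph)

/-- A (possibly empty) list each of whose entries is `P_4` or `K_{1,3}`. -/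
def IsP4K13List (L : List PointedGraph) : Prop := ∀ T ∈ L, T = P4 ∨ T = K13

/-- `𝒢₁`: the graphs `C_k +_e G_w(P₃, P₄, …, P₄)` with `l ≥ 0` copies of `P₄`. For `l = 0` the
tree is `P₃` and `w` is a leaf of it. -/
def InG1 {V : Type u} (G : SimpleGraph V) (k : ℕ) : Prop :=
  ∃ l : ℕ, IsCycleJoin G k (glueList (P3 :: List.replicate l P4))

/-- `𝒢₂`: the graphs `C_k +_e G_w(P₂, P₃, T₁, …, T_l)` with `l ≥ 0` and each `T_i` one of `P₄`,
`K_{1,3}`. -/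
def InG2 {V : Type u} (G : SimpleGraph V) (k : ℕ) : Prop :=
  ∃ L : List PointedGraph, IsP4K13List L ∧ IsCycleJoin G k (glueList (P2 :: P3 :: L))

/-- `𝒢₆`: the graphs `C_k ⊙ G_w(P₃, T₁, …, T_l)` with each `T_i` one of `P₄`, `K_{1,3}`. -/
def InG6 {V : Type u} (G : SimpleGraph V) (k : ℕ) : Prop :=
  ∃ L : List PointedGraph, IsP4K13List L ∧ IsCycleGlue G k (glueList (P3 :: L))

/-- `𝒢₇`: the graphs `C_k ⊙ G_w(P₂, P₂, T₁, …, T_l)` with each `T_i` one of `P₄`, `K_{1,3}`. -/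
def InG7 {V : Type u} (G : SimpleGraph V) (k : ℕ) : Prop :=
  ∃ L : List PointedGraph, IsP4K13List L ∧ IsCycleGlue G k (glueList (P2 :: P2 :: L))

/-- `𝒢₈`: the graphs `C_k ⊙ G_w(P₄, …, P₄)` with at least one copy of `P₄`. -/
def InG8 {V : Type u} (G : SimpleGraph V) (k : ℕ) : Prop :=
  ∃ l : ℕ, 1 ≤ l ∧ IsCycleGlue G k (glueList (List.replicate l P4))

/-- `𝒢₉`: the graphs `C_k ⊙ G_w(P₂, T₁, …, T_l)` with each `T_i` one of `P₄`, `K_{1,3}`. -/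
def InG9 {V : Type u} (G : SimpleGraph V) (k : ℕ) : Prop :=
  ∃ L : List PointedGraph, IsP4K13List L ∧ IsCycleGlue G k (glueList (P2 :: L))

/-- `x₁ = k · 3^((n-k-1)/3-1) + (k+1)/3`. -/
def x1 (n k : ℕ) : ℚ := k * (3 : ℚ) ^ (((n : ℤ) - k - 1) / 3 - 1) + (k + 1) / 3

/-- `x₂ = (k+1) · 3^((n-k-1)/3-1) + 1`. -/
def x2 (n k : ℕ) : ℚ := (k + 1) * (3 : ℚ) ^ (((n : ℤ) - k - 1) / 3 - 1) + 1

/-- `x₃ = k · 3^((n-k)/3-1) + (k+1)/3 · [(n-k)/3+1] + 1`. -/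
def x3 (n k : ℕ) : ℚ :=
  k * (3 : ℚ) ^ (((n : ℤ) - k) / 3 - 1) + (k + 1) / 3 * (((n : ℚ) - k) / 3 + 1) + 1

/-- `x₄ = (k+1) · 3^((n-k)/3-1) + (n+k-1)/3`. -/
def x4 (n k : ℕ) : ℚ :=
  (k + 1) * (3 : ℚ) ^ (((n : ℤ) - k) / 3 - 1) + ((n : ℚ) + k - 1) / 3

end Potted

namespace Potted

-- Codes of rooted trees and their counts

universe u v

/-! Removing the edges of the cycle leaves, around the branching vertex w of the cycle, a rooted
tree T of order n - k + 1. Write k = 3t + 2. If w is not selected, the rest of the cycle is a path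
of order 3t + 1, with t + 1 maximum dissociation sets, of size 2t + 1. If w is selected, the rest of
the cycle contributes at most 2t vertices: in one way with both cycle neighbours of w left out and,
when w is isolated in T, in t further ways for each neighbour that is selected. So selecting w costs
one vertex on the cycle, and m(G) is a linear form in a few counts of T: sets avoiding w get the
coefficient t + 1, sets with w isolated 2t + 1, sets with w of degree one 1, and only counts at the
best combined size survive. This is `Data.weight`; the three constructors of `Data` record how the
sizes for the three states of the root compare.

The theorem thus becomes an extremal problem for rooted trees, solved in `weight_le_of_mod_two`,
`weight_of_mod_one` and `weight_of_mod_zero`. They rest on `RT.bounds`, an induction on adding one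
branch at the root, with the hypotheses `InvX`, `InvP`, `InvZ` strengthened until they reproduce
themselves and keep track of equality. The benchmark is `E j`, which is supermultiplicative. A
branch with data `X` of order j + 3 may contribute a factor of at most `3 * E j`, and only the path
of order three, with its three maximum dissociation sets, attains this. Hence extremal trees are
stars of such paths with a small remainder (a leaf, two leaves, or an edge). A path of order three
attached by an end gives a `P4`, attached by its centre a `K13`; the distinction affects the weight
only when n ≡ 2 (mod 3), where all must be `P4`.

On the graph side, generating polynomials of dissociation sets follow the branch recursion
(`Realizes.genFun`), the cycle is closed up in `Decomp.genFun_eq`, and `Pol.Fits` extracts leading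
coefficients. Every potted graph has a decomposition (`IsPottedGraph.exists_decomp`), and its code
determines it up to isomorphism (`Decomp.nonempty_iso`), so membership in each family means having a
certain code. -/

/-- A code for a finite rooted tree: `join t s` is `t` with `s` as an additional branch at the
root. -/
inductive RT
  | leaf : RT
  | join : RT → RT → RT

namespace RT

/-- The number of vertices. -/
def size : RT → ℕ
  | leaf => 1
  | join t s => size t + size s

/-- The branches at the root. -/
def kids : RT → List RT
  | leaf => []
  | join t s => s :: kids t

/-- The rooted tree with given branches at the root. -/
def ofKids : List RT → RT
  | [] => leaf
  | s :: l => join (ofKids l) s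

theorem ofKids_kids (t : RT) : ofKids (kids t) = t := by
  induction t with
  | leaf => rfl
  | join t s iht _ => simp [kids, ofKids, iht]

/-- The path of order two. -/
def edge : RT := join leaf leaf

/-- The path of order three rooted at an end. -/
def pathEnd : RT := join leaf edge

/-- The path of order three rooted at its centre. -/
def pathMid : RT := join edge leaf

end RT

/-- Counts of the maximum dissociation sets of a rooted tree by the state of the root. `X b c d`:
the maximum is attained with the root left out (`b` sets), with the root isolated (`c` sets) and
with the root of degree one (`d` sets). `P o c d`: the root lies in all maximum sets, in `c` of them
as an isolated vertex, in `d` with degree one, and `o` counts the sets avoiding it of size one less.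
`Z o e d`: the root has degree one in all `d` maximum sets, and `o`, `e` count the sets of
size one less avoiding the root and having it as an isolated vertex. -/
inductive Data
  | X : ℕ → ℕ → ℕ → Data
  | P : ℕ → ℕ → ℕ → Data
  | Z : ℕ → ℕ → ℕ → Data

namespace Data

/-- The effect of adding a branch at the root. -/
def join : Data → Data → Data
  | P o₁ c₁ d₁, X b₂ c₂ d₂ => P (o₁ * (b₂ + c₂ + d₂)) (c₁ * b₂) (d₁ * b₂ + c₁ * c₂)
  | P o₁ c₁ _, P o₂ c₂ d₂ => Z (o₁ * (c₂ + d₂)) (c₁ * o₂) (c₁ * c₂)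
  | P o₁ c₁ d₁, Z o₂ e₂ d₂ => X (o₁ * d₂) (c₁ * o₂) (d₁ * o₂ + c₁ * e₂)
  | Z o₁ e₁ d₁, X b₂ c₂ d₂ => Z (o₁ * (b₂ + c₂ + d₂)) (e₁ * b₂) (d₁ * b₂)
  | Z o₁ e₁ d₁, P o₂ c₂ d₂ => X (o₁ * (c₂ + d₂)) 0 (d₁ * o₂ + e₁ * c₂)
  | Z o₁ _ d₁, Z o₂ _ d₂ => X (o₁ * d₂) 0 (d₁ * o₂)
  | X b₁ c₁ d₁, X b₂ c₂ d₂ => X (b₁ * (b₂ + c₂ + d₂)) (c₁ * b₂) (d₁ * b₂ + c₁ * c₂)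
  | X b₁ c₁ _, P _ c₂ d₂ => X (b₁ * (c₂ + d₂)) 0 (c₁ * c₂)
  | X b₁ _ _, Z _ _ d₂ => X (b₁ * d₂) 0 0

end Data

/-- The counts of a rooted tree. -/
def RT.data : RT → Data
  | .leaf => .P 1 1 0
  | .join t s => (data t).join (data s)

/-! ### Numerical functions -/

/-- `3 ^ ⌊j / 3⌋`. -/
def E (j : ℕ) : ℕ := 3 ^ (j / 3)

/-- The excess over `E j` of the maximum number of maximum dissociation sets in a tree of order
`j + 3`. -/
def eps (j : ℕ) : ℕ := if j % 3 = 0 then j / 3 + 2 else if j % 3 = 1 then 1 else 0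

/-- The indicator of the multiples of three. -/
def del (j : ℕ) : ℕ := if j % 3 = 0 then 1 else 0

theorem E_pos (j : ℕ) : 1 ≤ E j := Nat.one_le_pow _ _ (by norm_num)

theorem E_mono {i j : ℕ} (h : i ≤ j) : E i ≤ E j :=
  Nat.pow_le_pow_right (by norm_num) (Nat.div_le_div_right h)

/-- Floors are superadditive. This is what lets bounds for two trees multiply when their roots are
joined. -/
theorem E_mul_le (i j : ℕ) : E i * E j ≤ E (i + j) := by
  unfold E
  rw [← pow_add]
  exact Nat.pow_le_pow_right (by norm_num) (by omega)

theorem E_add_three (j : ℕ) : E (j + 3) = 3 * E j := by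
  unfold E
  rw [show (j + 3) / 3 = j / 3 + 1 by omega, pow_succ, mul_comm]

theorem E_three_mul_add (q j : ℕ) : E (3 * q + j) = 3 ^ q * E j := by
  unfold E
  rw [show (3 * q + j) / 3 = q + j / 3 by omega, pow_add]

theorem E_three_mul (q : ℕ) : E (3 * q) = 3 ^ q := by
  unfold E
  rw [show 3 * q / 3 = q by omega]

theorem E_zero : E 0 = 1 := rfl

theorem E_lt_add_two {j : ℕ} (h : (j + 2) % 3 = 0) : E j < E (j + 2) := by
  unfold E
  exact Nat.pow_lt_pow_right (by norm_num) (by omega)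

theorem E_lt_succ {j : ℕ} (h : (j + 1) % 3 = 0) : E j < E (j + 1) := by
  unfold E
  exact Nat.pow_lt_pow_right (by norm_num) (by omega)

theorem del_le_one (j : ℕ) : del j ≤ 1 := by unfold del; split <;> simp

theorem del_add_three (j : ℕ) : del (j + 3) = del j := by unfold del; simp

theorem eps_add_del (j : ℕ) : eps j + del j ≤ eps (j + 3) := by
  unfold eps del; split_ifs <;> omega

theorem eps_add_mul (q j : ℕ) : eps j ≤ eps (3 * q + j) := by
  unfold eps; split_ifs <;> omega

theorem del_le_eps (j : ℕ) : del j ≤ eps j := by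
  unfold eps del; split_ifs <;> omega

theorem succ_le_three_pow (q : ℕ) : 2 * q + 1 ≤ 3 ^ q := by
  induction q with
  | zero => simp
  | succ q ih => rw [pow_succ]; omega

/-- The exception `j = 0` is the path of order three, where the excess 2 is larger than `E 0 = 1`;
it is the source of all extremal structures. -/
theorem eps_le_E {j : ℕ} (h : j ≠ 0) : eps j ≤ E j := by
  have h2 := succ_le_three_pow (j / 3)
  unfold eps
  split_ifs
  · have : 2 * (j / 3) + 1 ≤ E j := h2
    omega
  · exact E_pos j
  · omega

theorem E_add_del_le (j : ℕ) : E j + del j ≤ E (j + 1) + eps (j + 1) := by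
  have h : E j ≤ E (j + 1) := E_mono (Nat.le_succ j)
  rcases Nat.lt_or_ge (j % 3) 1 with h0 | h0
  · have : eps (j + 1) = 1 := by unfold eps; split_ifs <;> omega
    have := del_le_one j
    omega
  · have : del j = 0 := by unfold del; split_ifs <;> omega
    omega

theorem eps_three_mul (q : ℕ) : eps (3 * q) = q + 2 := by
  unfold eps; split_ifs <;> omega

/-! ### Inductive bounds for the counts of a rooted tree -/

open RT

/-- `P3List l e q`: the list `l` consists of `q` paths of order three, `e` of them rooted at an
end and the others at the centre. -/
inductive P3List : List RT → ℕ → ℕ → Prop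
  | nil : P3List [] 0 0
  | consEnd {l : List RT} {e q : ℕ} (h : P3List l e q) : P3List (pathEnd :: l) (e + 1) (q + 1)
  | consMid {l : List RT} {e q : ℕ} (h : P3List l e q) : P3List (pathMid :: l) e (q + 1)

theorem P3List.le {l : List RT} {e q : ℕ} (h : P3List l e q) : e ≤ q := by
  induction h <;> omega

theorem P3List.eq_nil {l : List RT} {e : ℕ} (h : P3List l e 0) : l = [] := by
  cases h; rfl

/-- Bounds for a tree of order `j + 3` with data `X b c d`. -/
structure InvX (t : RT) (j b c d : ℕ) : Prop where
  pos : 1 ≤ b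
  b_le : b ≤ E j
  bc_le : b + c ≤ E j + del j
  m_le : b + c + d ≤ E j + eps j
  small : j = 0 → (t = pathEnd ∧ b = 1 ∧ c = 1 ∧ d = 1) ∨ (t = pathMid ∧ b = 1 ∧ c = 0 ∧ d = 2)
  eq_zero : b = E j → j % 3 = 0 →
    ((∃ l e q, (kids t).Perm (leaf :: leaf :: l) ∧ P3List l e q) ∧ c = 0) ∨
    (∃ l e q, (kids t).Perm (edge :: l) ∧ P3List l e q ∧ j = 3 * q ∧ c = 1 ∧ d = 1 + e)
  eq_one : b = E j → j % 3 = 1 → 1 ≤ d →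
    ∃ l e q, (kids t).Perm (leaf :: edge :: l) ∧ P3List l e q

/-- Bounds for a tree of order `j + 2` with data `Z o e d`. -/
structure InvZ (t : RT) (j o e d : ℕ) : Prop where
  o_pos : 1 ≤ o
  e_pos : 1 ≤ e
  d_pos : 1 ≤ d
  e_le : e ≤ E j
  sum_le : o + e + d ≤ E j + eps j
  shape : (∃ l f q, (kids t).Perm (leaf :: l) ∧ P3List l f q ∧ j = 3 * q ∧ o = 3 ^ q ∧ e = 1 ∧
    d = 1) ∨ o + d ≤ E j

/-- Bounds for a tree of order `i + 4` with data `P o c d` whose branches are not all paths of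
order three. -/
structure GenP (t : RT) (i o c d : ℕ) : Prop where
  o_pos : 1 ≤ o
  c_pos : 1 ≤ c
  c_le : c ≤ E i
  cd_le : c + d ≤ E i + 1
  oc_le : o + c ≤ 3 * E i
  o_le : o ≤ 2 * E i ∨ o + 2 * c ≤ 3 * E i
  sum_le : o + 2 * c + d ≤ 3 * E i + eps (i + 3)
  shape : (∃ a b c' d', t = join leaf a ∧ InvX a i b c' d' ∧ i ≠ 0 ∧ o = b + c' + d' ∧ c = b ∧
      d = c') ∨
    (o + 2 * c ≤ 3 * E i ∧ o + 2 * c + d ≤ 3 * E i + 1 ∧ (i % 3 = 2 → o + 2 * c + d ≤ 3 * E i))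

/-- Bounds for a tree of order `j + 1` with data `P o c d`. -/
inductive InvP (t : RT) (j o c d : ℕ) : Prop where
  | leaf (ht : t = leaf) (hj : j = 0) (ho : o = 1) (hc : c = 1) (hd : d = 0)
  | paths (q : ℕ) (h : P3List (kids t) d (q + 1)) (hj : j = 3 * (q + 1)) (ho : o = 3 ^ (q + 1))
      (hc : c = 1)
  | gen (i : ℕ) (hj : j = i + 3) (h : GenP t i o c d)

theorem InvX.del_le {t : RT} {j b c d : ℕ} (h : InvX t j b c d) : b + c ≤ E j + 1 :=
  h.bc_le.trans (by have := del_le_one j; omega)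

/-- Compared with the general factor 3 of `InvX.three_mul`, the factor 2 here shows that only paths
of order three can be extremal branches. -/
theorem InvX.two_mul {t : RT} {j b c d : ℕ} (h : InvX t j b c d) (hj : j ≠ 0) :
    b + c + d ≤ 2 * E j := by
  have := h.m_le
  have := eps_le_E hj
  omega

theorem InvX.three_mul {t : RT} {j b c d : ℕ} (h : InvX t j b c d) : b + c + d ≤ 3 * E j := by
  have := E_pos j
  by_cases hj : j = 0
  · rcases h.small hj with h | h <;> omega
  · have := h.two_mul hj; omega

theorem InvX.path {t : RT} {b c d : ℕ} (h : InvX t 0 b c d) :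
    b = 1 ∧ c + d = 2 ∧ c ≤ 1 ∧
      ((t = pathEnd ∧ c = 1) ∨ (t = pathMid ∧ c = 0)) := by
  rcases h.small rfl with ⟨h, h1, h2, h3⟩ | ⟨h, h1, h2, h3⟩
  · exact ⟨h1, by omega, by omega, .inl ⟨h, h2⟩⟩
  · exact ⟨h1, by omega, by omega, .inr ⟨h, h2⟩⟩

theorem InvZ.od_le {t : RT} {j o e d : ℕ} (h : InvZ t j o e d) :
    o ≤ E j ∧ d ≤ E j ∧ o + d ≤ E j + 1 := by
  rcases h.shape with ⟨l, f, q, -, -, rfl, rfl, rfl, rfl⟩ | h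
  · have := E_pos (3 * q)
    rw [E_three_mul] at *
    omega
  · omega

/-- Since `o ≥ 1`, the alternative `o + d ≤ E j` is excluded; in the star alternative `d = 1` forces
`q = 0`. -/
theorem InvZ.eq_edge {t : RT} {j o e d : ℕ} (h : InvZ t j o e d) (hd : d = E j) :
    t = edge ∧ j = 0 ∧ o = 1 ∧ e = 1 ∧ d = 1 := by
  have := h.o_pos
  rcases h.shape with ⟨l, f, q, hk, hl, rfl, rfl, rfl, rfl⟩ | h
  · rw [E_three_mul] at hd
    have hq : q = 0 := by
      have := succ_le_three_pow q
      omega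
    subst hq
    rw [hl.eq_nil, List.perm_singleton] at hk
    refine ⟨?_, rfl, rfl, rfl, rfl⟩
    rw [← ofKids_kids t, hk]
    rfl
  · omega

theorem InvP.pos {t : RT} {j o c d : ℕ} (h : InvP t j o c d) : 1 ≤ o ∧ 1 ≤ c := by
  cases h with
  | leaf _ _ ho hc => omega
  | paths q h hj ho hc => exact ⟨ho ▸ Nat.one_le_pow _ _ (by norm_num), hc.ge⟩
  | gen i hj h => exact ⟨h.o_pos, h.c_pos⟩

theorem InvP.o_le {t : RT} {j o c d : ℕ} (h : InvP t j o c d) : o ≤ E j := by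
  cases h with
  | leaf _ hj ho hc => subst hj ho; rfl
  | paths q h hj ho hc => rw [hj, ho, E_three_mul]
  | gen i hj h => rw [hj, E_add_three]; have := h.oc_le; omega

/-- A tree with data `P` is a single vertex or has a branch of order at least three. -/
theorem InvP.leaf_or {t : RT} {j o c d : ℕ} (h : InvP t j o c d) :
    (t = .leaf ∧ j = 0 ∧ o = 1 ∧ c = 1 ∧ d = 0) ∨ ∃ i, j = i + 3 ∧ c ≤ E i ∧ c + d ≤ E i + 1 := by
  cases h with
  | leaf h1 h2 h3 h4 h5 => exact .inl ⟨h1, h2, h3, h4, h5⟩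
  | paths q h hj ho hc =>
    refine .inr ⟨3 * q, by omega, by rw [hc]; exact E_pos _, ?_⟩
    have := h.le
    have := succ_le_three_pow q
    rw [E_three_mul]
    omega
  | gen i hj h => exact .inr ⟨i, hj, h.c_le, h.cd_le⟩

theorem InvP.m_le {t : RT} {j o c d : ℕ} (h : InvP t j o c d) : c + d ≤ E j := by
  rcases h.leaf_or with ⟨-, rfl, -, rfl, rfl⟩ | ⟨i, rfl, h1, h2⟩
  · rfl
  · have := E_pos i
    rw [E_add_three]
    omega

theorem InvP.eq_leaf {t : RT} {j o c d : ℕ} (h : InvP t j o c d) (hm : c + d = E j) :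
    t = .leaf ∧ j = 0 ∧ c = 1 ∧ d = 0 := by
  cases h with
  | leaf ht hj _ hc hd => exact ⟨ht, hj, hc, hd⟩
  | paths q h hj ho hc =>
    have := h.le
    have := succ_le_three_pow (q + 1)
    rw [hj, E_three_mul] at hm
    omega
  | gen i hj h =>
    have := h.cd_le
    have := E_pos i
    rw [hj, E_add_three] at hm
    omega

theorem InvP.eq_paths {t : RT} {j o c d : ℕ} (h : InvP t j o c d) (ho : o = E j) :
    ∃ q, P3List (kids t) d q ∧ j = 3 * q ∧ c = 1 := by
  cases h with
  | leaf ht hj _ hc hd => exact ⟨0, by subst ht hd; exact .nil, by omega, hc⟩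
  | paths q h hj ho hc => exact ⟨q + 1, h, hj, hc⟩
  | gen i hj h =>
    have := h.oc_le
    have := h.c_pos
    rw [hj, E_add_three] at ho
    omega

/-- `3 ^ p (1 + x) + 3 ^ q ≤ 3 ^ (p + q) + …` for two stars of paths of order three. -/
theorem three_pow_aux {x q : ℕ} (p : ℕ) (hx : x ≤ q) :
    3 ^ q + (1 + x) * 3 ^ p + 1 ≤ 3 ^ (q + p) + q + p + 2 := by
  have h1 := succ_le_three_pow q
  have h2 := succ_le_three_pow p
  rw [pow_add]
  generalize 3 ^ q = a at *
  generalize 3 ^ p = b at *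
  -- After shifting by the lower bounds, the slack is `a * b + 2 * q * b + q + p - x * (b + 1)`,
  -- which `x ≤ q` makes nonnegative.
  obtain ⟨b, rfl⟩ : ∃ b', b = b' + 1 := ⟨b - 1, by omega⟩
  obtain ⟨a, rfl⟩ : ∃ a', a = a' + 1 + 2 * q := ⟨a - 1 - 2 * q, by omega⟩
  nlinarith [Nat.zero_le (a * b), Nat.mul_le_mul_right b hx]

/-- The number of maximum dissociation sets of the tree obtained by joining the roots of a tree
with data `P` and a tree with data `Z`. -/
theorem sum_PZ_le {t₁ t₂ : RT} {i j o₁ c₁ d₁ o₂ e₂ d₂ : ℕ} (h₁ : InvP t₁ i o₁ c₁ d₁)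
    (h₂ : InvZ t₂ j o₂ e₂ d₂) :
    o₁ * d₂ + (c₁ + d₁) * o₂ + c₁ * e₂ ≤ E (i + j) + eps (i + j) := by
  have hs := h₂.sum_le
  cases h₁ with
  | leaf ht hj ho hc hd => subst hj ho hc hd; simp only [zero_add, one_mul, add_zero]; omega
  | paths q h hj ho hc =>
    have hle := h.le
    have hq := succ_le_three_pow (q + 1)
    have heps := eps_add_mul (q + 1) j
    subst hj ho hc
    rcases h₂.shape with ⟨l, f, p, -, -, rfl, rfl, rfl, rfl⟩ | h
    · have := three_pow_aux p hle
      rw [← mul_add, E_three_mul, eps_three_mul]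
      omega
    · rw [E_three_mul_add]
      generalize 3 ^ (q + 1) = a at *
      obtain ⟨a, rfl⟩ : ∃ a', a = a' + 1 := ⟨a - 1, by omega⟩
      nlinarith
  | gen n hj h =>
    subst hj
    have hC := E_pos n
    have hoc := h.oc_le
    rcases h₂.shape with ⟨l, f, p, -, -, rfl, rfl, rfl, rfl⟩ | hD
    · have k1 := h.sum_le
      have k2 := h.cd_le
      have k3 := eps_add_mul p (n + 3)
      rw [show 3 * p + (n + 3) = 3 * (p + 1) + n by ring] at k3
      rw [show n + 3 + 3 * p = 3 * (p + 1) + n by ring, E_three_mul_add, pow_succ]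
      have h3 := succ_le_three_pow p
      generalize 3 ^ p = a at *
      obtain ⟨a, rfl⟩ : ∃ a', a = a' + 1 := ⟨a - 1, by omega⟩
      nlinarith
    · have k1 := E_mul_le (n + 3) j
      rw [E_add_three] at k1
      have k2 := h₂.e_le
      have k3 := h.cd_le
      have k4 := h.c_le
      refine le_trans ?_ (k1.trans (Nat.le_add_right _ _))
      generalize E n = C at *
      generalize E j = D at *
      rcases h.o_le with h5 | h5
      · have k6 := Nat.mul_le_mul_right d₂ h5
        nlinarith
      · have k6 : o₁ * d₂ ≤ (3 * C - c₁) * d₂ := Nat.mul_le_mul_right _ (by omega)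
        have k9 : (3 * C - c₁) * D + c₁ * D = 3 * C * D := by
          rw [← add_mul]; congr 1; omega
        nlinarith

theorem kids_edge_inv {t : RT} {l : List RT} (h : (kids t).Perm l) (s : RT) :
    (kids (join t s)).Perm (s :: l) := List.Perm.cons s h

theorem InvP.join_Z {t₁ t₂ : RT} {i j o₁ c₁ d₁ o₂ e₂ d₂ : ℕ} (h₁ : InvP t₁ i o₁ c₁ d₁)
    (h₂ : InvZ t₂ j o₂ e₂ d₂) :
    InvX (join t₁ t₂) (i + j) (o₁ * d₂) (c₁ * o₂) (d₁ * o₂ + c₁ * e₂) := by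
  obtain ⟨ho₁, hc₁⟩ := h₁.pos
  have hd₂ := h₂.d_pos
  obtain ⟨hoE, hdE, -⟩ := h₂.od_le
  have hEE := E_mul_le i j
  have hb : o₁ * d₂ ≤ E i * E j := Nat.mul_le_mul h₁.o_le hdE
  -- Equality needs both factors maximal: the first makes `t₁` a star of paths of order three, the
  -- second makes `t₂` an edge.
  have key : o₁ * d₂ = E (i + j) → ∃ q, P3List (kids t₁) d₁ q ∧ i = 3 * q ∧ c₁ = 1 ∧
      t₂ = edge ∧ j = 0 ∧ o₂ = 1 ∧ e₂ = 1 ∧ d₂ = 1 := by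
    intro heq
    have h1 := h₁.o_le
    have h3 : o₁ = E i := by
      by_contra hne
      have : o₁ * d₂ < E i * E j := Nat.mul_lt_mul_of_lt_of_le (by omega) hdE (by omega)
      omega
    have h4 : d₂ = E j := by
      by_contra hne
      have : o₁ * d₂ < E i * E j := Nat.mul_lt_mul_of_le_of_lt h1 (by omega) (by omega)
      omega
    obtain ⟨q, hq, hi, hc⟩ := h₁.eq_paths h3
    obtain ⟨a, b, c, d, e⟩ := h₂.eq_edge h4
    exact ⟨q, hq, hi, hc, a, b, c, d, e⟩
  refine ⟨Nat.mul_pos ho₁ hd₂, hb.trans hEE, ?_, ?_, ?_, ?_, ?_⟩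
  · cases h₁ with
    | leaf ht hi ho hc hd =>
      subst hi ho hc hd
      rcases h₂.shape with ⟨l, f, p, -, -, rfl, rfl, rfl, rfl⟩ | h
      · simp [E_three_mul, del, add_comm]
      · simp only [one_mul, zero_add]; omega
    | paths q h hi ho hc =>
      subst hi ho hc
      rcases h₂.shape with ⟨l, f, p, -, -, rfl, rfl, rfl, rfl⟩ | h
      · have h1 := succ_le_three_pow p
        rw [← mul_add, E_three_mul, pow_add 3 (q + 1) p]
        simp only [del, Nat.mul_mod_right, if_true]
        generalize 3 ^ p = x at *
        generalize 3 ^ (q + 1) = y at *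
        obtain ⟨x, rfl⟩ : ∃ x', x = x' + 1 := ⟨x - 1, by omega⟩
        obtain ⟨y, rfl⟩ : ∃ y', y = y' + 1 := ⟨y - 1, by omega⟩
        nlinarith [Nat.zero_le (x * y)]
      · rw [E_three_mul_add]
        have h2 : 1 ≤ 3 ^ (q + 1) := Nat.one_le_pow _ _ (by norm_num)
        nlinarith
    | gen n hi h =>
      subst hi
      refine le_trans ?_ (hEE.trans (Nat.le_add_right _ _))
      rw [E_add_three]
      have h1 := h.oc_le
      rcases h₂.shape with ⟨l, f, p, -, -, rfl, rfl, rfl, rfl⟩ | h2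
      · rw [E_three_mul] at *
        nlinarith
      · have := Nat.mul_le_mul h1 h2
        nlinarith
  · have := sum_PZ_le h₁ h₂
    nlinarith
  · intro h
    obtain ⟨rfl, rfl⟩ : i = 0 ∧ j = 0 := by omega
    have h1 : d₂ = E 0 := by rw [E_zero] at *; omega
    obtain ⟨rfl, -, rfl, rfl, rfl⟩ := h₂.eq_edge h1
    have h3 := h₁.o_le
    rw [E_zero] at h3
    cases h₁ with
    | leaf ht hi ho hc hd => subst ht ho hc hd; exact .inl ⟨rfl, rfl, rfl, rfl⟩
    | paths q h hi => omega
    | gen n hi => omega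
  · intro h _
    obtain ⟨q, hq, rfl, rfl, rfl, rfl, rfl, rfl, rfl⟩ := key h
    exact .inr ⟨kids t₁, d₁, q, List.Perm.refl _, hq, rfl, rfl, by ring⟩
  · intro h h1
    obtain ⟨q, hq, rfl, rfl, rfl, rfl, rfl, rfl, rfl⟩ := key h
    omega

/-- Forgetting the root, this is the same tree as in `InvP.join_Z` with the roles exchanged, so
`sum_PZ_le` bounds the total again; only the split by the state of the root is new. -/
theorem InvZ.join_P {t₁ t₂ : RT} {i j o₁ e₁ d₁ o₂ c₂ d₂ : ℕ} (h₁ : InvZ t₁ i o₁ e₁ d₁)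
    (h₂ : InvP t₂ j o₂ c₂ d₂) :
    InvX (join t₁ t₂) (i + j) (o₁ * (c₂ + d₂)) 0 (d₁ * o₂ + e₁ * c₂) := by
  obtain ⟨ho₂, hc₂⟩ := h₂.pos
  have hd₁ := h₁.d_pos
  have ho₁ := h₁.o_pos
  obtain ⟨hoE, hdE, -⟩ := h₁.od_le
  have hEE := E_mul_le i j
  have hb : o₁ * (c₂ + d₂) ≤ E i * E j := Nat.mul_le_mul hoE h₂.m_le
  have hS := sum_PZ_le h₂ h₁
  have key : o₁ * (c₂ + d₂) = E (i + j) → ∃ l f q, (kids t₁).Perm (leaf :: l) ∧ P3List l f q ∧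
      i = 3 * q ∧ t₂ = leaf ∧ j = 0 := by
    intro heq
    have h1 := h₂.m_le
    have h3 : o₁ = E i := by
      by_contra hne
      have : o₁ * (c₂ + d₂) < E i * E j := Nat.mul_lt_mul_of_lt_of_le (by omega) h1 (by omega)
      omega
    have h4 : c₂ + d₂ = E j := by
      by_contra hne
      have : o₁ * (c₂ + d₂) < E i * E j := Nat.mul_lt_mul_of_le_of_lt hoE (by omega) (by omega)
      omega
    obtain ⟨a, b, -, -⟩ := h₂.eq_leaf h4
    rcases h₁.shape with ⟨l, f, q, hk, hl, hi, -⟩ | h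
    · exact ⟨l, f, q, hk, hl, hi, a, b⟩
    · omega
  refine ⟨Nat.mul_pos ho₁ (by omega), hb.trans hEE, (hb.trans hEE).trans (Nat.le_add_right _ _),
    ?_, ?_, ?_, ?_⟩
  · rw [add_comm i j]
    nlinarith
  · intro h
    obtain ⟨rfl, rfl⟩ : i = 0 ∧ j = 0 := by omega
    have h1 : d₁ = E 0 := by rw [E_zero] at *; omega
    obtain ⟨rfl, -, rfl, rfl, rfl⟩ := h₁.eq_edge h1
    cases h₂ with
    | leaf ht hi ho hc hd => subst ht ho hc hd; exact .inr ⟨rfl, rfl, rfl, rfl⟩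
    | paths q h hi => omega
    | gen n hi => omega
  · intro h _
    obtain ⟨l, f, q, hk, hl, hi, rfl, hj⟩ := key h
    exact .inl ⟨⟨l, f, q, kids_edge_inv hk _, hl⟩, rfl⟩
  · intro h h1
    obtain ⟨l, f, q, hk, hl, hi, rfl, hj⟩ := key h
    omega

/-- If one of the trees satisfies `o + d ≤ E`, the product bound is enough. If both are stars with
an extra leaf, the total is `3 ^ p + 3 ^ q ≤ 3 ^ (p + q) + 1`, and the index has residue 1, where
`eps` is 1. -/
theorem InvZ.join_Z {t₁ t₂ : RT} {i j o₁ e₁ d₁ o₂ e₂ d₂ : ℕ} (h₁ : InvZ t₁ i o₁ e₁ d₁)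
    (h₂ : InvZ t₂ j o₂ e₂ d₂) :
    InvX (join t₁ t₂) (i + j + 1) (o₁ * d₂) 0 (d₁ * o₂) := by
  have hd₁ := h₁.d_pos
  have ho₁ := h₁.o_pos
  have hd₂ := h₂.d_pos
  obtain ⟨hoE, hdE, -⟩ := h₁.od_le
  obtain ⟨hoE₂, hdE₂, -⟩ := h₂.od_le
  have hEE := E_mul_le i j
  have hE' : E (i + j) ≤ E (i + j + 1) := E_mono (by omega)
  have hb : o₁ * d₂ ≤ E i * E j := Nat.mul_le_mul hoE hdE₂
  have key : o₁ * d₂ = E (i + j + 1) → ∃ l f q, (kids t₁).Perm (leaf :: l) ∧ P3List l f q ∧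
      i = 3 * q ∧ t₂ = edge ∧ j = 0 := by
    intro heq
    have h3 : o₁ = E i := by
      by_contra hne
      have : o₁ * d₂ < E i * E j := Nat.mul_lt_mul_of_lt_of_le (by omega) hdE₂ (by omega)
      omega
    have h4 : d₂ = E j := by
      by_contra hne
      have : o₁ * d₂ < E i * E j := Nat.mul_lt_mul_of_le_of_lt hoE (by omega) (by omega)
      omega
    obtain ⟨a, b, -⟩ := h₂.eq_edge h4
    rcases h₁.shape with ⟨l, f, q, hk, hl, hi, -⟩ | h
    · exact ⟨l, f, q, hk, hl, hi, a, b⟩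
    · omega
  refine ⟨Nat.mul_pos ho₁ (by omega), (hb.trans hEE).trans hE',
    ((hb.trans hEE).trans hE').trans (Nat.le_add_right _ _), ?_, ?_, ?_, ?_⟩
  · have aux : o₁ + d₁ ≤ E i → o₁ * d₂ + 0 + d₁ * o₂ ≤ E (i + j + 1) + eps (i + j + 1) := by
      intro h
      refine le_trans ?_ ((hEE.trans hE').trans (Nat.le_add_right _ _))
      nlinarith
    have aux' : o₂ + d₂ ≤ E j → o₁ * d₂ + 0 + d₁ * o₂ ≤ E (i + j + 1) + eps (i + j + 1) := by
      intro h
      refine le_trans ?_ ((hEE.trans hE').trans (Nat.le_add_right _ _))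
      nlinarith
    rcases h₁.shape with ⟨l, f, p, -, -, rfl, rfl, rfl, rfl⟩ | h
    · rcases h₂.shape with ⟨l, f, q, -, -, rfl, rfl, rfl, rfl⟩ | h
      · have h1 := succ_le_three_pow p
        have h2 := succ_le_three_pow q
        rw [show 3 * p + 3 * q + 1 = 3 * (p + q) + 1 by ring, E_three_mul_add, pow_add,
          show E 1 = 1 from rfl, show eps (3 * (p + q) + 1) = 1 by unfold eps; split_ifs <;> omega]
        generalize 3 ^ p = x at *
        generalize 3 ^ q = y at *
        obtain ⟨x, rfl⟩ : ∃ x', x = x' + 1 := ⟨x - 1, by omega⟩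
        obtain ⟨y, rfl⟩ : ∃ y', y = y' + 1 := ⟨y - 1, by omega⟩
        nlinarith [Nat.zero_le (x * y)]
      · exact aux' h
    · exact aux h
  · omega
  · intro h _
    obtain ⟨l, f, q, hk, hl, hi, rfl, hj⟩ := key h
    omega
  · intro h h1 _
    obtain ⟨l, f, q, hk, hl, hi, rfl, hj⟩ := key h
    exact ⟨l, f, q, (kids_edge_inv hk _).trans (List.Perm.swap _ _ _), hl⟩

/-- The index gains two over `i + j`, so in residue 0 the product bound is strict, and in residue 1
the equality clause is void because the last count is 0. -/
theorem InvX.join_Z {t₁ t₂ : RT} {i j b₁ c₁ d₁ o₂ e₂ d₂ : ℕ} (h₁ : InvX t₁ i b₁ c₁ d₁)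
    (h₂ : InvZ t₂ j o₂ e₂ d₂) :
    InvX (join t₁ t₂) (i + j + 2) (b₁ * d₂) 0 0 := by
  obtain ⟨hoE₂, hdE₂, -⟩ := h₂.od_le
  have hEE := E_mul_le i j
  have hE' : E (i + j) ≤ E (i + j + 2) := E_mono (by omega)
  have hb : b₁ * d₂ ≤ E i * E j := Nat.mul_le_mul h₁.b_le hdE₂
  have hle := (hb.trans hEE).trans hE'
  refine ⟨Nat.mul_pos h₁.pos h₂.d_pos, hle, hle.trans (Nat.le_add_right _ _),
    hle.trans (Nat.le_add_right _ _), by omega, ?_, by omega⟩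
  intro heq h0
  have := E_lt_add_two h0
  omega

theorem InvX.join_P {t₁ t₂ : RT} {i j b₁ c₁ d₁ o₂ c₂ d₂ : ℕ} (h₁ : InvX t₁ i b₁ c₁ d₁)
    (h₂ : InvP t₂ j o₂ c₂ d₂) :
    InvX (join t₁ t₂) (i + j + 1) (b₁ * (c₂ + d₂)) 0 (c₁ * c₂) := by
  obtain ⟨ho₂, hc₂⟩ := h₂.pos
  have hEE := E_mul_le i j
  have hE' : E (i + j) ≤ E (i + j + 1) := E_mono (by omega)
  have hb : b₁ * (c₂ + d₂) ≤ E i * E j := Nat.mul_le_mul h₁.b_le h₂.m_le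
  have hle := (hb.trans hEE).trans hE'
  have hE1 := E_pos i
  have hE2 := E_pos j
  refine ⟨Nat.mul_pos h₁.pos (by omega), hle, hle.trans (Nat.le_add_right _ _), ?_, by omega,
    ?_, ?_⟩
  · rcases h₂.leaf_or with ⟨-, rfl, -, rfl, rfl⟩ | ⟨n, rfl, h1, h2⟩
    · have := h₁.bc_le
      have := E_add_del_le i
      simp only [add_zero, mul_one]
      omega
    · have hC := E_pos n
      refine le_trans ?_ ((hEE.trans hE').trans (Nat.le_add_right _ _))
      rw [E_add_three]
      have k3 := Nat.mul_le_mul_right (E n) h₁.del_le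
      have k4 := h₁.b_le
      nlinarith
  · intro heq h0
    have := E_lt_succ h0
    omega
  · intro heq h1 hd
    have h3 : b₁ = E i := by
      by_contra hne
      have := h₁.b_le
      have : b₁ * (c₂ + d₂) < E i * E j := Nat.mul_lt_mul_of_lt_of_le (by omega) h₂.m_le (by omega)
      omega
    have h4 : c₂ + d₂ = E j := by
      by_contra hne
      have := h₂.m_le
      have : b₁ * (c₂ + d₂) < E i * E j :=
        Nat.mul_lt_mul_of_le_of_lt h₁.b_le (by omega) (by omega)
      omega
    obtain ⟨rfl, rfl, rfl, rfl⟩ := h₂.eq_leaf h4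
    -- Of the two extremal trees of residue 0, the one with two leaves has `c₁ = 0`, contradicting
    -- `1 ≤ c₁ * c₂`; the other gains the leaf `t₂`.
    rcases h₁.eq_zero h3 (by omega) with ⟨-, rfl⟩ | ⟨l, e, q, hk, hl, -⟩
    · omega
    · exact ⟨l, e, q, kids_edge_inv hk _, hl⟩

/-- Equality in the first bound requires the full factor 3 from `t₂`, so `t₂` is a path of order
three and the extremal list of `t₁` grows by one entry. -/
theorem InvX.join_X {t₁ t₂ : RT} {i j b₁ c₁ d₁ b₂ c₂ d₂ : ℕ} (h₁ : InvX t₁ i b₁ c₁ d₁)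
    (h₂ : InvX t₂ j b₂ c₂ d₂) :
    InvX (join t₁ t₂) (i + j + 3) (b₁ * (b₂ + c₂ + d₂)) (c₁ * b₂) (d₁ * b₂ + c₁ * c₂) := by
  have hp₁ := h₁.pos
  have hp₂ := h₂.pos
  have hEE : E i * (3 * E j) ≤ E (i + j + 3) := by
    have := E_mul_le i j
    rw [E_add_three]
    nlinarith
  have hE1 := E_pos i
  have hE2 := E_pos j
  have hb : b₁ * (b₂ + c₂ + d₂) ≤ E i * (3 * E j) := Nat.mul_le_mul h₁.b_le h₂.three_mul
  have key : b₁ * (b₂ + c₂ + d₂) = E (i + j + 3) → b₁ = E i ∧ j = 0 := by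
    intro heq
    constructor
    · by_contra hne
      have := h₁.b_le
      have : b₁ * (b₂ + c₂ + d₂) < E i * (3 * E j) :=
        Nat.mul_lt_mul_of_lt_of_le (by omega) h₂.three_mul (by omega)
      omega
    · by_contra hne
      have := h₂.two_mul hne
      have : b₁ * (b₂ + c₂ + d₂) < E i * (3 * E j) :=
        Nat.mul_lt_mul_of_le_of_lt h₁.b_le (by omega) (by omega)
      omega
  have hbc := h₁.bc_le
  have hbl := h₁.b_le
  have hm := h₁.m_le
  have hdel := del_le_one i
  refine ⟨Nat.mul_pos hp₁ (by omega), hb.trans hEE, ?_, ?_, by omega, ?_, ?_⟩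
  · by_cases hj : j = 0
    · subst hj
      obtain ⟨rfl, h, -⟩ := h₂.path
      rw [add_zero, E_add_three, del_add_three, add_assoc 1 c₂ d₂, h]
      omega
    · refine le_trans ?_ (hEE.trans (Nat.le_add_right _ _))
      have k1 := h₂.two_mul hj
      have k2 := h₂.b_le
      nlinarith
  · by_cases hj : j = 0
    · subst hj
      obtain ⟨rfl, h, h', -⟩ := h₂.path
      have := eps_add_del i
      have := Nat.mul_le_mul_left c₁ h'
      rw [add_zero, E_add_three, add_assoc 1 c₂ d₂, h]
      omega
    by_cases hi : i = 0
    · subst hi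
      obtain ⟨rfl, h, h', -⟩ := h₁.path
      have := eps_add_del j
      have := h₂.bc_le
      have := h₂.m_le
      have := h₂.b_le
      rw [zero_add, E_add_three]
      nlinarith
    -- Multiplying out the bounds with their excesses gives at most `3 * E i * E j` plus the cross
    -- term `del i * del j`, because each `eps` is at most the corresponding `E`.
    · have hd : del i * del j ≤ eps (i + j + 3) := by
        unfold del eps; split_ifs <;> omega
      refine le_trans ?_ (Nat.add_le_add hEE hd)
      have k1 := h₂.bc_le
      have k2 := h₂.b_le
      have k3 := h₂.m_le
      have k4 := eps_le_E hi
      have k5 := eps_le_E hj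
      have k6 := del_le_eps i
      have k7 := del_le_eps j
      generalize E i = A at *
      generalize E j = B at *
      generalize del i = δ₁ at *
      generalize del j = δ₂ at *
      generalize eps i = ε₁ at *
      generalize eps j = ε₂ at *
      obtain ⟨x₁, rfl⟩ : ∃ x, ε₁ = δ₁ + x := ⟨ε₁ - δ₁, by omega⟩
      obtain ⟨x₂, rfl⟩ : ∃ x, ε₂ = δ₂ + x := ⟨ε₂ - δ₂, by omega⟩
      -- `b₁ m₂ + (m₁ - b₁) b₂ + c₁ c₂` is bounded through `m` and then through `b + c`.
      have e10 : (A + δ₁ - b₁) * (B + δ₂ - b₂) + b₁ * (B + δ₂) + (A + δ₁) * b₂ =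
          (A + δ₁) * (B + δ₂) + b₁ * b₂ := by
        obtain ⟨u, hu⟩ : ∃ u, A + δ₁ = b₁ + u := ⟨A + δ₁ - b₁, by omega⟩
        obtain ⟨v, hv⟩ : ∃ v, B + δ₂ = b₂ + v := ⟨B + δ₂ - b₂, by omega⟩
        rw [hu, hv, Nat.add_sub_cancel_left, Nat.add_sub_cancel_left]
        ring
      have e11 : c₁ * c₂ ≤ (A + δ₁ - b₁) * (B + δ₂ - b₂) :=
        Nat.mul_le_mul (by omega) (by omega)
      nlinarith
  · intro heq h0
    obtain ⟨hb1, rfl⟩ := key heq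
    obtain ⟨rfl, -, -, h⟩ := h₂.path
    rcases h₁.eq_zero hb1 (by omega) with ⟨⟨l, e, q, hk, hl⟩, rfl⟩ | ⟨l, e, q, hk, hl, rfl, rfl, rfl⟩
    · refine .inl ⟨?_, by simp⟩
      have := (kids_edge_inv hk t₂).trans
        ((List.Perm.swap _ _ _).trans ((List.Perm.swap _ _ _).cons _))
      rcases h with ⟨rfl, -⟩ | ⟨rfl, -⟩
      exacts [⟨_, _, _, this, hl.consEnd⟩, ⟨_, _, _, this, hl.consMid⟩]
    · have := (kids_edge_inv hk t₂).trans (List.Perm.swap _ _ _)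
      rcases h with ⟨rfl, rfl⟩ | ⟨rfl, rfl⟩
      exacts [.inr ⟨_, _, _, this, hl.consEnd, by ring, by simp, by ring⟩,
        .inr ⟨_, _, _, this, hl.consMid, by ring, by simp, by ring⟩]
  · intro heq h1 hd
    obtain ⟨hb1, rfl⟩ := key heq
    obtain ⟨rfl, -, -, h⟩ := h₂.path
    have hc : c₁ = 0 := by
      have : del i = 0 := by unfold del; split_ifs <;> omega
      omega
    subst hc
    obtain ⟨l, e, q, hk, hl⟩ := h₁.eq_one hb1 (by omega) (by simpa using hd)
    have := (kids_edge_inv hk t₂).trans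
      ((List.Perm.swap _ _ _).trans ((List.Perm.swap _ _ _).cons _))
    rcases h with ⟨rfl, -⟩ | ⟨rfl, -⟩
    exacts [⟨_, _, _, this, hl.consEnd⟩, ⟨_, _, _, this, hl.consMid⟩]

/-- Adding a branch with data `X` to a single vertex. -/
theorem InvX.of_single {a : RT} {j b c d : ℕ} (h : InvX a j b c d) :
    InvP (join leaf a) (j + 3) (b + c + d) b c := by
  have hp := h.pos
  by_cases hj : j = 0
  · subst hj
    obtain ⟨rfl, h, -, h1⟩ := h.path
    refine .paths 0 ?_ rfl (by rw [add_assoc, h]; rfl) rfl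
    rcases h1 with ⟨rfl, rfl⟩ | ⟨rfl, rfl⟩
    exacts [P3List.nil.consEnd, P3List.nil.consMid]
  · have h1 := h.two_mul hj
    have h2 := h.b_le
    have h3 := h.bc_le
    have h4 := h.m_le
    have h5 := del_le_one j
    refine .gen j rfl ⟨by omega, hp, h2, by omega, by omega, .inl h1, ?_,
      .inl ⟨a, b, c, d, rfl, h, hj, rfl, rfl, rfl⟩⟩
    unfold del eps at *
    split_ifs at * <;> omega

/-- Both roots want to be selected, so the new edge joins them in every maximum set. The star
alternative of the shape arises only when `t₂` is a single vertex and `t₁` is a single vertex or a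
star of paths of order three. -/
theorem InvP.join_P {t₁ t₂ : RT} {i j o₁ c₁ d₁ o₂ c₂ d₂ : ℕ} (h₁ : InvP t₁ i o₁ c₁ d₁)
    (h₂ : InvP t₂ j o₂ c₂ d₂) :
    InvZ (join t₁ t₂) (i + j) (o₁ * (c₂ + d₂)) (c₁ * o₂) (c₁ * c₂) := by
  obtain ⟨ho₁, hc₁⟩ := h₁.pos
  obtain ⟨ho₂, hc₂⟩ := h₂.pos
  have hEE := E_mul_le i j
  have hc₁' : c₁ ≤ E i := by have := h₁.m_le; omega
  have hwk {x : ℕ} (h : x ≤ E i * E j) : x ≤ E (i + j) + eps (i + j) :=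
    (h.trans hEE).trans (Nat.le_add_right _ _)
  refine ⟨Nat.mul_pos ho₁ (by omega), Nat.mul_pos hc₁ ho₂, Nat.mul_pos hc₁ hc₂,
    (Nat.mul_le_mul hc₁' h₂.o_le).trans hEE, ?_, ?_⟩
  · cases h₁ with
    | leaf ht hi ho hc hd =>
      subst hi ho hc hd
      simp only [zero_add, one_mul]
      cases h₂ with
      | leaf ht hj ho hc hd => subst hj ho hc hd; decide
      | paths q h hj ho hc =>
        subst hj ho hc
        have := h.le
        rw [E_three_mul, eps_three_mul]
        omega
      | gen n hj h =>
        subst hj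
        have := h.sum_le
        rw [E_add_three]
        omega
    | paths q h hi ho hc =>
      subst hi ho hc
      cases h₂ with
      | leaf ht hj ho hc hd =>
        subst hj ho hc hd
        rw [add_zero (3 * (q + 1)), E_three_mul, eps_three_mul]
        omega
      | paths p h' hj ho hc =>
        have := three_pow_aux (p := q + 1) (q := p + 1) h'.le
        subst hj ho hc
        rw [← mul_add, E_three_mul, eps_three_mul, add_comm (q + 1) (p + 1)]
        nlinarith
      | gen n hj h' =>
        subst hj
        have h1 := h'.sum_le
        have h2 := h'.cd_le
        have h3 := eps_add_mul (q + 1) (n + 3)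
        rw [show 3 * (q + 1) + (n + 3) = 3 * (q + 2) + n by ring] at h3
        have hC := E_pos n
        rw [show 3 * (q + 1) + (n + 3) = 3 * (q + 2) + n by ring, E_three_mul_add,
          show 3 ^ (q + 2) = 3 * 3 ^ (q + 1) by ring]
        generalize 3 ^ (q + 1) = a at *
        obtain ⟨a, rfl⟩ : ∃ a', a = a' + 1 := ⟨a - 1, by omega⟩
        nlinarith
    | gen n hi h =>
      have k1 := h.c_le
      subst hi
      cases h₂ with
      | leaf ht hj ho hc hd =>
        subst hj ho hc hd
        have := h.sum_le
        rw [add_zero (n + 3), E_add_three]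
        omega
      | paths q h' hj ho hc =>
        subst hj ho hc
        have hle := h'.le
        have hq := succ_le_three_pow (q + 1)
        apply hwk
        rw [E_three_mul, E_add_three]
        generalize 3 ^ (q + 1) = a at *
        have hd : 2 * (d₂ + 1) ≤ a + 1 := by omega
        rcases h.o_le with h5 | h5
        · have k5 := Nat.mul_le_mul_right (a + 1) h5
          nlinarith
        · have k5 := Nat.mul_le_mul_right (a + 1) h5
          nlinarith
      | gen p hj h' =>
        subst hj
        apply hwk
        rw [E_add_three, E_add_three]
        have k2 := h'.cd_le
        have k3 : o₂ + c₂ ≤ 3 * E p := h'.oc_le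
        rcases h.o_le with h5 | h5
        · have k7 := Nat.mul_le_mul_right (E p) h5
          nlinarith
        · have k7 := Nat.mul_le_mul_right (E p) h5
          nlinarith
  · have aux : o₁ + c₁ ≤ E i → o₁ * (c₂ + d₂) + c₁ * c₂ ≤ E (i + j) := by
      intro h
      refine le_trans ?_ hEE
      have k1 := Nat.mul_le_mul_left o₁ h₂.m_le
      have k2 : c₁ * c₂ ≤ c₁ * E j := Nat.mul_le_mul_left _ (by have := h₂.m_le; omega)
      nlinarith
    rcases h₂.leaf_or with ⟨rfl, rfl, rfl, rfl, rfl⟩ | ⟨n, rfl, h1, h2⟩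
    · cases h₁ with
      | leaf ht hi ho hc hd =>
        subst ht hi ho hc hd
        exact .inl ⟨[], 0, 0, .refl _, .nil, rfl, rfl, rfl, rfl⟩
      | paths q h hi ho hc =>
        subst hi ho hc
        exact .inl ⟨_, _, _, .refl _, h, rfl, by simp, rfl, rfl⟩
      | gen n hi h =>
        refine .inr (aux ?_)
        rw [hi, E_add_three]
        exact h.oc_le
    · right
      have hC := E_pos n
      rcases h₁.leaf_or with ⟨rfl, rfl, rfl, rfl, rfl⟩ | ⟨m, rfl, h4, h5⟩
      · rw [zero_add, E_add_three]
        omega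
      · have hA := E_pos m
        have h6 := h₁.o_le
        refine le_trans ?_ hEE
        rw [E_add_three] at h6 ⊢
        rw [E_add_three]
        nlinarith

/-- A branch of order three prolongs the star; any other branch contributes at most the factor `2 *
E j`, which is enough slack for `o + d ≤ E`. -/
theorem InvZ.join_X {t₁ t₂ : RT} {i j o₁ e₁ d₁ b₂ c₂ d₂ : ℕ} (h₁ : InvZ t₁ i o₁ e₁ d₁)
    (h₂ : InvX t₂ j b₂ c₂ d₂) :
    InvZ (join t₁ t₂) (i + j + 3) (o₁ * (b₂ + c₂ + d₂)) (e₁ * b₂) (d₁ * b₂) := by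
  have hd₁ := h₁.d_pos
  have ho₁ := h₁.o_pos
  have he₁ := h₁.e_pos
  have hp₂ := h₂.pos
  have hb := h₂.b_le
  have hEE : E i * (3 * E j) ≤ E (i + j + 3) := by
    have := E_mul_le i j
    rw [E_add_three]
    nlinarith
  have hwk {x : ℕ} (h : x ≤ E i * (3 * E j)) : x ≤ E (i + j + 3) + eps (i + j + 3) :=
    (h.trans hEE).trans (Nat.le_add_right _ _)
  by_cases hj : j = 0
  · subst hj
    obtain ⟨rfl, h, h', hs⟩ := h₂.path
    rw [add_zero i, add_assoc 1 c₂ d₂, h]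
    refine ⟨by omega, by omega, by omega, by rw [E_add_three]; have := h₁.e_le; omega, ?_, ?_⟩
      <;> rw [E_add_three]
    · have := h₁.od_le
      have := h₁.sum_le
      have := eps_add_del i
      rcases h₁.shape with ⟨l, f, q, -, -, rfl, rfl, rfl, rfl⟩ | h0
      · rw [E_three_mul] at *
        simp only [del, Nat.mul_mod_right, if_true] at *
        rw [eps_three_mul] at *
        omega
      · omega
    · rcases h₁.shape with ⟨l, f, q, hk, hl, rfl, rfl, rfl, rfl⟩ | h0
      · left
        have := (kids_edge_inv hk t₂).trans (List.Perm.swap _ _ _)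
        rcases hs with ⟨rfl, -⟩ | ⟨rfl, -⟩
        exacts [⟨_, _, _, this, hl.consEnd, by ring, by ring, rfl, rfl⟩,
          ⟨_, _, _, this, hl.consMid, by ring, by ring, rfl, rfl⟩]
      · right; omega
  · have h2 := h₂.two_mul hj
    refine ⟨Nat.mul_pos ho₁ (by omega), Nat.mul_pos he₁ hp₂, Nat.mul_pos hd₁ hp₂, ?_, ?_, ?_⟩
    · exact (Nat.mul_le_mul h₁.e_le (by omega)).trans hEE
    · rcases h₁.shape with ⟨l, f, q, -, -, rfl, rfl, rfl, rfl⟩ | h0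
      · rw [E_three_mul] at *
        rcases Nat.eq_zero_or_pos q with rfl | hq
        · rw [show 3 * 0 + j + 3 = j + 3 by ring, E_add_three]
          have := h₂.m_le
          have := eps_add_del j
          simp only [pow_zero, one_mul]
          omega
        · apply hwk
          have h6 : 3 ≤ 3 ^ q := by have := succ_le_three_pow q; omega
          generalize 3 ^ q = a at *
          nlinarith
      · apply hwk
        have k5 := Nat.mul_le_mul_right (E j) h₁.e_le
        nlinarith
    · right
      refine le_trans ?_ hEE
      obtain ⟨h4, h5, h6⟩ := h₁.od_le
      nlinarith

/-- The bounds for a tree whose branches are several trees with data `X`, not all of them paths of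
order three. -/
theorem GenP.of_multi {t : RT} {i o c d : ℕ} (ho : 1 ≤ o) (hc : 1 ≤ c) (hc' : c ≤ E i)
    (hcd : c + d ≤ E i + 1) (h₁ : o + 2 * c ≤ 3 * E i) (h₂ : o + 2 * c + d ≤ 3 * E i + 1)
    (h₃ : i % 3 = 2 → o + 2 * c + d ≤ 3 * E i) : GenP t i o c d := by
  refine ⟨ho, hc, hc', hcd, by omega, .inr h₁, ?_, .inr ⟨h₁, h₂, h₃⟩⟩
  unfold eps
  split_ifs <;> omega

/-- A variant of `GenP.of_multi` with sharper bounds. -/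
theorem GenP.of_le {t : RT} {i o c d B : ℕ} (ho : 1 ≤ o) (hc : 1 ≤ c) (hB : B ≤ E i)
    (hc' : c ≤ B) (hcd : c + d ≤ B) (h₂ : o + 2 * c + d ≤ 3 * B) : GenP t i o c d :=
  .of_multi ho hc (by omega) (by omega) (by omega) (by omega) (fun _ => by omega)

/-- The bounds for a tree with two branches with data `X`. -/
theorem InvX.sum_join_le {a₁ a₂ : RT} {n j b₁ c₁ d₁ b₂ c₂ d₂ F : ℕ} (h₁ : InvX a₁ n b₁ c₁ d₁)
    (h₂ : InvX a₂ j b₂ c₂ d₂) (hn : n ≠ 0) (hF : 3 * (E n * E j) ≤ F) :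
    (b₁ + c₁ + d₁) * (b₂ + c₂ + d₂) + 2 * (b₁ * b₂) ≤ 3 * F ∧
    (b₁ + c₁ + d₁) * (b₂ + c₂ + d₂) + 2 * (b₁ * b₂) + (c₁ * b₂ + b₁ * c₂) ≤ 3 * F + 1 ∧
    ((n + 3 + j) % 3 = 2 →
      (b₁ + c₁ + d₁) * (b₂ + c₂ + d₂) + 2 * (b₁ * b₂) + (c₁ * b₂ + b₁ * c₂) ≤ 3 * F) := by
  have hA := E_pos n
  have hB := E_pos j
  have ha2 := h₁.two_mul hn
  have h3 := h₂.three_mul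
  have e1 := Nat.mul_le_mul ha2 h3
  have e2 : b₁ * (b₂ + c₂) ≤ E n * (E j + 1) := Nat.mul_le_mul h₁.b_le h₂.del_le
  have e3 : (b₁ + c₁) * b₂ ≤ (E n + 1) * E j := Nat.mul_le_mul h₁.del_le h₂.b_le
  have e4 : b₁ * b₂ ≤ E n * E j := Nat.mul_le_mul h₁.b_le h₂.b_le
  have e5 : E n + E j ≤ E n * E j + 1 := by
    obtain ⟨x, hx⟩ : ∃ x, E n = x + 1 := ⟨E n - 1, by omega⟩
    obtain ⟨y, hy⟩ : ∃ y, E j = y + 1 := ⟨E j - 1, by omega⟩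
    rw [hx, hy]
    linarith [Nat.zero_le (x * y)]
  refine ⟨by linarith, by linarith, ?_⟩
  intro hr
  have hma := h₁.m_le
  have hmb := h₂.m_le
  by_cases h6 : n % 3 = 2
  · have h7 : eps n = 0 := by unfold eps; split_ifs <;> omega
    have e6 : (b₁ + c₁ + d₁) * (b₂ + c₂ + d₂) ≤ E n * (3 * E j) :=
      Nat.mul_le_mul (by omega) h3
    linarith
  by_cases h7 : j % 3 = 2
  · have h8 : eps j = 0 := by unfold eps; split_ifs <;> omega
    have e6 : (b₁ + c₁ + d₁) * (b₂ + c₂ + d₂) ≤ 2 * E n * E j :=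
      Nat.mul_le_mul (by omega) (by omega)
    linarith
  · have h8 := h₂.two_mul (by omega)
    have e6 := Nat.mul_le_mul ha2 h8
    linarith

/-- Starting from a single vertex or a star of paths of order three, the first branch that is not
such a path leads to `GenP`, and further branches stay there. -/
theorem InvP.join_X {t₁ t₂ : RT} {i j o₁ c₁ d₁ b₂ c₂ d₂ : ℕ} (h₁ : InvP t₁ i o₁ c₁ d₁)
    (h₂ : InvX t₂ j b₂ c₂ d₂) :
    InvP (join t₁ t₂) (i + j + 3) (o₁ * (b₂ + c₂ + d₂)) (c₁ * b₂) (d₁ * b₂ + c₁ * c₂) := by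
  have hp := h₂.pos
  have hb := h₂.b_le
  have hbc := h₂.del_le
  have hB := E_pos j
  have h3 := h₂.three_mul
  cases h₁ with
  | leaf ht hi ho hc hd =>
    subst ht hi ho hc hd
    simpa using h₂.of_single
  | paths q h hi ho hc =>
    have hle := h.le
    have hq := succ_le_three_pow (q + 1)
    have hq' := succ_le_three_pow q
    subst hi ho hc
    by_cases hj : j = 0
    · subst hj
      obtain ⟨rfl, h0, -, hs⟩ := h₂.path
      rw [add_assoc 1 c₂ d₂, h0]
      refine .paths (q + 1) ?_ (by ring) (by ring) (by simp)
      rcases hs with ⟨rfl, rfl⟩ | ⟨rfl, rfl⟩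
      · simpa [kids] using h.consEnd
      · simpa [kids] using h.consMid
    · have h2 := h₂.two_mul hj
      refine .gen (3 * (q + 1) + j) rfl ?_
      refine .of_multi (Nat.mul_pos (by omega) (by omega)) (by omega) ?_ ?_ ?_ ?_ ?_ <;>
        rw [E_three_mul_add]
      · nlinarith
      · nlinarith
      · nlinarith
      · nlinarith
      · intro hr
        have h4 := h₂.m_le
        have h5 : eps j = 0 := by unfold eps; split_ifs <;> omega
        have k6 : 3 ^ (q + 1) * (b₂ + c₂ + d₂) ≤ 3 ^ (q + 1) * E j :=
          Nat.mul_le_mul_left _ (by omega)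
        nlinarith
  | gen n hi h =>
    subst hi
    have hA := E_pos n
    have hEE : 3 * (E n * E j) ≤ E (n + 3 + j) := by
      have := E_mul_le n j
      rw [show n + 3 + j = n + j + 3 by ring, E_add_three]
      omega
    have ho := h.o_pos
    have hc := h.c_pos
    have hcl := h.c_le
    have hcd := h.cd_le
    have k1 := Nat.mul_le_mul hcl hb
    have hop : 1 ≤ o₁ * (b₂ + c₂ + d₂) := Nat.mul_pos ho (by omega)
    have hcp : 1 ≤ c₁ * b₂ := Nat.mul_pos hc hp
    refine .gen (n + 3 + j) rfl ?_
    have hcd' : c₁ * b₂ + (d₁ * b₂ + c₁ * c₂) ≤ 3 * (E n * E j) := by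
      nlinarith
    -- With a single large branch at the root, `o + 2 * c` need not be bounded by `3 * E n`; the
    -- second branch then has to be estimated together with the first one, by `InvX.sum_join_le`.
    rcases h.shape with ⟨a, b, c', d', -, ha, hn, rfl, rfl, rfl⟩ | ⟨h4, h5, -⟩
    · obtain ⟨e1, e2, e3⟩ := ha.sum_join_le h₂ hn hEE
      exact .of_multi hop hcp (by omega) (by omega) e1 e2 e3
    · have e1 : (o₁ + c₁) * (b₂ + c₂ + d₂) ≤ (o₁ + c₁) * (3 * E j) := Nat.mul_le_mul_left _ h3
      have e2 : (c₁ + d₁) * b₂ ≤ (c₁ + d₁) * E j := Nat.mul_le_mul_left _ hb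
      have e3 : (3 * o₁ + 4 * c₁ + d₁) * E j ≤ (9 * E n) * E j :=
        Nat.mul_le_mul_right _ (by omega)
      exact .of_le hop hcp hEE (by linarith) hcd' (by linarith [Nat.zero_le (c₁ * d₂)])

/-- The bounds for the data of a tree. -/
def RT.Bounds (t : RT) : Prop :=
  match t.data with
  | .X b c d => ∃ j, t.size = j + 3 ∧ InvX t j b c d
  | .P o c d => ∃ j, t.size = j + 1 ∧ InvP t j o c d
  | .Z o e d => ∃ j, t.size = j + 2 ∧ InvZ t j o e d

theorem RT.bounds (t : RT) : t.Bounds := by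
  induction t with
  | leaf => exact ⟨0, rfl, .leaf rfl rfl rfl rfl rfl⟩
  | join t s iht ihs =>
    unfold RT.Bounds at *
    simp only [RT.data, RT.size]
    rcases ht : t.data with ⟨b₁, c₁, d₁⟩ | ⟨b₁, c₁, d₁⟩ | ⟨b₁, c₁, d₁⟩ <;>
    rcases hs : s.data with ⟨b₂, c₂, d₂⟩ | ⟨b₂, c₂, d₂⟩ | ⟨b₂, c₂, d₂⟩ <;>
    rw [ht] at iht <;> rw [hs] at ihs <;>
    obtain ⟨i, hi, iht⟩ := iht <;> obtain ⟨j, hj, ihs⟩ := ihs <;>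
    rw [hi, hj]
    · exact ⟨_, by ring, iht.join_X ihs⟩
    · exact ⟨_, by ring, iht.join_P ihs⟩
    · exact ⟨_, by ring, iht.join_Z ihs⟩
    · exact ⟨_, by ring, iht.join_X ihs⟩
    · exact ⟨_, by ring, iht.join_P ihs⟩
    · exact ⟨_, by ring, iht.join_Z ihs⟩
    · exact ⟨_, by ring, iht.join_X ihs⟩
    · exact ⟨_, by ring, iht.join_P ihs⟩
    · exact ⟨_, by ring, iht.join_Z ihs⟩

/-! ### The extremal problem for weights -/

/-- The number of maximum dissociation sets of the potted graph with cycle of order `3 * t + 2`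
and a tree with the given data at a vertex of the cycle. -/
def Data.weight (t : ℕ) : Data → ℕ
  | .X b _ _ => (t + 1) * b
  | .P o c d => (t + 1) * o + (2 * t + 1) * c + d
  | .Z o _ d => (t + 1) * o + d

/-- The weight equals `t * (o + 2 * c) + (o + 2 * c + d) - c`, and `c ≥ 1` absorbs the excess 1 of
the second hypothesis. -/
theorem weight_P_le {o c d t B : ℕ} (hc : 1 ≤ c)
    (h₁ : o + 2 * c ≤ B) (h₂ : o + 2 * c + d ≤ B + 1) :
    (Data.P o c d).weight t ≤ (t + 1) * B ∧
      (o + 2 * c + d ≤ B → (Data.P o c d).weight t < (t + 1) * B) := by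
  simp only [Data.weight]
  constructor
  · nlinarith
  · intro h; nlinarith

/-- The weight is `(t + 1) * (o + d) - t * d`. -/
theorem weight_Z_lt {o d t B : ℕ} (e : ℕ) (ht : 1 ≤ t) (hd : 1 ≤ d) (h : o + d ≤ B) :
    (Data.Z o e d).weight t < (t + 1) * B := by
  simp only [Data.weight]
  nlinarith

theorem E_eq {j s : ℕ} (h : j / 3 = s) : E j = 3 ^ s := by unfold E; rw [h]

/-- For an order divisible by three, data `X` have an index of residue 0 and `InvX.eq_zero` lists
the equality cases. Data `P` and `Z` have residue 2, where `eps` vanishes, and stay strictly below.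
-/
theorem weight_le_of_mod_two (T : RT) {s t : ℕ} (hs : 1 ≤ s) (ht : 1 ≤ t)
    (hT : T.size = 3 * s + 3) :
    T.data.weight t ≤ (t + 1) * 3 ^ s ∧ (T.data.weight t = (t + 1) * 3 ^ s →
      ∃ l e q, P3List l e q ∧
        ((kids T).Perm (edge :: l) ∨ (kids T).Perm (leaf :: leaf :: l))) := by
  obtain ⟨s, rfl⟩ : ∃ s', s = s' + 1 := ⟨s - 1, by omega⟩
  have key : T.data.weight t < (t + 1) * 3 ^ (s + 1) → T.data.weight t ≤ (t + 1) * 3 ^ (s + 1) ∧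
    (T.data.weight t = (t + 1) * 3 ^ (s + 1) → ∃ l e q, P3List l e q ∧
      ((kids T).Perm (edge :: l) ∨ (kids T).Perm (leaf :: leaf :: l))) :=
    fun h => ⟨h.le, fun h' => absurd h' h.ne⟩
  have hb := T.bounds
  unfold RT.Bounds at hb
  rcases hd : T.data with ⟨b, c, d⟩ | ⟨o, c, d⟩ | ⟨o, e, d⟩ <;> rw [hd] at hb key <;>
    obtain ⟨j, hj, h⟩ := hb
  · have hE : E j = 3 ^ (s + 1) := E_eq (by omega)
    simp only [Data.weight]
    have hb := h.b_le
    rw [hE] at hb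
    refine ⟨Nat.mul_le_mul_left _ hb, fun heq => ?_⟩
    have hbE : b = E j := by rw [hE]; exact Nat.eq_of_mul_eq_mul_left (by omega) heq
    rcases h.eq_zero hbE (by omega) with ⟨⟨l, e, q, h1, h2⟩, -⟩ | ⟨l, e, q, h1, h2, -⟩
    exacts [⟨l, e, q, h2, .inr h1⟩, ⟨l, e, q, h2, .inl h1⟩]
  · apply key
    cases h with
    | leaf _ h => omega
    | paths q _ h => omega
    | gen i hi h =>
      have hE : E i = 3 ^ s := E_eq (by omega)
      have hc := h.c_pos
      rcases h.shape with ⟨a, b, c', d', -, ha, hi0, rfl, rfl, rfl⟩ | ⟨h1, h2, h3⟩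
      · have hm := ha.m_le
        have h0 : eps i = 0 := by unfold eps; split_ifs <;> omega
        rw [hE, h0] at hm
        simp only [Data.weight]
        have k1 := Nat.mul_le_mul_left (t + 1) hm
        have k2 : (2 * t + 1) * (c + d) ≤ (2 * t + 1) * 3 ^ s := Nat.mul_le_mul_left _ (by omega)
        have k3 : 0 ≤ t * d := Nat.zero_le _
        rw [pow_succ]
        linarith
      · rw [hE] at *
        have := (weight_P_le (t := t) hc h1 h2).2 (h3 (by omega))
        rwa [pow_succ, mul_comm (3 ^ s) 3]
  · apply key
    have hE : E j = 3 ^ (s + 1) := E_eq (by omega)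
    rcases h.shape with ⟨_, _, q, -, -, h, -⟩ | h'
    · omega
    · rw [hE] at h'
      exact weight_Z_lt e ht h.d_pos h'

/-- Two values compete, one from data `Z` and one from data `P`, and which is larger depends on `s`
and `t`. Every other tree is strictly below at least one of them, which is all that a maximum needs.
-/
theorem weight_of_mod_one (T : RT) {s t : ℕ} (ht : 1 ≤ t) (hT : T.size = 3 * s + 5) :
    (T.data.weight t = (t + 1) * 3 ^ (s + 1) + 1 ∧
      ∃ l e q, P3List l e q ∧ (kids T).Perm (leaf :: l)) ∨
    (T.data.weight t = (3 * t + 2) * 3 ^ s + (t + 1) ∧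
      ∃ a l e q, T = join leaf a ∧ P3List l e q ∧ (kids a).Perm (leaf :: edge :: l)) ∨
    T.data.weight t < (t + 1) * 3 ^ (s + 1) + 1 ∨
    T.data.weight t < (3 * t + 2) * 3 ^ s + (t + 1) := by
  have hb := T.bounds
  unfold RT.Bounds at hb
  rcases hd : T.data with ⟨b, c, d⟩ | ⟨o, c, d⟩ | ⟨o, e, d⟩ <;> rw [hd] at hb <;>
    obtain ⟨j, hj, h⟩ := hb
  · right; right; left
    have hE : E j = 3 ^ s := E_eq (by omega)
    have hb := h.b_le
    rw [hE] at hb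
    simp only [Data.weight, pow_succ]
    nlinarith
  · cases h with
    | leaf _ h => omega
    | paths q _ h => omega
    | gen i hi h =>
      have hE : E i = 3 ^ s := E_eq (by omega)
      have hc := h.c_pos
      rcases h.shape with ⟨a, b, c', d', hT', ha, hi0, rfl, rfl, rfl⟩ | ⟨h1, h2, -⟩
      · have hm := ha.m_le
        have hbc := ha.bc_le
        have hr : i % 3 = 1 := by omega
        have h0 : eps i = 1 := by unfold eps; split_ifs <;> omega
        have h1 : del i = 0 := by unfold del; split_ifs <;> omega
        have hst := ha.eq_one
        rw [hE, h1] at hbc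
        rw [hE, h0] at hm
        rw [hE] at hst
        simp only [Data.weight]
        -- The branch `a` has `c + d ≤ 3 ^ s` and total at most `3 ^ s + 1`, so the value is
        -- attained only with `c = 3 ^ s`, `d = 0`, `d' = 1`; then `InvX.eq_one` identifies `a`.
        by_cases heq : c = 3 ^ s ∧ 1 ≤ d'
        · obtain ⟨l, e, q, hk, hl⟩ := hst heq.1 hr heq.2
          right; left
          refine ⟨?_, a, l, e, q, hT', hl, hk⟩
          obtain ⟨rfl, rfl⟩ : d = 0 ∧ d' = 1 := by omega
          rw [heq.1]
          ring
        · right; right; right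
          by_cases hc3 : c = 3 ^ s
          · obtain ⟨rfl, rfl⟩ : d = 0 ∧ d' = 0 := by omega
            rw [hc3]
            nlinarith
          · have k1 := Nat.mul_le_mul_left (t + 1) hm
            have k2 : (2 * t + 1) * (c + 1) ≤ (2 * t + 1) * 3 ^ s :=
              Nat.mul_le_mul_left _ (by omega)
            rcases Nat.eq_zero_or_pos d with rfl | hd0
            · nlinarith
            · have k3 : (2 * t + 1) * (c + d) ≤ (2 * t + 1) * 3 ^ s :=
                Nat.mul_le_mul_left _ (by omega)
              nlinarith
      · right; right; left
        rw [hE] at *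
        have := (weight_P_le (t := t) hc h1 h2).1
        rw [pow_succ, mul_comm (3 ^ s) 3]
        omega
  · have hE : E j = 3 ^ (s + 1) := E_eq (by omega)
    rcases h.shape with ⟨l, f, q, h1, h2, h3, rfl, rfl, rfl⟩ | h'
    · obtain rfl : q = s + 1 := by omega
      exact .inl ⟨rfl, l, f, _, h2, h1⟩
    · right; right; left
      rw [hE] at h'
      exact (weight_Z_lt e ht h.d_pos h').trans (Nat.lt_succ_self _)

/-- Again there are two competing values, both from data `P`: a star of paths of order three, or a
single large branch. In each the number of paths attached by an end enters with a positive
coefficient, so at equality all of them are. -/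
theorem weight_of_mod_zero (T : RT) {s t : ℕ} (ht : 1 ≤ t) (hT : T.size = 3 * s + 4) :
    (T.data.weight t = (t + 1) * 3 ^ (s + 1) + (2 * t + 1) + (s + 1) ∧
      P3List (kids T) (s + 1) (s + 1)) ∨
    (T.data.weight t = (t + 1) * (3 ^ s + s + 2) + (2 * t + 1) * 3 ^ s + 1 ∧
      ∃ a l, T = join leaf a ∧ P3List l s s ∧ (kids a).Perm (edge :: l)) ∨
    T.data.weight t < (t + 1) * 3 ^ (s + 1) + (2 * t + 1) + (s + 1) ∨
    T.data.weight t < (t + 1) * (3 ^ s + s + 2) + (2 * t + 1) * 3 ^ s + 1 := by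
  have hb := T.bounds
  unfold RT.Bounds at hb
  rcases hd : T.data with ⟨b, c, d⟩ | ⟨o, c, d⟩ | ⟨o, e, d⟩ <;> rw [hd] at hb <;>
    obtain ⟨j, hj, h⟩ := hb
  · right; right; left
    have hE : E j = 3 ^ s := E_eq (by omega)
    have hb := h.b_le
    rw [hE] at hb
    simp only [Data.weight, pow_succ]
    nlinarith
  · cases h with
    | leaf _ h => omega
    | paths q h1 h2 ho hc =>
      obtain rfl : q = s := by omega
      have hle := h1.le
      simp only [Data.weight]
      subst ho hc
      by_cases hds : d = q + 1
      · subst hds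
        exact .inl ⟨by ring, h1⟩
      · right; right; left
        omega
    | gen i hi h =>
      have hE : E i = 3 ^ s := E_eq (by omega)
      have hc := h.c_pos
      rcases h.shape with ⟨a, b, c', d', hT', ha, hi0, rfl, rfl, rfl⟩ | ⟨h1, h2, -⟩
      · have hm := ha.m_le
        have hbc := ha.bc_le
        obtain rfl : i = 3 * s := by omega
        have h1 : del (3 * s) = 1 := by unfold del; split_ifs <;> omega
        have hst := ha.eq_zero
        have hcE := ha.b_le
        rw [E_three_mul, h1] at hbc
        rw [E_three_mul, eps_three_mul] at hm
        rw [E_three_mul] at hst hcE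
        simp only [Data.weight]
        right
        by_cases heq : c = 3 ^ s
        -- A branch with two leaves has `d = 0` and misses the final `+ 1`; a branch with an edge
        -- loses `t + 1` for each path attached by its centre.
        · rcases hst heq (by omega) with ⟨-, rfl⟩ | ⟨l, e, q, hk, hl, hq, rfl, rfl⟩
          · right; right
            have := Nat.mul_le_mul_left (t + 1) hm
            rw [← heq] at *
            linarith
          · obtain rfl : q = s := by omega
            by_cases heq' : e = q
            · left
              subst heq'
              refine ⟨?_, a, l, hT', hl, hk⟩
              rw [heq]
              ring
            · right; right
              have : (t + 1) * (c + 1 + (1 + e) + 1) ≤ (t + 1) * (c + q + 2) :=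
                Nat.mul_le_mul_left _ (by omega)
              rw [← heq]
              linarith
        · right; right
          have k1 := Nat.mul_le_mul_left (t + 1) hm
          rcases Nat.eq_zero_or_pos d with rfl | hd0
          · have k2 := Nat.mul_le_mul_left (2 * t + 1) hcE
            linarith
          · obtain ⟨x, hx⟩ : ∃ x, 3 ^ s = c + x := ⟨3 ^ s - c, by omega⟩
            have hx1 : 1 ≤ x := by omega
            have k3 := Nat.mul_le_mul_left t hx1
            rw [hx] at k1 ⊢
            linarith
      · right; right; left
        rw [hE] at *
        have := (weight_P_le (t := t) hc h1 h2).1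
        rw [pow_succ, mul_comm (3 ^ s) 3]
        omega
  · right; right; left
    have hE : E j = 3 ^ s := E_eq (by omega)
    rcases h.shape with ⟨l, f, q, h1, h2, h3, -⟩ | h'
    · omega
    · rw [hE] at h'
      have := weight_Z_lt e ht h.d_pos h'
      rw [pow_succ]
      linarith [Nat.zero_le ((t + 1) * 3 ^ s)]

theorem P3List.data {l : List RT} {e q : ℕ} (h : P3List l e q) :
    (ofKids l).data = .P (3 ^ q) 1 e := by
  induction h with
  | nil => rfl
  | consEnd h ih =>
    simp only [ofKids, RT.data, ih, pathEnd, edge, Data.join]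
    norm_num [pow_succ]
  | consMid h ih =>
    simp only [ofKids, RT.data, ih, pathMid, edge, Data.join]
    norm_num [pow_succ]

theorem P3List.size {l : List RT} {e q : ℕ} (h : P3List l e q) :
    (ofKids l).size = 3 * q + 1 := by
  induction h with
  | nil => rfl
  | consEnd h ih => simp only [ofKids, RT.size, ih, pathEnd, edge]; ring
  | consMid h ih => simp only [ofKids, RT.size, ih, pathMid, edge]; ring

/-! ### Leading coefficients of generating polynomials -/

open Polynomial

/-- `p` has degree at most `n`, and its coefficient at `n` is `c`. -/
def Top (p : ℕ[X]) (n c : ℕ) : Prop := p.natDegree ≤ n ∧ p.coeff n = c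

namespace Top

theorem mul {p q : ℕ[X]} {m n c d : ℕ} (hp : Top p m c) (hq : Top q n d) :
    Top (p * q) (m + n) (c * d) :=
  ⟨natDegree_mul_le_of_le hp.1 hq.1, by rw [coeff_mul_add_eq_of_natDegree_le hp.1 hq.1, hp.2, hq.2]⟩

theorem add {p q : ℕ[X]} {n c d : ℕ} (hp : Top p n c) (hq : Top q n d) :
    Top (p + q) n (c + d) :=
  ⟨natDegree_add_le_of_degree_le hp.1 hq.1, by rw [coeff_add, hp.2, hq.2]⟩

theorem lift {p : ℕ[X]} {m n c : ℕ} (hp : Top p m c) (h : m < n) : Top p n 0 :=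
  ⟨hp.1.trans h.le, coeff_eq_zero_of_natDegree_lt (hp.1.trans_lt h)⟩

theorem congr {p : ℕ[X]} {m n c d : ℕ} (hp : Top p m c) (h : m = n) (h' : c = d) : Top p n d :=
  h ▸ h' ▸ hp

theorem X : Top (X : ℕ[X]) 1 1 := ⟨natDegree_X_le, coeff_X_one⟩

theorem one : Top (1 : ℕ[X]) 0 1 := ⟨by simp, by simp⟩

theorem zero (n : ℕ) : Top (0 : ℕ[X]) n 0 := ⟨by simp, by simp⟩

end Top

/-- The generating polynomials, by size, of the dissociation sets of a rooted tree leaving the root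
out (`o`), containing it as an isolated vertex (`z`) and with degree one (`d`). -/
structure Pol where
  /-- the root is left out -/
  o : ℕ[X]
  /-- the root is isolated -/
  z : ℕ[X]
  /-- the root has degree one -/
  d : ℕ[X]

namespace Pol

/-- The generating polynomial of all dissociation sets. -/
noncomputable def tot (p : Pol) : ℕ[X] := p.o + p.z + p.d

/-- The effect of adding a branch at the root. -/
noncomputable def join (p q : Pol) : Pol := ⟨p.o * q.tot, p.z * q.o, p.d * q.o + p.z * q.z⟩

/-- The leading coefficients of `p` are those given by the data, at the level `a`. -/
def Fits (p : Pol) (a : ℕ) : Data → Prop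
  | .X b c d => Top p.o a b ∧ Top p.z a c ∧ Top p.d a d
  | .P o c d => Top p.o a o ∧ Top p.z (a + 1) c ∧ Top p.d (a + 1) d
  | .Z o e d => Top p.o a o ∧ Top p.z a e ∧ Top p.d (a + 1) d

end Pol

/-- The increase of the level from a branch with the given data. -/
def Data.extra : Data → ℕ
  | .X _ _ _ => 0
  | _ => 1

/-- `Data.join` is the leading part of `Pol.join`: in each of the nine cases, `Top.lift` discards
the products of too small degree. -/
theorem Pol.Fits.join {p q : Pol} {a b : ℕ} {D D' : Data} (hp : p.Fits a D) (hq : q.Fits b D') :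
    (p.join q).Fits (a + b + D'.extra) (D.join D') := by
  rcases D with ⟨b₁, c₁, d₁⟩ | ⟨b₁, c₁, d₁⟩ | ⟨b₁, c₁, d₁⟩ <;>
  rcases D' with ⟨b₂, c₂, d₂⟩ | ⟨b₂, c₂, d₂⟩ | ⟨b₂, c₂, d₂⟩ <;>
  obtain ⟨h1, h2, h3⟩ := hp <;> obtain ⟨h4, h5, h6⟩ := hq <;>
  simp only [Data.join, Pol.Fits, Pol.join, Pol.tot, Data.extra]
  · exact ⟨h1.mul ((h4.add h5).add h6), h2.mul h4, (h3.mul h4).add (h2.mul h5)⟩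
  · exact ⟨(h1.mul (((h4.lift (Nat.lt_add_one _)).add h5).add h6)).congr (by ring) (by ring),
      (h2.mul h4).lift (by omega),
      (((h3.mul h4).lift (by omega)).add ((h2.mul h5).congr (by ring) rfl)).congr rfl (by ring)⟩
  · exact ⟨(h1.mul (((h4.lift (Nat.lt_add_one _)).add (h5.lift (Nat.lt_add_one _))).add
      h6)).congr (by ring) (by ring), (h2.mul h4).lift (by omega),
      (((h3.mul h4).lift (by omega)).add ((h2.mul h5).lift (by omega))).congr rfl (by ring)⟩
  · exact ⟨h1.mul ((h4.add h5).add h6), (h2.mul h4).congr (by ring) rfl,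
      ((h3.mul h4).add (h2.mul h5)).congr (by ring) rfl⟩
  · exact ⟨(h1.mul (((h4.lift (Nat.lt_add_one _)).add h5).add h6)).congr (by ring) (by ring),
      (h2.mul h4).congr (by ring) rfl,
      (((h3.mul h4).lift (by omega)).add ((h2.mul h5).congr (by ring) rfl)).congr rfl (by ring)⟩
  · exact ⟨(h1.mul (((h4.lift (Nat.lt_add_one _)).add (h5.lift (Nat.lt_add_one _))).add
      h6)).congr (by ring) (by ring), (h2.mul h4).congr (by ring) rfl,
      ((h3.mul h4).add (h2.mul h5)).congr (by ring) rfl⟩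
  · exact ⟨h1.mul ((h4.add h5).add h6), h2.mul h4,
      (((h3.mul h4).congr (by ring) rfl).add ((h2.mul h5).lift (by omega))).congr rfl (by ring)⟩
  · exact ⟨(h1.mul (((h4.lift (Nat.lt_add_one _)).add h5).add h6)).congr (by ring) (by ring),
      (h2.mul h4).lift (by omega),
      ((h3.mul h4).congr (by ring) rfl).add ((h2.mul h5).congr (by ring) rfl)⟩
  · exact ⟨(h1.mul (((h4.lift (Nat.lt_add_one _)).add (h5.lift (Nat.lt_add_one _))).add
      h6)).congr (by ring) (by ring), (h2.mul h4).lift (by omega),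
      (((h3.mul h4).congr (by ring) rfl).add ((h2.mul h5).lift (by omega))).congr rfl (by ring)⟩

/-- The generating polynomials of a rooted tree. -/
noncomputable def RT.pol : RT → Pol
  | .leaf => ⟨1, X, 0⟩
  | .join t s => (pol t).join (pol s)

theorem RT.fits_leaf : (RT.pol leaf).Fits 0 (.P 1 1 0) := ⟨Top.one, Top.X, Top.zero _⟩

theorem RT.exists_fits (t : RT) : ∃ a, t.pol.Fits a t.data := by
  induction t with
  | leaf => exact ⟨0, fits_leaf⟩
  | join t s iht ihs =>
    obtain ⟨a, ha⟩ := iht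
    obtain ⟨b, hb⟩ := ihs
    exact ⟨_, ha.join hb⟩

/-- The path with `n + 1` vertices, rooted at an end. -/
def RT.path : ℕ → RT
  | 0 => leaf
  | n + 1 => join leaf (path n)

/-- Prolonging a path by a vertex cycles through the types `P`, `Z`, `X`. The coefficient `c`
belongs to a lower level and does not affect the totals, so it is left unspecified. -/
theorem RT.fits_path (t : ℕ) :
    (∃ c, (path (3 * t)).pol.Fits (2 * t) (.P c 1 t)) ∧
      ∃ c, (path (3 * t + 1)).pol.Fits (2 * t + 1) (.Z (t + 1) c 1) := by
  have step {n a c : ℕ} {t : ℕ} (h : (path n).pol.Fits a (.P c 1 t)) :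
      (path (n + 1)).pol.Fits (a + 1) (.Z (t + 1) c 1) := by
    have := RT.fits_leaf.join h
    simp only [Data.join, Data.extra, one_mul, zero_add] at this
    rwa [add_comm 1 t] at this
  suffices h : ∃ c, (path (3 * t)).pol.Fits (2 * t) (.P c 1 t) from
    ⟨h, h.imp fun c hc => step hc⟩
  induction t with
  | zero => exact ⟨1, RT.fits_leaf⟩
  | succ t ih =>
    obtain ⟨c, h⟩ := ih
    have h2 := RT.fits_leaf.join (step h)
    have h3 := RT.fits_leaf.join h2
    simp only [Data.join, Data.extra, one_mul, zero_add, zero_mul, add_zero] at h3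
    exact ⟨_, h3⟩

theorem RT.top_path (t : ℕ) : Top (path (3 * t)).pol.tot (2 * t + 1) (t + 1) ∧
    Top (path (3 * t + 1)).pol.tot (2 * t + 2) 1 := by
  obtain ⟨⟨c, h1, h2, h3⟩, c', h4, h5, h6⟩ := RT.fits_path t
  exact ⟨(((h1.lift (Nat.lt_add_one _)).add h2).add h3).congr rfl (by ring),
    (((h4.lift (Nat.lt_add_one _)).add (h5.lift (Nat.lt_add_one _))).add h6).congr rfl
      (by ring)⟩

/-- The leading coefficient of the generating polynomial of a potted graph. -/
theorem RT.top_potted (T : RT) (t : ℕ) : ∃ a, Top (T.pol.o * (path (3 * t + 3)).pol.tot +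
    (T.pol.z + T.pol.d) * (path (3 * t + 1)).pol.tot +
    2 * (T.pol.z * (X * (path (3 * t)).pol.tot))) a (T.data.weight (t + 1)) := by
  obtain ⟨a, h⟩ := T.exists_fits
  have p1 := (RT.top_path (t + 1)).1
  have p2 := (RT.top_path t).2
  have p3 := Top.X.mul (RT.top_path t).1
  have p4 : Top (2 : ℕ[X]) 0 2 :=
    ⟨natDegree_ofNat 2 |>.le, by rw [← C_ofNat, coeff_C_zero]⟩
  -- The first path factor has degree `2 * t + 3`, the other two `2 * t + 2`; the missing vertex is
  -- made up only where selecting the root of the tree gains one.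
  refine ⟨a + (2 * t + 3), ?_⟩
  rcases hd : T.data with ⟨b, c, d⟩ | ⟨o, c, d⟩ | ⟨o, e, d⟩ <;> rw [hd] at h <;>
    obtain ⟨h1, h2, h3⟩ := h <;> simp only [Data.weight]
  · exact (((h1.mul p1).add (((h2.add h3).mul p2).lift (by omega))).add
      ((p4.mul (h2.mul p3)).lift (by omega))).congr (by ring) (by ring)
  · exact ((((h1.mul p1).congr (by ring) rfl).add
      (((h2.add h3).mul p2).congr (by ring) rfl)).add
      ((p4.mul (h2.mul p3)).congr (by ring) rfl)).congr rfl (by ring)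
  · exact ((((h1.mul p1).congr (by ring) rfl).add
      ((((h2.lift (Nat.lt_add_one _)).add h3).mul p2).congr (by ring) rfl)).add
      ((p4.mul (h2.mul p3)).lift (by omega))).congr rfl (by ring)

/-! ### Dissociation sets of coded trees -/

/-- The code `t` describes the subgraph of `G` induced on `S`, rooted at `r`. -/
def Realizes {V : Type u} (G : SimpleGraph V) : RT → Set V → V → Prop
  | .leaf, S, r => S = {r}
  | .join t s, S, r => ∃ (S₁ S₂ : Set V) (c : V), Realizes G t S₁ r ∧ Realizes G s S₂ c ∧
      Disjoint S₁ S₂ ∧ S = S₁ ∪ S₂ ∧ ∀ x ∈ S₁, ∀ y ∈ S₂, G.Adj x y ↔ x = r ∧ y = c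

theorem Realizes.mem {V : Type u} {G : SimpleGraph V} {t : RT} {S : Set V} {r : V}
    (h : Realizes G t S r) : r ∈ S := by
  induction t generalizing S r with
  | leaf => rw [show S = {r} from h]; rfl
  | join t s iht _ =>
    obtain ⟨S₁, S₂, c, h1, -, -, rfl, -⟩ := h
    exact .inl (iht h1)

/-- No vertex has two neighbours inside `A`, for `A` regarded as a graph induced by `G`. -/
def Diss {V : Type u} (G : SimpleGraph V) (A : Finset V) : Prop :=
  ∀ v ∈ A, ∀ x ∈ A, ∀ y ∈ A, G.Adj v x → G.Adj v y → x = y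

open Classical in
-- A violation not inside one part uses a crossing edge, and all of these start at `r`. A predicate
-- `N` serves both uses: one neighbour for a branch, two for the rest of the cycle.
theorem diss_union {V : Type u} {G : SimpleGraph V} {S₁ S₂ : Set V} (hd : Disjoint S₁ S₂) {r : V} {N : V → Prop}
    (hadj : ∀ x ∈ S₁, ∀ y ∈ S₂, G.Adj x y ↔ x = r ∧ N y) {A₁ A₂ : Finset V}
    (h₁ : (A₁ : Set V) ⊆ S₁) (h₂ : (A₂ : Set V) ⊆ S₂) :
    Diss G (A₁ ∪ A₂) ↔ Diss G A₁ ∧ Diss G A₂ ∧ (r ∈ A₁ → ∀ y ∈ A₂, N y →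
      (∀ x ∈ A₁, ¬G.Adj r x) ∧ (∀ x ∈ A₂, ¬G.Adj y x) ∧ ∀ x ∈ A₂, N x → x = y) := by
  have hadj' : ∀ x ∈ A₁, ∀ y ∈ A₂, G.Adj x y ↔ x = r ∧ N y :=
    fun x hx y hy => hadj x (h₁ hx) y (h₂ hy)
  have hne : ∀ x ∈ A₁, ∀ y ∈ A₂, x ≠ y := by
    rintro x hx y hy rfl
    exact Set.disjoint_left.1 hd (h₁ hx) (h₂ hy)
  constructor
  · intro h
    have h' : ∀ v, v ∈ A₁ ∨ v ∈ A₂ → ∀ x, x ∈ A₁ ∨ x ∈ A₂ → ∀ y, y ∈ A₁ ∨ y ∈ A₂ →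
        G.Adj v x → G.Adj v y → x = y := by
      simpa only [Diss, Finset.mem_union] using h
    refine ⟨fun v hv x hx y hy => h' v (.inl hv) x (.inl hx) y (.inl hy),
      fun v hv x hx y hy => h' v (.inr hv) x (.inr hx) y (.inr hy), fun hr y hy hN => ?_⟩
    have hry := (hadj' r hr y hy).2 ⟨rfl, hN⟩
    refine ⟨fun x hx hrx => ?_, fun x hx hyx => ?_, fun x hx hNx => ?_⟩
    · exact hne x hx y hy (h' r (.inl hr) x (.inl hx) y (.inr hy) hrx hry)
    · exact hne r hr x hx (h' y (.inr hy) r (.inl hr) x (.inr hx) hry.symm hyx)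
    · exact h' r (.inl hr) x (.inr hx) y (.inr hy) ((hadj' r hr x hx).2 ⟨rfl, hNx⟩) hry
  · rintro ⟨hA₁, hA₂, h⟩ v hv x hx y hy hvx hvy
    rw [Finset.mem_union] at hv hx hy
    rcases hv with hv | hv
    · rcases hx with hx | hx <;> rcases hy with hy | hy
      · exact hA₁ v hv x hx y hy hvx hvy
      · obtain ⟨rfl, hN⟩ := (hadj' v hv y hy).1 hvy
        exact absurd hvx ((h hv y hy hN).1 x hx)
      · obtain ⟨rfl, hN⟩ := (hadj' v hv x hx).1 hvx
        exact absurd hvy ((h hv x hx hN).1 y hy)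
      · obtain ⟨rfl, hN⟩ := (hadj' v hv x hx).1 hvx
        exact ((h hv x hx hN).2.2 y hy ((hadj' v hv y hy).1 hvy).2).symm
    · rcases hx with hx | hx <;> rcases hy with hy | hy
      · rw [((hadj' x hx v hv).1 hvx.symm).1, ((hadj' y hy v hv).1 hvy.symm).1]
      · obtain ⟨rfl, hN⟩ := (hadj' x hx v hv).1 hvx.symm
        exact absurd hvy ((h hx v hv hN).2.1 y hy)
      · obtain ⟨rfl, hN⟩ := (hadj' y hy v hv).1 hvy.symm
        exact absurd hvx ((h hy v hv hN).2.1 x hx)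
      · exact hA₂ v hv x hx y hy hvx hvy

section genFun

open Classical in
/-- The generating polynomial of the sets `A ⊆ S` with property `P`, by cardinality. -/
noncomputable def genFun {V : Type u} [Fintype V] (S : Set V) (P : Finset V → Prop) : ℕ[X] :=
  ∑ A ∈ Finset.univ.filter (fun A : Finset V => (A : Set V) ⊆ S ∧ P A), X ^ A.card

variable {V : Type u} [Fintype V]

open Classical in
theorem genFun_restrict {S S' : Set V} {P Q : Finset V → Prop}
    (h : ∀ A : Finset V, ((A : Set V) ⊆ S ∧ P A) ↔ ((A : Set V) ⊆ S' ∧ Q A)) :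
    genFun S P = genFun S' Q := by
  unfold genFun
  exact Finset.sum_congr (Finset.filter_congr fun A _ => h A) fun _ _ => rfl

theorem genFun_congr {S : Set V} {P Q : Finset V → Prop}
    (h : ∀ A : Finset V, (A : Set V) ⊆ S → (P A ↔ Q A)) : genFun S P = genFun S Q :=
  genFun_restrict fun A => and_congr_right (h A)

theorem genFun_add {S : Set V} {P P₁ P₂ : Finset V → Prop}
    (h : ∀ A : Finset V, (A : Set V) ⊆ S → (P A ↔ P₁ A ∨ P₂ A)) (h' : ∀ A, P₁ A → ¬P₂ A) :
    genFun S P = genFun S P₁ + genFun S P₂ := by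
  classical
  rw [genFun_congr h]
  unfold genFun
  rw [← Finset.sum_union]
  · congr 1
    ext A
    simp only [Finset.mem_filter, Finset.mem_univ, true_and, Finset.mem_union]
    tauto
  · rw [Finset.disjoint_filter]
    intro A _ h1 h2
    exact h' A h1.2 h2.2

theorem genFun_split {S : Set V} {P : Finset V → Prop} (Q : Finset V → Prop) :
    genFun S P = genFun S (fun A => P A ∧ Q A) + genFun S (fun A => P A ∧ ¬Q A) :=
  genFun_add (fun A _ => by tauto) (fun A h h' => h'.2 h.2)

open Classical in
theorem genFun_mul {S₁ S₂ : Set V} (hd : Disjoint S₁ S₂) {P P₁ P₂ : Finset V → Prop}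
    (h : ∀ A₁ A₂ : Finset V, (A₁ : Set V) ⊆ S₁ → (A₂ : Set V) ⊆ S₂ →
      (P (A₁ ∪ A₂) ↔ P₁ A₁ ∧ P₂ A₂)) :
    genFun (S₁ ∪ S₂) P = genFun S₁ P₁ * genFun S₂ P₂ := by
  have hfil : ∀ A₁ A₂ : Finset V, (A₁ : Set V) ⊆ S₁ → (A₂ : Set V) ⊆ S₂ →
      (A₁ ∪ A₂).filter (· ∈ S₁) = A₁ ∧ (A₁ ∪ A₂).filter (· ∈ S₂) = A₂ := by
    intro A₁ A₂ h1 h2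
    have hd' := Set.disjoint_left.1 hd
    constructor
    · ext x
      simp only [Finset.mem_filter, Finset.mem_union] at *
      tauto
    · ext x
      simp only [Finset.mem_filter, Finset.mem_union] at *
      tauto
  unfold genFun
  rw [Finset.sum_mul_sum, ← Finset.sum_product']
  symm
  refine Finset.sum_bij' (fun A _ => A.1 ∪ A.2)
    (fun A _ => (A.filter (· ∈ S₁), A.filter (· ∈ S₂))) ?_ ?_ ?_ ?_ ?_
  · rintro ⟨A₁, A₂⟩ hA
    simp only [Finset.mem_product, Finset.mem_filter, Finset.mem_univ, true_and] at hA ⊢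
    refine ⟨?_, (h _ _ hA.1.1 hA.2.1).2 ⟨hA.1.2, hA.2.2⟩⟩
    rw [Finset.coe_union]
    exact Set.union_subset_union hA.1.1 hA.2.1
  · intro A hA
    simp only [Finset.mem_product, Finset.mem_filter, Finset.mem_univ, true_and] at hA ⊢
    have e1 : ((A.filter (· ∈ S₁) : Finset V) : Set V) ⊆ S₁ := by
      intro x hx; simpa using (Finset.mem_filter.1 hx).2
    have e2 : ((A.filter (· ∈ S₂) : Finset V) : Set V) ⊆ S₂ := by
      intro x hx; simpa using (Finset.mem_filter.1 hx).2
    have e3 : A.filter (· ∈ S₁) ∪ A.filter (· ∈ S₂) = A := by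
      ext x
      have := @hA.1 x
      simp only [Finset.mem_filter, Finset.mem_union, Finset.mem_coe, Set.mem_union] at *
      tauto
    have := (h _ _ e1 e2).1 (by rw [e3]; exact hA.2)
    exact ⟨⟨e1, this.1⟩, e2, this.2⟩
  · rintro ⟨A₁, A₂⟩ hA
    simp only [Finset.mem_product, Finset.mem_filter, Finset.mem_univ, true_and] at hA
    obtain ⟨h1, h2⟩ := hfil A₁ A₂ hA.1.1 hA.2.1
    simp only [h1, h2]
  · intro A hA
    simp only [Finset.mem_filter, Finset.mem_univ, true_and] at hA
    ext x
    have := @hA.1 x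
    simp only [Finset.mem_filter, Finset.mem_union, Finset.mem_coe, Set.mem_union] at *
    tauto
  · rintro ⟨A₁, A₂⟩ hA
    simp only [Finset.mem_product, Finset.mem_filter, Finset.mem_univ, true_and] at hA
    rw [← pow_add, Finset.card_union_of_disjoint]
    rw [← Finset.disjoint_coe]
    exact Set.disjoint_of_subset hA.1.1 hA.2.1 hd

variable {G : SimpleGraph V}

variable (G) in
/-- Dissociation sets avoiding `r`. -/
def DissOut (r : V) (A : Finset V) : Prop := Diss G A ∧ r ∉ A

variable (G) in
/-- Dissociation sets with `r` as an isolated vertex. -/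
def DissIso (r : V) (A : Finset V) : Prop := Diss G A ∧ r ∈ A ∧ ∀ x ∈ A, ¬G.Adj r x

variable (G) in
/-- Dissociation sets with `r` as a vertex of degree one. -/
def DissDeg (r : V) (A : Finset V) : Prop := Diss G A ∧ r ∈ A ∧ ∃ x ∈ A, G.Adj r x

theorem genFun_mem (S : Set V) (r : V) : genFun S (fun A => Diss G A ∧ r ∈ A) =
    genFun S (DissIso G r) + genFun S (DissDeg G r) := by
  refine genFun_add (fun A _ => ?_) (fun A h h' => ?_)
  · by_cases h : ∃ x ∈ A, G.Adj r x
    · simp only [DissIso, DissDeg]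
      tauto
    · simp only [DissIso, DissDeg]
      have : ∀ x ∈ A, ¬G.Adj r x := by push Not at h; exact h
      tauto
  · obtain ⟨x, hx, hrx⟩ := h'.2.2
    exact h.2.2 x hx hrx

theorem genFun_diss (S : Set V) (r : V) : genFun S (Diss G) =
    genFun S (DissOut G r) + genFun S (DissIso G r) + genFun S (DissDeg G r) := by
  rw [genFun_split (fun A => r ∈ A), genFun_mem, add_comm, ← add_assoc]
  rfl

theorem genFun_singleton (r : V) : genFun {r} (DissOut G r) = 1 ∧
    genFun {r} (DissIso G r) = X ∧ genFun {r} (DissDeg G r) = 0 := by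
  classical
  have hs : ∀ A : Finset V, (A : Set V) ⊆ {r} ↔ A = ∅ ∨ A = {r} := by
    intro A
    rw [← Finset.coe_singleton, Finset.coe_subset, Finset.subset_singleton_iff]
  refine ⟨?_, ?_, ?_⟩
  · unfold genFun
    rw [show (Finset.univ.filter fun A : Finset V => (A : Set V) ⊆ {r} ∧ DissOut G r A) = {∅} from ?_]
    · simp
    · ext A
      simp only [Finset.mem_filter, Finset.mem_univ, true_and, hs, Finset.mem_singleton]
      constructor
      · rintro ⟨rfl | rfl, h⟩
        · rfl
        · exact absurd (Finset.mem_singleton_self r) h.2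
      · rintro rfl
        exact ⟨.inl rfl, by simp [DissOut, Diss]⟩
  · unfold genFun
    rw [show (Finset.univ.filter fun A : Finset V => (A : Set V) ⊆ {r} ∧ DissIso G r A) = {{r}}
      from ?_]
    · simp
    · ext A
      simp only [Finset.mem_filter, Finset.mem_univ, true_and, hs, Finset.mem_singleton]
      constructor
      · rintro ⟨rfl | rfl, h⟩
        · exact absurd h.2.1 (Finset.notMem_empty r)
        · rfl
      · rintro rfl
        exact ⟨.inr rfl, by simp [DissIso, Diss]⟩
  · unfold genFun
    rw [Finset.sum_eq_zero]
    intro A hA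
    simp only [Finset.mem_filter, Finset.mem_univ, true_and, hs] at hA
    obtain ⟨rfl | rfl, h⟩ := hA
    · exact absurd h.2.1 (Finset.notMem_empty r)
    · obtain ⟨x, hx, h⟩ := h.2.2
      rw [Finset.mem_singleton.1 hx] at h
      exact absurd h (G.loopless.irrefl r)

theorem Realizes.genFun {t : RT} {S : Set V} {r : V} (h : Realizes G t S r) :
    genFun S (DissOut G r) = t.pol.o ∧ genFun S (DissIso G r) = t.pol.z ∧
      genFun S (DissDeg G r) = t.pol.d := by
  classical
  induction t generalizing S r with
  | leaf => rw [show S = {r} from h]; exact genFun_singleton r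
  | join t s iht ihs =>
    obtain ⟨S₁, S₂, c, h1, h2, hd, rfl, hadj⟩ := h
    obtain ⟨o1, z1, d1⟩ := iht h1
    obtain ⟨o2, z2, d2⟩ := ihs h2
    have hr₁ := h1.mem
    have hc₂ := h2.mem
    have hr {A₁ A₂ : Finset V} (hA₂ : (A₂ : Set V) ⊆ S₂) : r ∈ A₁ ∪ A₂ ↔ r ∈ A₁ := by
      rw [Finset.mem_union, or_iff_left]
      exact fun h => Set.disjoint_left.1 hd hr₁ (hA₂ h)
    have hc {A₁ A₂ : Finset V} (hA₁ : (A₁ : Set V) ⊆ S₁) : c ∈ A₁ ∪ A₂ ↔ c ∈ A₂ := by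
      rw [Finset.mem_union, or_iff_right]
      exact fun h => Set.disjoint_left.1 hd (hA₁ h) hc₂
    have hn {A₁ A₂ : Finset V} (hA₂ : (A₂ : Set V) ⊆ S₂) :
        (∃ x ∈ A₁ ∪ A₂, G.Adj r x) ↔ (∃ x ∈ A₁, G.Adj r x) ∨ c ∈ A₂ := by
      constructor
      · rintro ⟨x, hx, h⟩
        rcases Finset.mem_union.1 hx with hx | hx
        · exact .inl ⟨x, hx, h⟩
        · have := ((hadj r hr₁ x (hA₂ hx)).1 h).2
          exact .inr (this ▸ hx)
      · rintro (⟨x, hx, h⟩ | h)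
        · exact ⟨x, Finset.mem_union_left _ hx, h⟩
        · exact ⟨c, Finset.mem_union_right _ h, (hadj r hr₁ c hc₂).2 ⟨rfl, rfl⟩⟩
    have hdiss {A₁ A₂ : Finset V} (hA₁ : (A₁ : Set V) ⊆ S₁) (hA₂ : (A₂ : Set V) ⊆ S₂) :
        Diss G (A₁ ∪ A₂) ↔ Diss G A₁ ∧ Diss G A₂ ∧ (r ∈ A₁ → c ∈ A₂ →
          (∀ x ∈ A₁, ¬G.Adj r x) ∧ ∀ x ∈ A₂, ¬G.Adj c x) := by
      rw [diss_union hd hadj hA₁ hA₂]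
      refine and_congr_right fun _ => and_congr_right fun _ => imp_congr_right fun _ => ?_
      constructor
      · intro h hcA
        exact ⟨(h c hcA rfl).1, (h c hcA rfl).2.1⟩
      · rintro h y hy rfl
        exact ⟨(h hy).1, (h hy).2, fun x _ hx => hx⟩
    simp only [RT.pol, Pol.join, Pol.tot]
    refine ⟨?_, ?_, ?_⟩
    · rw [← o1, ← o2, ← z2, ← d2, ← genFun_diss]
      refine genFun_mul hd fun A₁ A₂ hA₁ hA₂ => ?_
      simp only [DissOut, hdiss hA₁ hA₂, hr hA₂]
      tauto
    · rw [← z1, ← o2]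
      refine genFun_mul hd fun A₁ A₂ hA₁ hA₂ => ?_
      have := hn (A₁ := A₁) hA₂
      have h3 : (∀ x ∈ A₁ ∪ A₂, ¬G.Adj r x) ↔ (∀ x ∈ A₁, ¬G.Adj r x) ∧ c ∉ A₂ := by
        have := not_congr this
        push Not at this
        exact this
      simp only [DissIso, DissOut, hdiss hA₁ hA₂, hr hA₂, h3]
      tauto
    -- The root has degree one either through `t`, and then `c` is left out, or through `c`, and
    -- then both roots are isolated on their own sides.
    · rw [genFun_split (fun A => c ∉ A), ← d1, ← o2, ← z1, ← z2]
      congr 1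
      · refine genFun_mul hd fun A₁ A₂ hA₁ hA₂ => ?_
        simp only [DissDeg, DissOut, hdiss hA₁ hA₂, hr hA₂, hn hA₂, hc hA₁]
        by_cases hcA : c ∈ A₂
        · simp only [hcA, not_true, and_false]
        · simp only [hcA, not_false_eq_true, and_true, or_false, false_imp_iff, implies_true]
          tauto
      · refine genFun_mul hd fun A₁ A₂ hA₁ hA₂ => ?_
        simp only [DissDeg, DissIso, hdiss hA₁ hA₂, hr hA₂, hn hA₂, hc hA₁]
        tauto

theorem Realizes.genFun_diss {t : RT} {S : Set V} {r : V} (h : Realizes G t S r) :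
    Potted.genFun S (Diss G) = t.pol.tot := by
  obtain ⟨h1, h2, h3⟩ := h.genFun
  rw [Potted.genFun_diss S r, h1, h2, h3]
  rfl

end genFun

theorem isDissociationSet_iff {V : Type u} [Finite V] {G : SimpleGraph V} {A : Finset V} :
    IsDissociationSet G A ↔ Diss G A := by
  unfold IsDissociationSet Diss
  refine forall₂_congr fun v _ => ?_
  rw [Set.ncard_le_one (Set.toFinite _)]
  constructor
  · intro h x hx y hy hvx hvy
    exact h x ⟨hx, hvx⟩ y ⟨hy, hvy⟩
  · rintro h x ⟨hx, hvx⟩ y ⟨hy, hvy⟩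
    exact h x hx y hy hvx hvy

/-- `Top` alone allows a zero coefficient at `n`; positivity of `w` makes `n` the true maximum size.
-/
theorem numMax_eq_of_top {V : Type u} [Fintype V] {G : SimpleGraph V} {n w : ℕ}
    (h : Top (genFun Set.univ (Diss G)) n w) (hw : 0 < w) : numMaxDissociationSets G = w := by
  classical
  have hcoeff : ∀ m, (genFun Set.univ (Diss G)).coeff m =
      (Finset.univ.filter fun A : Finset V => Diss G A ∧ A.card = m).card := by
    intro m
    unfold genFun
    rw [Polynomial.finsetSum_coeff]
    simp only [Polynomial.coeff_X_pow, Set.subset_univ, true_and]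
    rw [Finset.sum_boole, Finset.filter_filter]
    simp only [Nat.cast_id, eq_comm]
  have hle : ∀ A : Finset V, Diss G A → A.card ≤ n := by
    intro A hA
    refine le_trans (Polynomial.le_natDegree_of_ne_zero ?_) h.1
    rw [hcoeff, Finset.card_ne_zero]
    exact ⟨A, by simp [hA]⟩
  have hex : ∃ A : Finset V, Diss G A ∧ A.card = n := by
    have h2 := h.2
    rw [hcoeff] at h2
    obtain ⟨A, hA⟩ := Finset.card_pos.1 (h2 ▸ hw)
    exact ⟨A, by simpa using hA⟩
  rw [← h.2, hcoeff, numMaxDissociationSets, ← Set.ncard_coe_finset]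
  congr 1
  ext A
  simp only [Set.mem_ofPred_eq, IsMaximumDissociationSet, isDissociationSet_iff, Finset.coe_filter,
    Finset.mem_univ, true_and]
  refine and_congr_right fun hA => ?_
  obtain ⟨B, hB, hBn⟩ := hex
  constructor
  · intro hm
    have := hm B hB
    have := hle A hA
    omega
  · intro hm T hT
    rw [hm]
    exact hle T hT

/-! ### The cycle: counting in a decomposed potted graph -/

section

variable {V : Type u} {G : SimpleGraph V}

theorem realizes_path {c : ℕ → V} (m : ℕ) {a : ℕ}
    (inj : ∀ i j, a ≤ i → i < j → j ≤ a + m → c i ≠ c j)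
    (adj : ∀ i j, a ≤ i → i < j → j ≤ a + m → (G.Adj (c i) (c j) ↔ j = i + 1)) :
    Realizes G (path m) {x | ∃ i, a ≤ i ∧ i ≤ a + m ∧ x = c i} (c a) := by
  induction m generalizing a with
  | zero =>
    show {x | ∃ i, a ≤ i ∧ i ≤ a + 0 ∧ x = c i} = {c a}
    ext x
    constructor
    · rintro ⟨i, h1, h2, rfl⟩
      rw [show i = a by omega]
      rfl
    · rintro rfl
      exact ⟨a, le_rfl, le_rfl, rfl⟩
  | succ m ih =>
    refine ⟨{c a}, {x | ∃ i, a + 1 ≤ i ∧ i ≤ a + 1 + m ∧ x = c i}, c (a + 1), rfl,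
      ih (fun i j h1 h2 h3 => inj i j (by omega) h2 (by omega))
        (fun i j h1 h2 h3 => adj i j (by omega) h2 (by omega)), ?_, ?_, ?_⟩
    · rw [Set.disjoint_singleton_left]
      rintro ⟨i, h1, h2, h3⟩
      exact inj a i le_rfl (by omega) (by omega) h3
    · ext x
      constructor
      · rintro ⟨i, h1, h2, rfl⟩
        rcases h1.eq_or_lt with rfl | h
        · exact .inl rfl
        · exact .inr ⟨i, h, by omega, rfl⟩
      · rintro (rfl | ⟨i, h1, h2, rfl⟩)
        · exact ⟨a, le_rfl, by omega, rfl⟩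
        · exact ⟨i, by omega, by omega, rfl⟩
    · rintro x rfl y ⟨i, h1, h2, rfl⟩
      rw [adj a i le_rfl (by omega) (by omega)]
      constructor
      · rintro rfl; exact ⟨rfl, rfl⟩
      · rintro ⟨-, h⟩
        by_contra hne
        exact inj (a + 1) i (by omega) (by omega) (by omega) h.symm

variable (G) in
/-- `G` consists of a cycle `c 0, …, c (k - 1)` and a tree on `S` with code `t`, rooted at `c 0`. -/
structure Decomp (k : ℕ) (t : RT) (c : ℕ → V) (S : Set V) : Prop where
  inj : ∀ i j, i < j → j < k → c i ≠ c j
  realizes : Realizes G t S (c 0)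
  cover : ∀ x, x ∈ S ∨ ∃ i, 0 < i ∧ i < k ∧ x = c i
  notMem : ∀ i, 0 < i → i < k → c i ∉ S
  adj : ∀ i j, i < j → j < k → (G.Adj (c i) (c j) ↔ j = i + 1 ∨ (i = 0 ∧ j = k - 1))
  outer : ∀ i, 0 < i → i < k → ∀ x ∈ S, G.Adj x (c i) → x = c 0

/-- The part of the cycle outside the tree. -/
def arc (c : ℕ → V) (a b : ℕ) : Set V := {x | ∃ i, a ≤ i ∧ i ≤ b ∧ x = c i}

variable {k : ℕ} {t : RT} {c : ℕ → V} {S : Set V}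

theorem Decomp.univ_eq (h : Decomp G (k + 1) t c S) : Set.univ = S ∪ arc c 1 k := by
  refine (Set.eq_univ_of_forall fun x => ?_).symm
  rcases h.cover x with hx | ⟨i, h1, h2, rfl⟩
  · exact .inl hx
  · exact .inr ⟨i, h1, by omega, rfl⟩

theorem Decomp.disjoint (h : Decomp G (k + 1) t c S) : Disjoint S (arc c 1 k) := by
  rw [Set.disjoint_left]
  rintro _ hx ⟨i, h1, h2, rfl⟩
  exact h.notMem i h1 (by omega) hx

theorem Decomp.adj_cross (h : Decomp G (k + 1) t c S) {x : V} (hx : x ∈ S) {i : ℕ} (h1 : 1 ≤ i)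
    (h2 : i ≤ k) : G.Adj x (c i) ↔ x = c 0 ∧ (i = 1 ∨ i = k) := by
  have hadj := h.adj 0 i h1 (by omega)
  constructor
  · intro hxi
    obtain rfl := h.outer i h1 (by omega) x hx hxi
    exact ⟨rfl, by have := hadj.1 hxi; omega⟩
  · rintro ⟨rfl, h3⟩
    exact hadj.2 (by omega)

/-- The path obtained from an arc of the cycle. -/
theorem Decomp.realizes_arc (h : Decomp G (k + 1) t c S) {a m : ℕ} (ha : 1 ≤ a)
    (hm : a + m ≤ k) : Realizes G (path m) (arc c a (a + m)) (c a) := by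
  refine realizes_path m (fun i j h1 h2 h3 => h.inj i j h2 (by omega)) fun i j h1 h2 h3 => ?_
  rw [h.adj i j h2 (by omega)]
  omega

/-- An arc of the cycle traversed in the opposite direction. -/
theorem Decomp.realizes_arc_reverse (h : Decomp G (k + 1) t c S) {a m : ℕ} (ha : 1 ≤ a)
    (hm : a + m = k) : Realizes G (path m) (arc c a k) (c k) := by
  have h1 := realizes_path (G := G) (c := fun i => c (k - i)) m (a := 0)
    (fun i j h1 h2 h3 => (h.inj (k - j) (k - i) (by omega) (by omega)).symm)
    (fun i j h1 h2 h3 => by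
      rw [G.adj_comm, h.adj (k - j) (k - i) (by omega) (by omega)]
      omega)
  have h2 : arc c a k = {x | ∃ i, 0 ≤ i ∧ i ≤ 0 + m ∧ x = c (k - i)} := by
    ext x
    constructor
    · rintro ⟨i, h1, h2, rfl⟩
      exact ⟨k - i, by omega, by omega, by congr 1; omega⟩
    · rintro ⟨i, h1, h2, rfl⟩
      exact ⟨k - i, by omega, by omega, rfl⟩
  rw [h2]
  exact h1

theorem Decomp.subset_arc_succ (h : Decomp G (k + 1) t c S) {a b : ℕ} (hb : b ≤ k)
    (A : Finset V) :
    (A : Set V) ⊆ arc c (a + 1) b ↔ (A : Set V) ⊆ arc c a b ∧ c a ∉ A := by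
  constructor
  · intro hA
    refine ⟨fun x hx => ?_, fun hx => ?_⟩
    · obtain ⟨i, h1, h2, rfl⟩ := hA hx
      exact ⟨i, by omega, h2, rfl⟩
    · obtain ⟨i, h1, h2, h3⟩ := hA hx
      exact h.inj a i (by omega) (by omega) h3
  · rintro ⟨hA, ha⟩ x hx
    obtain ⟨i, h1, h2, rfl⟩ := hA hx
    refine ⟨i, ?_, h2, rfl⟩
    rcases h1.eq_or_lt with rfl | h
    · exact absurd hx ha
    · exact h

theorem Decomp.subset_arc_pred (h : Decomp G (k + 1) t c S) {a b : ℕ} (hb : b + 1 ≤ k)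
    (A : Finset V) :
    (A : Set V) ⊆ arc c a b ↔ (A : Set V) ⊆ arc c a (b + 1) ∧ c (b + 1) ∉ A := by
  constructor
  · intro hA
    refine ⟨fun x hx => ?_, fun hx => ?_⟩
    · obtain ⟨i, h1, h2, rfl⟩ := hA hx
      exact ⟨i, by omega, by omega, rfl⟩
    · obtain ⟨i, h1, h2, h3⟩ := hA hx
      exact h.inj i (b + 1) (by omega) (by omega) h3.symm
  · rintro ⟨hA, ha⟩ x hx
    obtain ⟨i, h1, h2, rfl⟩ := hA hx
    refine ⟨i, h1, ?_, rfl⟩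
    rcases h2.eq_or_lt with rfl | h
    · exact absurd hx ha
    · omega

theorem path_z (n : ℕ) : (path (n + 2)).pol.z = X * (path n).pol.tot := by
  simp [path, RT.pol, Pol.join]

open Classical in
theorem Decomp.diss_union (h : Decomp G (k + 1) t c S) (hk : 2 ≤ k) {A₁ A₂ : Finset V}
    (h₁ : (A₁ : Set V) ⊆ S) (h₂ : (A₂ : Set V) ⊆ arc c 1 k) :
    Diss G (A₁ ∪ A₂) ↔ Diss G A₁ ∧ Diss G A₂ ∧ (c 0 ∈ A₁ →
      (c 1 ∈ A₂ → (∀ x ∈ A₁, ¬G.Adj (c 0) x) ∧ (∀ x ∈ A₂, ¬G.Adj (c 1) x) ∧ c k ∉ A₂) ∧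
      (c k ∈ A₂ → (∀ x ∈ A₁, ¬G.Adj (c 0) x) ∧ (∀ x ∈ A₂, ¬G.Adj (c k) x) ∧ c 1 ∉ A₂)) := by
  have hne : c 1 ≠ c k := h.inj 1 k (by omega) (by omega)
  rw [Potted.diss_union h.disjoint (r := c 0) (N := fun y => y = c 1 ∨ y = c k) ?_ h₁ h₂]
  · refine and_congr_right fun _ => and_congr_right fun _ => imp_congr_right fun _ => ?_
    constructor
    · intro hN
      refine ⟨fun h1 => ?_, fun hk => ?_⟩
      · obtain ⟨a, b, d⟩ := hN _ h1 (.inl rfl)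
        exact ⟨a, b, fun hk => hne (d _ hk (.inr rfl)).symm⟩
      · obtain ⟨a, b, d⟩ := hN _ hk (.inr rfl)
        exact ⟨a, b, fun h1 => hne (d _ h1 (.inl rfl))⟩
    · rintro ⟨h1, hk⟩ y hy (rfl | rfl)
      · obtain ⟨a, b, d⟩ := h1 hy
        refine ⟨a, b, ?_⟩
        rintro x hx (rfl | rfl)
        exacts [rfl, absurd hx d]
      · obtain ⟨a, b, d⟩ := hk hy
        refine ⟨a, b, ?_⟩
        rintro x hx (rfl | rfl)
        exacts [absurd hx d, rfl]
  · rintro x hx _ ⟨i, h1, h2, rfl⟩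
    rw [h.adj_cross hx h1 h2]
    refine and_congr_right fun _ => ?_
    constructor
    · rintro (rfl | rfl)
      exacts [.inl rfl, .inr rfl]
    · rintro (hi | hi)
      · left
        by_contra hi1
        exact h.inj 1 i (by omega) (by omega) hi.symm
      · right
        by_contra hik
        exact h.inj i k (by omega) (by omega) hi

open Classical in
/-- The generating polynomial of the dissociation sets of a potted graph. -/
theorem Decomp.genFun_eq [Fintype V] {m : ℕ} (h : Decomp G (m + 5) t c S) :
    genFun Set.univ (Diss G) = t.pol.o * (path (m + 3)).pol.tot +
      (t.pol.z + t.pol.d) * (path (m + 1)).pol.tot +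
      2 * (t.pol.z * (X * (path m).pol.tot)) := by
  obtain ⟨o, z, d⟩ := h.realizes.genFun
  have hr0 := h.realizes.mem
  have hd := h.disjoint
  have hmem1 : c 1 ∈ arc c 1 (m + 4) := ⟨1, le_rfl, by omega, rfl⟩
  have hmemk : c (m + 4) ∈ arc c 1 (m + 4) := ⟨_, by omega, le_rfl, rfl⟩
  have hr {A₁ A₂ : Finset V} (hA₂ : (A₂ : Set V) ⊆ arc c 1 (m + 4)) :
      c 0 ∈ A₁ ∪ A₂ ↔ c 0 ∈ A₁ := by
    rw [Finset.mem_union, or_iff_left]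
    exact fun h => Set.disjoint_left.1 hd hr0 (hA₂ h)
  have hc {A₁ A₂ : Finset V} (hA₁ : (A₁ : Set V) ⊆ S) {y : V} (hy : y ∈ arc c 1 (m + 4)) :
      y ∈ A₁ ∪ A₂ ↔ y ∈ A₂ := by
    rw [Finset.mem_union, or_iff_right]
    exact fun h => Set.disjoint_left.1 hd (hA₁ h) hy
  have q0 : genFun (arc c 1 (m + 4)) (Diss G) = (path (m + 3)).pol.tot := by
    have := (h.realizes_arc (a := 1) (m := m + 3) le_rfl (by omega)).genFun_diss
    rwa [show 1 + (m + 3) = m + 4 by ring] at this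
  -- If `c 0` and `c 1` are both selected, they form an isolated edge, so `c 2` and the other end of
  -- the arc are left out and a path of order `m + 1` remains free.
  have q1 : genFun (arc c 1 (m + 4)) (fun A => DissIso G (c 1) A ∧ c (m + 4) ∉ A) =
      X * (path m).pol.tot := by
    rw [← path_z, ← (h.realizes_arc (a := 1) (m := m + 2) le_rfl (by omega)).genFun.2.1]
    refine genFun_restrict fun A => ?_
    rw [show 1 + (m + 2) = m + 3 by ring, h.subset_arc_pred (b := m + 3) (by omega)]
    tauto
  have q2 : genFun (arc c 1 (m + 4)) (fun A => DissIso G (c (m + 4)) A ∧ c 1 ∉ A) =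
      X * (path m).pol.tot := by
    rw [← path_z, ← (h.realizes_arc_reverse (a := 2) (m := m + 2) (by omega)
      (by omega)).genFun.2.1]
    refine genFun_restrict fun A => ?_
    rw [h.subset_arc_succ (a := 1) le_rfl]
    tauto
  have q3 : genFun (arc c 1 (m + 4)) (fun A => Diss G A ∧ c 1 ∉ A ∧ c (m + 4) ∉ A) =
      (path (m + 1)).pol.tot := by
    rw [← (h.realizes_arc (a := 2) (m := m + 1) (by omega) (by omega)).genFun_diss]
    refine genFun_restrict fun A => ?_
    rw [show 2 + (m + 1) = m + 3 by ring, h.subset_arc_succ (a := 1) (by omega),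
      h.subset_arc_pred (b := m + 3) (by omega)]
    tauto
  have e1 : genFun (S ∪ arc c 1 (m + 4)) (fun A => Diss G A ∧ ¬c 0 ∈ A) =
      t.pol.o * (path (m + 3)).pol.tot := by
    rw [← o, ← q0]
    refine genFun_mul hd fun A₁ A₂ hA₁ hA₂ => ?_
    rw [h.diss_union (by omega) hA₁ hA₂, hr hA₂]
    simp only [DissOut]
    tauto
  have e2 : genFun (S ∪ arc c 1 (m + 4)) (fun A => (Diss G A ∧ c 0 ∈ A) ∧ c 1 ∈ A) =
      t.pol.z * (X * (path m).pol.tot) := by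
    rw [← z, ← q1]
    refine genFun_mul hd fun A₁ A₂ hA₁ hA₂ => ?_
    rw [h.diss_union (by omega) hA₁ hA₂, hr hA₂, hc hA₁ hmem1]
    simp only [DissIso]
    by_cases hA : c (m + 4) ∈ A₂ <;>
      simp only [hA, not_true, not_false_eq_true, and_false, and_true, false_imp_iff,
        true_imp_iff] <;> tauto
  have e3 : genFun (S ∪ arc c 1 (m + 4))
      (fun A => ((Diss G A ∧ c 0 ∈ A) ∧ ¬c 1 ∈ A) ∧ c (m + 4) ∈ A) =
      t.pol.z * (X * (path m).pol.tot) := by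
    rw [← z, ← q2]
    refine genFun_mul hd fun A₁ A₂ hA₁ hA₂ => ?_
    rw [h.diss_union (by omega) hA₁ hA₂, hr hA₂, hc hA₁ hmem1, hc hA₁ hmemk]
    simp only [DissIso]
    by_cases hA : c 1 ∈ A₂ <;>
      simp only [hA, not_true, not_false_eq_true, and_false, false_and, and_true, false_imp_iff,
        true_imp_iff] <;>
      tauto
  have e4 : genFun (S ∪ arc c 1 (m + 4))
      (fun A => ((Diss G A ∧ c 0 ∈ A) ∧ ¬c 1 ∈ A) ∧ ¬c (m + 4) ∈ A) =
      (t.pol.z + t.pol.d) * (path (m + 1)).pol.tot := by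
    rw [← z, ← d, ← genFun_mem, ← q3]
    refine genFun_mul hd fun A₁ A₂ hA₁ hA₂ => ?_
    rw [h.diss_union (by omega) hA₁ hA₂, hr hA₂, hc hA₁ hmem1, hc hA₁ hmemk]
    tauto
  -- Four cases: `c 0` left out, or selected with `c 1`, with `c (m + 4)`, or with neither. Both
  -- neighbours at once would give `c 0` degree two.
  rw [h.univ_eq, genFun_split (fun A => c 0 ∈ A), e1,
    genFun_split (P := fun A => Diss G A ∧ c 0 ∈ A) (fun A => c 1 ∈ A), e2,
    genFun_split (P := fun A => (Diss G A ∧ c 0 ∈ A) ∧ ¬c 1 ∈ A) (fun A => c (m + 4) ∈ A), e3, e4]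
  ring

theorem RT.weight_pos (T : RT) (t : ℕ) : 0 < T.data.weight t := by
  have hb := T.bounds
  unfold RT.Bounds at hb
  rcases hd : T.data with ⟨b, c, d⟩ | ⟨o, c, d⟩ | ⟨o, e, d⟩ <;> rw [hd] at hb <;>
    obtain ⟨j, hj, h⟩ := hb <;> simp only [Data.weight]
  · exact Nat.mul_pos (Nat.succ_pos _) h.pos
  · have := Nat.mul_pos (Nat.succ_pos t) h.pos.1
    simp only [Nat.succ_eq_add_one] at this
    omega
  · have := h.d_pos
    omega

theorem Decomp.numMax_eq [Fintype V] {s : ℕ} (h : Decomp G (3 * s + 5) t c S) :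
    numMaxDissociationSets G = t.data.weight (s + 1) := by
  obtain ⟨a, ha⟩ := t.top_potted s
  rw [← h.genFun_eq] at ha
  exact numMax_eq_of_top ha (t.weight_pos _)

end

/-! ### Codes determine graphs up to isomorphism -/

section

variable {V : Type u} {W : Type v} {G : SimpleGraph V} {H : SimpleGraph W}

theorem Realizes.map {f : V → W} {t : RT} {S : Set V} {r : V} (h : Realizes G t S r)
    (inj : Set.InjOn f S) (adj : ∀ x ∈ S, ∀ y ∈ S, H.Adj (f x) (f y) ↔ G.Adj x y) :
    Realizes H t (f '' S) (f r) := by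
  induction t generalizing S r with
  | leaf =>
    obtain rfl : S = {r} := h
    exact Set.image_singleton
  | join t s iht ihs =>
    obtain ⟨S₁, S₂, c, h1, h2, hd, rfl, hadj⟩ := h
    refine ⟨f '' S₁, f '' S₂, f c,
      iht h1 (inj.mono Set.subset_union_left) fun x hx y hy => adj x (.inl hx) y (.inl hy),
      ihs h2 (inj.mono Set.subset_union_right) fun x hx y hy => adj x (.inr hx) y (.inr hy),
      ?_, Set.image_union _ _ _, ?_⟩
    · rw [Set.disjoint_left] at hd ⊢
      rintro _ ⟨x, hx, rfl⟩ ⟨y, hy, hxy⟩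
      exact hd hx (inj (.inr hy) (.inl hx) hxy ▸ hy)
    · rintro _ ⟨x, hx, rfl⟩ _ ⟨y, hy, rfl⟩
      rw [adj x (.inl hx) y (.inr hy), hadj x hx y hy]
      rw [inj.eq_iff (.inl hx) (.inl h1.mem), inj.eq_iff (.inr hy) (.inr h2.mem)]

theorem Realizes.congr {G' : SimpleGraph V} {t : RT} {S : Set V} {r : V} (h : Realizes G t S r)
    (adj : ∀ x ∈ S, ∀ y ∈ S, G'.Adj x y ↔ G.Adj x y) : Realizes G' t S r := by
  simpa using h.map (f := id) (Set.injOn_id S) adj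

/-- A code orders the branches although the tree does not; the extremal codes are known only up to
such a permutation. -/
theorem Realizes.perm {l l' : List RT} (hl : l.Perm l') {S : Set V} {r : V}
    (h : Realizes G (ofKids l) S r) : Realizes G (ofKids l') S r := by
  induction hl generalizing S r with
  | nil => exact h
  | cons x _ ih =>
    obtain ⟨S₁, S₂, c, h1, h2⟩ := h
    exact ⟨S₁, S₂, c, ih h1, h2⟩
  | swap x y l =>
    obtain ⟨_, S₂, c, ⟨S₁, S₃, d, h1, h3, hd', rfl, hadj'⟩, h2, hd, rfl, hadj⟩ := h
    rw [Set.disjoint_union_left] at hd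
    have hr : ∀ y ∈ S₃, y ≠ r := fun y hy hyr => Set.disjoint_left.1 hd' h1.mem (hyr ▸ hy)
    have hr' : ∀ y ∈ S₂, y ≠ r := fun y hy hyr => Set.disjoint_left.1 hd.1 h1.mem (hyr ▸ hy)
    refine ⟨S₁ ∪ S₂, S₃, d, ⟨S₁, S₂, c, h1, h2, hd.1, rfl, fun x hx y hy =>
      hadj x (.inl hx) y hy⟩, h3, ?_, Set.union_right_comm _ _ _, ?_⟩
    · rw [Set.disjoint_union_left]
      exact ⟨hd', hd.2.symm⟩
    · rintro x (hx | hx) y hy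
      · exact hadj' x hx y hy
      · rw [G.adj_comm, hadj y (.inr hy) x hx]
        exact ⟨fun h => absurd h.1 (hr y hy), fun h => absurd h.1 (hr' x hx)⟩
  | trans _ _ ih ih' => exact ih' (ih h)

theorem Realizes.kids_perm {t : RT} {l : List RT} (hl : (kids t).Perm l) {S : Set V} {r : V}
    (h : Realizes G t S r) : Realizes G (ofKids l) S r :=
  Realizes.perm hl (by rwa [ofKids_kids])

theorem Realizes.ncard [Finite V] {t : RT} {S : Set V} {r : V} (h : Realizes G t S r) :
    S.ncard = t.size := by
  induction t generalizing S r with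
  | leaf =>
    obtain rfl : S = {r} := h
    exact Set.ncard_singleton r
  | join t s iht ihs =>
    obtain ⟨S₁, S₂, c, h1, h2, hd, rfl, -⟩ := h
    rw [Set.ncard_union_eq hd, iht h1, ihs h2]
    rfl

open Classical in
-- Used both for attaching a branch to a tree and for attaching the rest of the cycle.
theorem exists_glue_map {S₁ S₂ : Set V} {T₁ T₂ : Set W} {f₁ f₂ : V → W} (hS : Disjoint S₁ S₂)
    (hT : Disjoint T₁ T₂) (h₁ : Set.BijOn f₁ S₁ T₁) (h₂ : Set.BijOn f₂ S₂ T₂)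
    (adj₁ : ∀ x ∈ S₁, ∀ y ∈ S₁, H.Adj (f₁ x) (f₁ y) ↔ G.Adj x y)
    (adj₂ : ∀ x ∈ S₂, ∀ y ∈ S₂, H.Adj (f₂ x) (f₂ y) ↔ G.Adj x y)
    (adj : ∀ x ∈ S₁, ∀ y ∈ S₂, H.Adj (f₁ x) (f₂ y) ↔ G.Adj x y) :
    ∃ f : V → W, Set.EqOn f f₁ S₁ ∧ Set.BijOn f (S₁ ∪ S₂) (T₁ ∪ T₂) ∧
      ∀ x ∈ S₁ ∪ S₂, ∀ y ∈ S₁ ∪ S₂, H.Adj (f x) (f y) ↔ G.Adj x y := by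
  have e1 : Set.EqOn (S₁.piecewise f₁ f₂) f₁ S₁ := Set.piecewise_eqOn S₁ f₁ f₂
  have e2 : Set.EqOn (S₁.piecewise f₁ f₂) f₂ S₂ := fun x hx =>
    Set.piecewise_eq_of_notMem S₁ f₁ f₂ fun h => Set.disjoint_left.1 hS h hx
  refine ⟨S₁.piecewise f₁ f₂, e1, ?_, ?_⟩
  · refine (h₁.congr e1.symm).union (h₂.congr e2.symm) ?_
    rw [Set.injOn_union hS]
    refine ⟨(h₁.congr e1.symm).injOn, (h₂.congr e2.symm).injOn, fun x hx y hy hxy => ?_⟩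
    rw [e1 hx, e2 hy] at hxy
    exact Set.disjoint_left.1 hT (h₁.mapsTo hx) (hxy ▸ h₂.mapsTo hy)
  · rintro x (hx | hx) y (hy | hy)
    · rw [e1 hx, e1 hy, adj₁ x hx y hy]
    · rw [e1 hx, e2 hy, adj x hx y hy]
    · rw [e2 hx, e1 hy, H.adj_comm, G.adj_comm, adj y hy x hx]
    · rw [e2 hx, e2 hy, adj₂ x hx y hy]

/-- Realizations of the same code are isomorphic. -/
theorem Realizes.exists_map {t : RT} {S : Set V} {r : V} {T : Set W} {q : W}
    (h : Realizes G t S r) (h' : Realizes H t T q) : ∃ f : V → W, f r = q ∧ Set.BijOn f S T ∧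
      ∀ x ∈ S, ∀ y ∈ S, H.Adj (f x) (f y) ↔ G.Adj x y := by
  induction t generalizing S r T q with
  | leaf =>
    obtain rfl : S = {r} := h
    obtain rfl : T = {q} := h'
    refine ⟨fun _ => q, rfl, ?_, ?_⟩
    · rw [Set.bijOn_singleton]
    · rintro x rfl y rfl
      simp
  | join t s iht ihs =>
    obtain ⟨S₁, S₂, c, h1, h2, hd, rfl, hadj⟩ := h
    obtain ⟨T₁, T₂, d, h1', h2', hd', rfl, hadj'⟩ := h'
    obtain ⟨f₁, hf₁, b₁, a₁⟩ := iht h1 h1'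
    obtain ⟨f₂, hf₂, b₂, a₂⟩ := ihs h2 h2'
    obtain ⟨f, e, b, a⟩ := exists_glue_map hd hd' b₁ b₂ a₁ a₂ (by
      intro x hx y hy
      rw [hadj x hx y hy, hadj' _ (b₁.mapsTo hx) _ (b₂.mapsTo hy), ← hf₁, ← hf₂,
        b₁.injOn.eq_iff hx h1.mem, b₂.injOn.eq_iff hy h2.mem])
    exact ⟨f, (e h1.mem).trans hf₁, b, a⟩

variable {k : ℕ} {t : RT} {c : ℕ → V} {S : Set V} {d : ℕ → W} {T : Set W}

theorem Decomp.adj_arc (h : Decomp G (k + 1) t c S) {i j : ℕ} (hi : 1 ≤ i) (hi' : i ≤ k)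
    (hj : 1 ≤ j) (hj' : j ≤ k) : G.Adj (c i) (c j) ↔ j = i + 1 ∨ i = j + 1 := by
  rcases lt_trichotomy i j with hij | rfl | hij
  · rw [h.adj i j hij (by omega)]
    omega
  · simp
  · rw [G.adj_comm, h.adj j i hij (by omega)]
    omega

/-- A potted graph is determined up to isomorphism by the length of its cycle and the code of its
tree. -/
theorem Decomp.nonempty_iso (h : Decomp G (k + 1) t c S) (h' : Decomp H (k + 1) t d T) :
    Nonempty (G ≃g H) := by
  obtain ⟨f₁, hf₁, b₁, a₁⟩ := h.realizes.exists_map h'.realizes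
  have hinj : Set.InjOn c (Set.Icc 1 k) := by
    intro i hi j hj hij
    by_contra hne
    rcases lt_or_gt_of_ne hne with hlt | hlt
    · exact h.inj i j hlt (Nat.lt_succ_of_le hj.2) hij
    · exact h.inj j i hlt (Nat.lt_succ_of_le hi.2) hij.symm
  have hf₂ : ∀ i, 1 ≤ i → i ≤ k → d (Function.invFunOn c (Set.Icc 1 k) (c i)) = d i :=
    fun i h1 h2 => by rw [hinj.leftInvOn_invFunOn ⟨h1, h2⟩]
  have b₂ : Set.BijOn (fun x => d (Function.invFunOn c (Set.Icc 1 k) x)) (arc c 1 k)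
      (arc d 1 k) := by
    refine ⟨?_, ?_, ?_⟩
    · rintro _ ⟨i, h1, h2, rfl⟩
      exact ⟨i, h1, h2, hf₂ i h1 h2⟩
    · rintro _ ⟨i, h1, h2, rfl⟩ _ ⟨j, h3, h4, rfl⟩ hij
      simp only [hf₂ i h1 h2, hf₂ j h3 h4] at hij
      rcases lt_trichotomy i j with hlt | rfl | hlt
      · exact absurd hij (h'.inj i j hlt (by omega))
      · rfl
      · exact absurd hij.symm (h'.inj j i hlt (by omega))
    · rintro _ ⟨i, h1, h2, rfl⟩
      exact ⟨c i, ⟨i, h1, h2, rfl⟩, hf₂ i h1 h2⟩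
  obtain ⟨f, -, b, a⟩ := exists_glue_map (G := G) (H := H) h.disjoint h'.disjoint b₁ b₂ a₁ (by
      rintro _ ⟨i, h1, h2, rfl⟩ _ ⟨j, h3, h4, rfl⟩
      simp only [hf₂ i h1 h2, hf₂ j h3 h4]
      rw [h.adj_arc h1 h2 h3 h4, h'.adj_arc h1 h2 h3 h4]) (by
      rintro x hx _ ⟨i, h1, h2, rfl⟩
      simp only [hf₂ i h1 h2]
      rw [h.adj_cross hx h1 h2, h'.adj_cross (b₁.mapsTo hx) h1 h2, ← hf₁,
        b₁.injOn.eq_iff hx h.realizes.mem])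
  rw [← h.univ_eq, ← h'.univ_eq] at b
  refine ⟨⟨Equiv.ofBijective f (Set.bijOn_univ.1 b), ?_⟩⟩
  intro x y
  rw [← h.univ_eq] at a
  exact a x trivial y trivial

theorem Decomp.of_iso (e : G ≃g H) (h : Decomp H k t d T) :
    ∃ c S, Decomp G k t c S := by
  refine ⟨fun i => e.symm (d i), e.symm '' T, ?_, ?_, ?_, ?_, ?_, ?_⟩
  · intro i j hij hj hc
    exact h.inj i j hij hj (e.symm.injective hc)
  · exact h.realizes.map e.symm.injective.injOn fun x _ y _ => e.symm.map_adj_iff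
  · intro x
    rcases h.cover (e x) with hx | ⟨i, h1, h2, h3⟩
    · exact .inl ⟨e x, hx, e.symm_apply_apply x⟩
    · exact .inr ⟨i, h1, h2, by rw [← h3, e.symm_apply_apply]⟩
  · rintro i h1 h2 ⟨x, hx, hxi⟩
    exact h.notMem i h1 h2 (e.symm.injective hxi ▸ hx)
  · intro i j hij hj
    rw [e.symm.map_adj_iff, h.adj i j hij hj]
  · rintro i h1 h2 _ ⟨x, hx, rfl⟩ hadj
    rw [e.symm.map_adj_iff] at hadj
    rw [h.outer i h1 h2 x hx hadj]

theorem Decomp.congr_code {s : RT} (h : Decomp G k t c S) (hs : Realizes G s S (c 0)) :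
    Decomp G k s c S :=
  { h with realizes := hs }

theorem Decomp.card [Fintype V] (h : Decomp G (k + 1) t c S) :
    Fintype.card V = t.size + k := by
  have h1 : (arc c 1 k).ncard = k := by
    have h2 : arc c 1 k = c '' (Set.Icc 1 k) := by
      ext x
      constructor
      · rintro ⟨i, h1, h2, rfl⟩; exact ⟨i, ⟨h1, h2⟩, rfl⟩
      · rintro ⟨i, ⟨h1, h2⟩, rfl⟩; exact ⟨i, h1, h2, rfl⟩
    rw [h2, Set.InjOn.ncard_image]
    · rw [← Finset.coe_Icc, Set.ncard_coe_finset]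
      simp
    · intro i hi j hj hij
      by_contra hne
      rcases lt_or_gt_of_ne hne with hlt | hlt
      · exact h.inj i j hlt (Nat.lt_succ_of_le hj.2) hij
      · exact h.inj j i hlt (Nat.lt_succ_of_le hi.2) hij.symm
  rw [← Nat.card_eq_fintype_card, ← Set.ncard_univ, h.univ_eq, Set.ncard_union_eq h.disjoint, h1,
    h.realizes.ncard]

end

/-! ### Every potted graph has a decomposition -/

section

variable {V : Type u}

/-- Every finite acyclic graph is, around a vertex, described by a code. -/
theorem exists_realizes [Finite V] {H : SimpleGraph V} (hH : H.IsAcyclic) (r : V) :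
    ∃ t, Realizes H t {x | H.Reachable r x} r := by
  induction hn : H.edgeSet.ncard using Nat.strong_induction_on generalizing H r with
  | _ n ih =>
  by_cases hr : ∃ c, H.Adj r c
  · obtain ⟨c, hc⟩ := hr
    -- The edge from `r` to `c` is a bridge, so deleting it splits the component of `r` into a
    -- smaller tree at `r` and a branch at `c`.
    have hb := SimpleGraph.isBridge_iff.1 (SimpleGraph.isAcyclic_iff_forall_adj_isBridge.1 hH hc)
    have hle : H.deleteEdges {s(r, c)} ≤ H := SimpleGraph.deleteEdges_le _
    have hlt : (H.deleteEdges {s(r, c)}).edgeSet.ncard < n := by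
      rw [SimpleGraph.edgeSet_deleteEdges, ← hn]
      exact Set.ncard_sdiff_singleton_lt_of_mem hc
    have hadj : ∀ x y, (H.deleteEdges {s(r, c)}).Adj x y ↔
        H.Adj x y ∧ ¬(x = r ∧ y = c ∨ x = c ∧ y = r) := by
      intro x y
      rw [SimpleGraph.deleteEdges_adj, Set.mem_singleton_iff, Sym2.eq_iff]
    obtain ⟨t, ht⟩ := ih _ hlt (hH.anti hle) r rfl
    obtain ⟨s, hs⟩ := ih _ hlt (hH.anti hle) c rfl
    generalize H.deleteEdges {s(r, c)} = H' at *
    refine ⟨.join t s, {x | H'.Reachable r x}, {x | H'.Reachable c x}, c,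
      ht.congr fun x hx y hy => ?_, hs.congr fun x hx y hy => ?_, ?_, ?_, ?_⟩
    · rw [hadj]
      refine ⟨fun h => ⟨h, ?_⟩, fun h => h.1⟩
      rintro (⟨-, rfl⟩ | ⟨rfl, -⟩)
      · exact hb hy
      · exact hb hx
    · rw [hadj]
      refine ⟨fun h => ⟨h, ?_⟩, fun h => h.1⟩
      rintro (⟨rfl, -⟩ | ⟨-, rfl⟩)
      · exact hb hx.symm
      · exact hb hy.symm
    · rw [Set.disjoint_left]
      exact fun x hx hy => hb (hx.trans hy.symm)
    · refine Set.Subset.antisymm (fun x hx => ?_) (Set.union_subset (fun x hx => hx.mono hle)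
        fun x hx => hc.reachable.trans (hx.mono hle))
      have key : ∀ a b (p : H.Walk a b), (H'.Reachable r a ∨ H'.Reachable c a) →
          (H'.Reachable r b ∨ H'.Reachable c b) := by
        intro a b p
        induction p with
        | nil => exact id
        | @cons u v _ h _ ih =>
          intro hu
          apply ih
          by_cases h' : H'.Adj u v
          · exact hu.imp (·.trans h'.reachable) (·.trans h'.reachable)
          · rw [hadj, not_and, not_not] at h'
            rcases h' h with ⟨-, rfl⟩ | ⟨-, rfl⟩
            · exact .inr .rfl
            · exact .inl .rfl
      obtain ⟨p⟩ : H.Reachable r x := hx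
      exact key _ _ p (.inl .rfl)
    · intro x hx y hy
      refine ⟨fun h => ?_, ?_⟩
      · by_contra hne
        have h' : H'.Adj x y := by
          rw [hadj]
          refine ⟨h, ?_⟩
          rintro (h' | ⟨rfl, rfl⟩)
          · exact hne h'
          · exact hb hx
        exact hb ((SimpleGraph.Reachable.trans hx h'.reachable).trans
          (SimpleGraph.Reachable.symm hy))
      · rintro ⟨rfl, rfl⟩
        exact hc
  · refine ⟨.leaf, ?_⟩
    show {x | H.Reachable r x} = {r}
    ext x
    constructor
    · rintro ⟨p⟩
      cases p with
      | nil => rfl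
      | cons h _ => exact absurd ⟨_, h⟩ hr
    · rintro rfl
      exact SimpleGraph.Reachable.rfl

/-- The only cycle of `G` runs through `c 0, …, c (k - 1)`, and only `c 0` has further
neighbours. -/
theorem IsPottedGraph.exists_cycle [Finite V] {G : SimpleGraph V} {k : ℕ}
    (h : IsPottedGraph G k) : ∃ (c : ℕ → V) (C : G.Subgraph), 3 ≤ k ∧ G.Connected ∧
      (∀ (C' : G.Subgraph) (l : ℕ), IsCycleSubgraph C' l → C' = C) ∧
      (∀ i j, i < j → j < k → c i ≠ c j) ∧ c k = c 0 ∧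
      (∀ x y, C.Adj x y ↔ ∃ i < k, (x = c i ∧ y = c (i + 1)) ∨ (y = c i ∧ x = c (i + 1))) ∧
      ∀ i, 0 < i → i < k → ∀ x, G.Adj (c i) x → C.Adj (c i) x := by
  classical
  obtain ⟨hc, C, ⟨v, p, hp, hpl, hpC⟩, huniq, w, ⟨hw, -⟩, hw'⟩ := h
  have hws : w ∈ p.support := by rwa [← hpC, SimpleGraph.Walk.mem_verts_toSubgraph] at hw
  -- The cycle is restarted at the unique cycle vertex of degree larger than two, which becomes `c
  -- 0`.
  have hq := hp.rotate hws
  have hql : (p.rotate w hws).length = k := by rw [SimpleGraph.Walk.length_rotate, hpl]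
  have hqC : (p.rotate w hws).toSubgraph = C := by
    rw [SimpleGraph.Walk.toSubgraph_rotate, hpC]
  generalize p.rotate w hws = q at hq hql hqC
  have h3 : 3 ≤ k := hql ▸ hq.three_le_length
  have hinj : ∀ i j, i < j → j < k → q.getVert i ≠ q.getVert j := by
    intro i j hij hj he
    have := hq.getVert_injOn' (show i ≤ q.length - 1 by omega) (show j ≤ q.length - 1 by omega) he
    omega
  refine ⟨q.getVert, C, h3, hc, huniq, hinj, ?_, ?_, ?_⟩
  · rw [← hql, SimpleGraph.Walk.getVert_length, SimpleGraph.Walk.getVert_zero]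
  · intro x y
    rw [← hqC, SimpleGraph.Walk.toSubgraph_adj_iff]
    constructor
    · rintro ⟨i, h1, h2⟩
      rw [Sym2.eq_iff] at h1
      exact ⟨i, hql ▸ h2, by rcases h1 with ⟨h1, h2⟩ | ⟨h1, h2⟩ <;> simp [h1, h2]⟩
    · rintro ⟨i, h2, h1⟩
      refine ⟨i, ?_, hql.symm ▸ h2⟩
      rw [Sym2.eq_iff]
      rcases h1 with ⟨h1, h2⟩ | ⟨h1, h2⟩ <;> simp [h1, h2]
  · intro i h1 h2 x hx
    have hmem : q.getVert i ∈ q.support := q.getVert_mem_support i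
    have hCi : q.getVert i ∈ C.verts := by
      rw [← hqC, SimpleGraph.Walk.mem_verts_toSubgraph]
      exact hmem
    have hdeg : (G.neighborSet (q.getVert i)).ncard ≤ 2 := by
      by_contra hlt
      have := hw' _ ⟨hCi, not_le.1 hlt⟩
      exact hinj 0 i h1 h2 (by rw [SimpleGraph.Walk.getVert_zero, this])
    -- The cycle already provides two neighbours and the degree is at most two, so nothing else is
    -- attached here.
    have heq : C.neighborSet (q.getVert i) = G.neighborSet (q.getVert i) := by
      refine Set.eq_of_subset_of_ncard_le (C.neighborSet_subset _) ?_
      rw [← hqC, hq.ncard_neighborSet_toSubgraph_eq_two hmem]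
      exact hdeg
    have hx' : x ∈ G.neighborSet (q.getVert i) := hx
    rw [← heq] at hx'
    exact hx'

/-- A potted graph consists of its cycle and a rooted tree. -/
theorem IsPottedGraph.exists_decomp [Finite V] {G : SimpleGraph V} {k : ℕ}
    (h : IsPottedGraph G k) : 3 ≤ k ∧ ∃ t c S, Decomp G k t c S := by
  obtain ⟨c, C, h3, hconn, huniq, hinj, hck, hC, hnb⟩ := h.exists_cycle
  have hadj : ∀ x y, (G.deleteEdges C.edgeSet).Adj x y ↔ G.Adj x y ∧ ¬C.Adj x y := by
    intro x y
    rw [SimpleGraph.deleteEdges_adj, SimpleGraph.Subgraph.mem_edgeSet]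
  -- A cycle avoiding the edges of `C` would be a cycle of `G`, hence equal to `C` by uniqueness.
  have hacyc : (G.deleteEdges C.edgeSet).IsAcyclic := by
    intro v q hq
    have hle : G.deleteEdges C.edgeSet ≤ G := SimpleGraph.deleteEdges_le _
    have hC' := huniq _ _ ⟨v, q.mapLe hle, hq.mapLe hle, rfl, rfl⟩
    have h3' := hq.three_le_length
    have h1 : (q.mapLe hle).toSubgraph.Adj (q.getVert 0) (q.getVert 1) := by
      rw [← SimpleGraph.Subgraph.mem_edgeSet, SimpleGraph.Walk.mem_edges_toSubgraph,
        SimpleGraph.Walk.edges_mapLe_eq_edges, ← SimpleGraph.Walk.mem_edges_toSubgraph,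
        SimpleGraph.Subgraph.mem_edgeSet]
      exact q.toSubgraph_adj_getVert (by omega)
    rw [hC'] at h1
    have h2 : (G.deleteEdges C.edgeSet).Adj (q.getVert 0) (q.getVert 1) :=
      q.adj_getVert_succ (by omega)
    exact ((hadj _ _).1 h2).2 h1
  obtain ⟨t, ht⟩ := exists_realizes hacyc (c 0)
  generalize G.deleteEdges C.edgeSet = H at *
  have hnot : ∀ i, 0 < i → i < k → ¬H.Reachable (c 0) (c i) := by
    rintro i h1 h2 hr
    obtain ⟨p⟩ := hr.symm
    generalize hy : c 0 = y at p
    cases p with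
    | nil => exact hinj 0 i h1 h2 hy
    | cons h _ =>
      rw [hadj] at h
      exact h.2 (hnb i h1 h2 _ h.1)
  have hCmem : ∀ x y, C.Adj x y → ∃ i < k, x = c i := by
    intro x y hxy
    rw [hC] at hxy
    obtain ⟨i, hi, ⟨h, -⟩ | ⟨-, h⟩⟩ := hxy
    · exact ⟨i, hi, h⟩
    · rcases (show i + 1 ≤ k from hi).eq_or_lt with h' | h'
      · exact ⟨0, by omega, by rw [h, h', hck]⟩
      · exact ⟨i + 1, h', h⟩
  have hCS : ∀ x y, H.Reachable (c 0) x → C.Adj x y → x = c 0 := by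
    intro x y hx hxy
    obtain ⟨i, hi, rfl⟩ := hCmem x y hxy
    rcases Nat.eq_zero_or_pos i with rfl | h
    · rfl
    · exact absurd hx (hnot i h hi)
  refine ⟨h3, t, c, _, hinj, ht.congr fun x hx y hy => ?_, ?_, hnot, ?_, ?_⟩
  · rw [hadj]
    refine ⟨fun h => ⟨h, fun h' => ?_⟩, fun h => h.1⟩
    have h1 := hCS x y hx h'
    have h2 := hCS y x hy h'.symm
    exact h.ne (h1.trans h2.symm)
  · have key : ∀ a b (p : G.Walk a b), (H.Reachable (c 0) a ∨ ∃ i, 0 < i ∧ i < k ∧ a = c i) →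
        (H.Reachable (c 0) b ∨ ∃ i, 0 < i ∧ i < k ∧ b = c i) := by
      intro a b p
      induction p with
      | nil => exact id
      | @cons u v _ h _ ih =>
        intro hu
        apply ih
        by_cases h' : C.Adj u v
        · obtain ⟨i, hi, rfl⟩ := hCmem v u h'.symm
          rcases Nat.eq_zero_or_pos i with rfl | hpos
          · exact .inl .rfl
          · exact .inr ⟨i, hpos, hi, rfl⟩
        · rcases hu with hu | ⟨i, h1, h2, rfl⟩
          · exact .inl (hu.trans ((hadj u v).2 ⟨h, h'⟩).reachable)
          · exact absurd (hnb i h1 h2 v h) h'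
    intro x
    obtain ⟨p⟩ := hconn.preconnected (c 0) x
    exact key _ _ p (.inl .rfl)
  · intro i j hij hj
    have hinj' : ∀ a b, a < k → b < k → c a = c b → a = b := by
      intro a b ha hb hab
      rcases lt_trichotomy a b with hlt | rfl | hlt
      · exact absurd hab (hinj a b hlt hb)
      · rfl
      · exact absurd hab.symm (hinj b a hlt ha)
    have hsucc : ∀ a b, a < k → b < k → c b = c (a + 1) → b = a + 1 ∨ (b = 0 ∧ a = k - 1) := by
      intro a b ha hb hab
      rcases (show a + 1 ≤ k from ha).eq_or_lt with h' | h'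
      · rw [h', hck] at hab
        exact .inr ⟨hinj' b 0 hb (by omega) hab, by omega⟩
      · exact .inl (hinj' b (a + 1) hb h' hab)
    have hGC : G.Adj (c i) (c j) ↔ C.Adj (c i) (c j) :=
      ⟨fun h => (hnb j (by omega) hj _ h.symm).symm, fun h => C.adj_sub h⟩
    rw [hGC, hC]
    constructor
    · rintro ⟨a, ha, ⟨h1, h2⟩ | ⟨h1, h2⟩⟩
      · obtain rfl := hinj' _ _ (by omega) ha h1
        rcases hsucc _ _ ha hj h2 with h | h
        · exact .inl h
        · omega
      · obtain rfl := hinj' _ _ hj ha h1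
        rcases hsucc _ _ ha (by omega) h2 with h | h
        · omega
        · exact .inr h
    · rintro (rfl | ⟨rfl, rfl⟩)
      · exact ⟨i, by omega, .inl ⟨rfl, rfl⟩⟩
      · refine ⟨k - 1, by omega, .inr ⟨rfl, ?_⟩⟩
        rw [show k - 1 + 1 = k by omega, hck]
  · intro i h1 h2 x hx hxi
    exact hCS x (c i) hx (hnb i h1 h2 x hxi.symm).symm

end

/-! ### Codes of the glued and joined graphs -/

/-- The pointed graph `T` is the rooted tree with code `t`. -/
def Coded (T : PointedGraph) (t : RT) : Prop := Realizes T.graph t Set.univ T.base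

section Glue

variable {ι : Type} (T : ι → PointedGraph)

open Classical in
/-- The inclusion of a part in the glued graph. -/
noncomputable def glueIn (i : ι) (x : (T i).Vert) : (glue T).Vert :=
  if h : x = (T i).base then none else some ⟨i, x, h⟩

theorem glueIn_base (i : ι) : glueIn T i (T i).base = none := dif_pos rfl

theorem glueIn_of_ne {i : ι} {x : (T i).Vert} (h : x ≠ (T i).base) :
    glueIn T i x = some ⟨i, x, h⟩ := dif_neg h

theorem glueIn_injective (i : ι) : Function.Injective (glueIn T i) := by
  intro x y h
  by_cases hx : x = (T i).base <;> by_cases hy : y = (T i).base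
  · rw [hx, hy]
  · rw [hx, glueIn_base, glueIn_of_ne T hy] at h
    cases h
  · rw [hy, glueIn_base, glueIn_of_ne T hx] at h
    cases h
  · rw [glueIn_of_ne T hx, glueIn_of_ne T hy] at h
    cases h
    rfl

theorem glueIn_eq {i j : ι} (hij : i ≠ j) {x : (T i).Vert} {y : (T j).Vert}
    (h : glueIn T i x = glueIn T j y) : x = (T i).base := by
  by_contra hx
  rw [glueIn_of_ne T hx] at h
  by_cases hy : y = (T j).base
  · rw [hy, glueIn_base] at h
    cases h
  · rw [glueIn_of_ne T hy] at h
    cases h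
    exact hij rfl

theorem glueIn_adj (i : ι) (x y : (T i).Vert) :
    (glue T).graph.Adj (glueIn T i x) (glueIn T i y) ↔ (T i).graph.Adj x y := by
  show GlueAdj T _ _ ↔ _
  by_cases hx : x = (T i).base <;> by_cases hy : y = (T i).base
  · rw [hx, hy, glueIn_base]
    exact ⟨fun h => (by cases h), fun h => absurd rfl h.ne⟩
  · rw [hx, glueIn_base, glueIn_of_ne T hy]
    refine ⟨fun h => ?_, fun h => .fromBase i ⟨y, hy⟩ h⟩
    cases h
    assumption
  · rw [hy, glueIn_base, glueIn_of_ne T hx]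
    refine ⟨fun h => ?_, fun h => .toBase i ⟨x, hx⟩ h⟩
    cases h
    assumption
  · rw [glueIn_of_ne T hx, glueIn_of_ne T hy]
    refine ⟨fun h => ?_, fun h => .inner i ⟨x, hx⟩ ⟨y, hy⟩ h⟩
    cases h
    assumption

theorem glueIn_adj_of_ne {i j : ι} (hij : i ≠ j) {x : (T i).Vert} {y : (T j).Vert}
    (hx : x ≠ (T i).base) (hy : y ≠ (T j).base) :
    ¬(glue T).graph.Adj (glueIn T i x) (glueIn T j y) := by
  intro h
  replace h : GlueAdj T _ _ := h
  rw [glueIn_of_ne T hx, glueIn_of_ne T hy] at h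
  cases h
  exact hij rfl

theorem exists_glueIn [Nonempty ι] (v : (glue T).Vert) : ∃ i x, v = glueIn T i x := by
  rcases v with _ | ⟨i, x, hx⟩
  · exact ⟨Classical.arbitrary ι, _, (glueIn_base T _).symm⟩
  · exact ⟨i, x, (glueIn_of_ne T hx).symm⟩

variable {T}

/-- Each base is a leaf of its part, so each part adds exactly one branch at the common vertex. The
induction runs over the parts already glued, hence the restricted vertex set. -/
theorem Coded.glue_ofKids {a : ι → RT} (h : ∀ i, Coded (T i) (join leaf (a i))) (l : List ι)
    (hl : l.Nodup) : Realizes (glue T).graph (ofKids (l.map a))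
      {v | v = none ∨ ∃ i ∈ l, ∃ x, v = glueIn T i x} none := by
  induction l with
  | nil =>
    show {v | v = none ∨ ∃ i ∈ [], ∃ x, v = glueIn T i x} = {none}
    ext v
    simp
  | cons i l ih =>
    rw [List.nodup_cons] at hl
    obtain ⟨S₁, S₂, c, hS₁, h2, hd, hS, hadj⟩ := h i
    obtain rfl : S₁ = {(T i).base} := hS₁
    have hS₂ : ∀ x ∈ S₂, x ≠ (T i).base := fun x hx hxb =>
      Set.disjoint_left.1 hd (show x ∈ {(T i).base} from hxb) hx
    have hout : ∀ j ∈ l, ∀ x, ∀ y ∈ S₂, glueIn T j x = glueIn T i y → False := by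
      intro j hj x y hy hxy
      exact hS₂ y hy (glueIn_eq T (fun hij : i = j => hl.1 (hij ▸ hj)) hxy.symm)
    refine ⟨_, glueIn T i '' S₂, glueIn T i c, ih hl.2,
      h2.map (glueIn_injective T i).injOn fun x _ y _ => glueIn_adj T i x y, ?_, ?_, ?_⟩
    · rw [Set.disjoint_right]
      rintro _ ⟨y, hy, rfl⟩ (h | ⟨j, hj, x, h⟩)
      · rw [← glueIn_base T i] at h
        exact hS₂ y hy (glueIn_injective T i h)
      · exact hout j hj x y hy h.symm
    · ext v
      constructor
      · rintro (rfl | ⟨j, hj, x, rfl⟩)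
        · exact .inl (.inl rfl)
        · rcases List.mem_cons.1 hj with rfl | hj
          · have hx : x ∈ {(T j).base} ∪ S₂ := hS ▸ Set.mem_univ x
            rcases hx with hx | hx
            · exact .inl (.inl (by rw [show x = (T j).base from hx, glueIn_base]))
            · exact .inr ⟨x, hx, rfl⟩
          · exact .inl (.inr ⟨j, hj, x, rfl⟩)
      · rintro ((rfl | ⟨j, hj, x, rfl⟩) | ⟨x, -, rfl⟩)
        · exact .inl rfl
        · exact .inr ⟨j, List.mem_cons_of_mem _ hj, x, rfl⟩
        · exact .inr ⟨i, List.mem_cons_self, x, rfl⟩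
    · have hbase : ∀ y ∈ S₂, (glue T).graph.Adj none (glueIn T i y) ↔ y = c := by
        intro y hy
        rw [← glueIn_base T i, glueIn_adj, hadj _ rfl y hy]
        simp
      rintro v hv _ ⟨y, hy, rfl⟩
      rw [(glueIn_injective T i).eq_iff]
      by_cases hvn : v = none
      · rw [hvn, hbase y hy]
        exact ⟨fun h => ⟨rfl, h⟩, fun h => h.2⟩
      · refine iff_of_false (fun hvy => ?_) (fun hvy => hvn hvy.1)
        rcases hv with rfl | ⟨j, hj, x, rfl⟩
        · exact hvn rfl
        · refine glueIn_adj_of_ne T (fun hij : j = i => hl.1 (hij ▸ hj)) (fun hx => ?_) (hS₂ y hy) hvy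
          rw [hx, glueIn_base] at hvn
          exact hvn rfl

/-- A cycle and a tree glued at a vertex. -/
theorem Decomp.glue {i j : ι} (hij : i ≠ j) (hι : ∀ a, a = i ∨ a = j) {k : ℕ} {t : RT}
    {d : ℕ → (T i).Vert} (hd : Decomp (T i).graph k leaf d {(T i).base}) (ht : Coded (T j) t) :
    Decomp (glue T).graph k t (fun a => glueIn T i (d a)) (Set.range (glueIn T j)) := by
  have hd0 : d 0 = (T i).base := hd.realizes.mem
  have hne : ∀ a, 0 < a → a < k → d a ≠ (T i).base := fun a h1 h2 => hd.notMem a h1 h2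
  refine ⟨fun a b hab hb h => hd.inj a b hab hb (glueIn_injective T i h), ?_, ?_, ?_, ?_, ?_⟩
  · have := ht.map (f := glueIn T j) (glueIn_injective T j).injOn
      fun x _ y _ => glueIn_adj T j x y
    rwa [Set.image_univ, glueIn_base, ← glueIn_base T i, ← hd0] at this
  · intro v
    have : Nonempty ι := ⟨i⟩
    obtain ⟨a, x, rfl⟩ := exists_glueIn T v
    rcases hι a with rfl | rfl
    · rcases hd.cover x with hx | ⟨b, h1, h2, rfl⟩
      · exact .inl ⟨_, by rw [show x = (T a).base from hx, glueIn_base, glueIn_base]⟩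
      · exact .inr ⟨b, h1, h2, rfl⟩
    · exact .inl ⟨x, rfl⟩
  · rintro a h1 h2 ⟨x, hx⟩
    exact hne a h1 h2 (glueIn_eq T hij hx.symm)
  · intro a b hab hb
    rw [glueIn_adj, hd.adj a b hab hb]
  · rintro a h1 h2 _ ⟨x, rfl⟩ hadj
    by_contra hx
    refine glueIn_adj_of_ne T hij.symm (fun h => hx ?_) (hne a h1 h2) hadj
    rw [hd0, h, glueIn_base, glueIn_base]

end Glue

theorem coded_glueList {L : List PointedGraph} {A : List RT}
    (h : List.Forall₂ (fun T a => Coded T (join leaf a)) L A) :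
    Coded (glueList L) (ofKids A) := by
  obtain ⟨hlen, hget⟩ := List.forall₂_iff_get.1 h
  have h1 := Coded.glue_ofKids (T := fun i : Fin L.length => L.get i)
    (a := fun i => A.get (i.cast hlen)) (fun i => hget i.1 i.2 _) (List.finRange L.length)
    (List.nodup_finRange _)
  have hA : (List.finRange L.length).map (fun i => A.get (i.cast hlen)) = A := by
    apply List.ext_get
    · simp [hlen]
    · intro n h1 h2
      simp
  rw [hA] at h1
  have hS : ∀ S : Set (glueList L).Vert, Realizes (glueList L).graph (ofKids A) S none →
      (∀ v, v ∈ S) → Coded (glueList L) (ofKids A) := by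
    intro S h hS
    rw [Set.eq_univ_of_forall hS] at h
    exact h
  refine hS _ h1 ?_
  · rintro (_ | ⟨i, x, hx⟩)
    · exact .inl rfl
    · exact .inr ⟨i, List.mem_finRange i, x, (glueIn_of_ne _ hx).symm⟩

/-- A bare cycle counts as a decomposition with a one-vertex tree; its vertices are traversed as `c
+ i` modulo `k`. -/
theorem decomp_cycleGraph {k : ℕ} (hk : 3 ≤ k) (c : Fin k) :
    ∃ d, Decomp (SimpleGraph.cycleGraph k) k leaf d {c} := by
  have : NeZero k := ⟨by omega⟩
  have hv : ∀ i j, i < j → j < k → ((c + Fin.ofNat k j) - (c + Fin.ofNat k i)).val = j - i := by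
    intro i j hij hj
    rw [add_sub_add_left_eq_sub, Fin.sub_def]
    simp only [Fin.val_ofNat]
    rw [Nat.mod_eq_of_lt hj, Nat.mod_eq_of_lt (hij.trans hj), show k - i + j = (j - i) + k by omega,
      Nat.add_mod_right, Nat.mod_eq_of_lt (by omega)]
  have hv' : ∀ i j, i < j → j < k →
      ((c + Fin.ofNat k i) - (c + Fin.ofNat k j)).val = k - j + i := by
    intro i j hij hj
    rw [add_sub_add_left_eq_sub, Fin.sub_def]
    simp only [Fin.val_ofNat]
    rw [Nat.mod_eq_of_lt hj, Nat.mod_eq_of_lt (hij.trans hj), Nat.mod_eq_of_lt (by omega)]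
  have h0 : c + Fin.ofNat k 0 = c := by simp
  have hinj : ∀ i j, i < j → j < k → c + Fin.ofNat k i ≠ c + Fin.ofNat k j := by
    intro i j hij hj h
    have := hv i j hij hj
    rw [h, sub_self] at this
    simp at this
    omega
  refine ⟨fun i => c + Fin.ofNat k i, hinj, ?_, ?_, ?_, ?_, ?_⟩
  · show {c} = {c + Fin.ofNat k 0}
    rw [h0]
  · intro x
    have hx : c + Fin.ofNat k (x - c).val = x := by simp
    rcases Nat.eq_zero_or_pos (x - c).val with h | h
    · left
      rw [h, h0] at hx
      exact hx.symm
    · exact .inr ⟨(x - c).val, h, (x - c).2, hx.symm⟩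
  · intro i h1 h2 h
    exact hinj 0 i h1 h2 (h0.trans (show _ = c from h).symm)
  · intro i j hij hj
    rw [SimpleGraph.cycleGraph_adj', hv i j hij hj, hv' i j hij hj]
    omega
  · rintro i _ _ x hx _
    exact (show x = c from hx).trans h0.symm

/-- The cycle vertex used for gluing is immaterial, because all choices have the same code. -/
theorem isCycleGlue_iff {V : Type u} {G : SimpleGraph V} {k : ℕ} (hk : 3 ≤ k) {T : PointedGraph}
    {t : RT} (hT : Coded T t) : IsCycleGlue G k T ↔ ∃ c S, Decomp G k t c S := by
  have key : ∀ c : Fin k, ∃ d S,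
      Decomp (glueList [⟨Fin k, SimpleGraph.cycleGraph k, c⟩, T]).graph k t d S := by
    intro c
    obtain ⟨d, hd⟩ := decomp_cycleGraph hk c
    exact ⟨_, _, Decomp.glue
      (T := fun i : Fin 2 => [PointedGraph.mk (Fin k) (SimpleGraph.cycleGraph k) c, T].get i) (i := 0) (j := 1)
      (by decide) (by decide) hd hT⟩
  constructor
  · rintro ⟨c, ⟨e⟩⟩
    obtain ⟨d, S, h⟩ := key c
    exact h.of_iso e
  · rintro ⟨c, S, h⟩
    obtain ⟨d, S', h'⟩ := key ⟨0, by omega⟩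
    obtain ⟨m, rfl⟩ : ∃ m, k = m + 1 := ⟨k - 1, by omega⟩
    exact ⟨_, h.nonempty_iso h'⟩

theorem Decomp.sum {W : Type u} {X : Type u} {C : SimpleGraph W} {H : SimpleGraph X} {w : W}
    {x : X} {k : ℕ} {t : RT} {d : ℕ → W} (hd : Decomp C k leaf d {w})
    (ht : Realizes H t Set.univ x) :
    Decomp (SimpleGraph.sum C H ⊔ SimpleGraph.edge (Sum.inl w) (Sum.inr x)) k (join leaf t)
      (fun a => Sum.inl (d a)) ({Sum.inl w} ∪ Set.range Sum.inr) := by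
  have hd0 : d 0 = w := hd.realizes.mem
  have hll : ∀ a b : W, (SimpleGraph.sum C H ⊔ SimpleGraph.edge (Sum.inl w) (Sum.inr x)).Adj
      (Sum.inl a) (Sum.inl b) ↔ C.Adj a b := by
    intro a b
    simp [SimpleGraph.sup_adj, SimpleGraph.edge_adj]
  have hrr : ∀ a b : X, (SimpleGraph.sum C H ⊔ SimpleGraph.edge (Sum.inl w) (Sum.inr x)).Adj
      (Sum.inr a) (Sum.inr b) ↔ H.Adj a b := by
    intro a b
    simp [SimpleGraph.sup_adj, SimpleGraph.edge_adj]
  have hlr : ∀ (a : W) (b : X),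
      (SimpleGraph.sum C H ⊔ SimpleGraph.edge (Sum.inl w) (Sum.inr x)).Adj
      (Sum.inl a) (Sum.inr b) ↔ a = w ∧ b = x := by
    intro a b
    simp [SimpleGraph.sup_adj, SimpleGraph.edge_adj]
  refine ⟨fun a b hab hb h => hd.inj a b hab hb (Sum.inl_injective h), ?_, ?_, ?_, ?_, ?_⟩
  · refine ⟨{Sum.inl w}, Set.range Sum.inr, Sum.inr x, ?_, ?_, ?_, rfl, ?_⟩
    · show {Sum.inl w} = {Sum.inl (d 0)}
      rw [hd0]
    · rw [← Set.image_univ]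
      exact ht.map Sum.inr_injective.injOn fun a _ b _ => hrr a b
    · simp
    · rintro _ rfl _ ⟨b, rfl⟩
      rw [hlr, hd0]
      simp
  · rintro (a | b)
    · rcases hd.cover a with h | ⟨i, h1, h2, rfl⟩
      · exact .inl (.inl (by rw [show a = w from h]; rfl))
      · exact .inr ⟨i, h1, h2, rfl⟩
    · exact .inl (.inr ⟨b, rfl⟩)
  · rintro i h1 h2 (h | ⟨b, h⟩)
    · exact hd.notMem i h1 h2 (Sum.inl_injective h)
    · cases h
  · intro a b hab hb
    rw [hll, hd.adj a b hab hb]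
  · rintro i h1 h2 _ (rfl | ⟨b, rfl⟩) hadj
    · rw [hd0]
    · rw [SimpleGraph.adj_comm, hlr] at hadj
      exact absurd hadj.1 (hd.notMem i h1 h2)

/-- The connecting edge turns the pointed tree into the single branch at a cycle vertex, whence
`join leaf t`. -/
theorem isCycleJoin_iff {V : Type u} {G : SimpleGraph V} {k : ℕ} (hk : 3 ≤ k) {T : PointedGraph}
    {t : RT} (hT : Coded T t) :
    IsCycleJoin G k T ↔ ∃ c S, Decomp G k (join leaf t) c S := by
  constructor
  · rintro ⟨c, ⟨e⟩⟩
    obtain ⟨d, hd⟩ := decomp_cycleGraph hk c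
    exact (hd.sum hT).of_iso e
  · rintro ⟨c, S, h⟩
    obtain ⟨d, hd⟩ := decomp_cycleGraph hk ⟨0, by omega⟩
    obtain ⟨m, rfl⟩ : ∃ m, k = m + 1 := ⟨k - 1, by omega⟩
    exact ⟨_, h.nonempty_iso (hd.sum hT)⟩

theorem realizes_pathGraph (m : ℕ) :
    Realizes (SimpleGraph.pathGraph (m + 1)) (path m) Set.univ 0 := by
  have hv : ∀ i, i ≤ 0 + m → (Fin.ofNat (m + 1) i).val = i := by
    intro i hi
    rw [Fin.val_ofNat, Nat.mod_eq_of_lt (by omega)]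
  have h := realizes_path (G := SimpleGraph.pathGraph (m + 1)) (c := Fin.ofNat (m + 1)) m (a := 0)
    (by
      intro i j _ hij hj h
      have := congrArg Fin.val h
      rw [hv i (by omega), hv j hj] at this
      omega)
    (by
      intro i j _ hij hj
      rw [SimpleGraph.pathGraph_adj, hv i (by omega), hv j hj]
      omega)
  rwa [show {x | ∃ i, 0 ≤ i ∧ i ≤ 0 + m ∧ x = Fin.ofNat (m + 1) i} = Set.univ from
    Set.eq_univ_of_forall fun x => ⟨x, Nat.zero_le _, by omega, by simp⟩] at h

theorem coded_P2 : Coded P2 (join leaf leaf) := realizes_pathGraph 1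

theorem coded_P3 : Coded P3 (join leaf edge) := realizes_pathGraph 2

theorem coded_P4 : Coded P4 (join leaf pathEnd) := realizes_pathGraph 3

theorem realizes_star : Realizes (completeBipartiteGraph (Fin 1) (Fin 3)) (join leaf pathMid)
    Set.univ (Sum.inr 0) := by
  refine ⟨{Sum.inr 0}, {Sum.inl 0, Sum.inr 1, Sum.inr 2}, Sum.inl 0, rfl,
    ⟨{Sum.inl 0, Sum.inr 1}, {Sum.inr 2}, Sum.inr 2,
      ⟨{Sum.inl 0}, {Sum.inr 1}, Sum.inr 1, rfl, rfl, ?_, ?_, ?_⟩, rfl, ?_, ?_, ?_⟩, ?_, ?_, ?_⟩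
  all_goals simp [Set.ext_iff, Fin.forall_fin_succ]

theorem coded_K13 : Coded K13 (join leaf pathMid) := realizes_star

/-- `T` has a single edge at its base, leading to the tree with code `a`. -/
def Branch (T : PointedGraph) (a : RT) : Prop := Coded T (join leaf a)

theorem IsP4K13List.exists_codes {L : List PointedGraph} (hL : IsP4K13List L) :
    ∃ l e q, P3List l e q ∧ List.Forall₂ Branch L l := by
  induction L with
  | nil => exact ⟨[], 0, 0, .nil, .nil⟩
  | cons T L ih =>
    obtain ⟨l, e, q, h, hl⟩ := ih fun T hT => hL T (List.mem_cons_of_mem _ hT)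
    rcases hL T List.mem_cons_self with rfl | rfl
    · exact ⟨_, _, _, h.consEnd, .cons coded_P4 hl⟩
    · exact ⟨_, _, _, h.consMid, .cons coded_K13 hl⟩

theorem P3List.exists_graphs {l : List RT} {e q : ℕ} (h : P3List l e q) :
    ∃ L, IsP4K13List L ∧ List.Forall₂ Branch L l := by
  induction h with
  | nil => exact ⟨[], by simp [IsP4K13List], .nil⟩
  | consEnd _ ih =>
    obtain ⟨L, hL, hl⟩ := ih
    exact ⟨P4 :: L, List.forall_mem_cons.2 ⟨.inl rfl, hL⟩, .cons coded_P4 hl⟩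
  | consMid _ ih =>
    obtain ⟨L, hL, hl⟩ := ih
    exact ⟨K13 :: L, List.forall_mem_cons.2 ⟨.inr rfl, hL⟩, .cons coded_K13 hl⟩

theorem p3List_replicate (q : ℕ) : P3List (List.replicate q pathEnd) q q := by
  induction q with
  | zero => exact .nil
  | succ q ih => exact ih.consEnd

/-- This is how the families consisting of copies of `P4` only arise. -/
theorem P3List.eq_replicate {l : List RT} {e q : ℕ} (h : P3List l e q) (heq : e = q) :
    l = List.replicate q pathEnd := by
  induction h with
  | nil => rfl
  | consEnd _ ih => rw [ih (by omega), List.replicate_succ]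
  | consMid h _ => exact absurd heq (by have := h.le; omega)

theorem branch_replicate (q : ℕ) :
    List.Forall₂ Branch (List.replicate q P4) (List.replicate q pathEnd) := by
  induction q with
  | zero => exact .nil
  | succ q ih => exact .cons coded_P4 ih

/-! ### The families in terms of codes -/

section

variable {V : Type u} {G : SimpleGraph V} {k : ℕ}

theorem inG1_iff (hk : 3 ≤ k) : InG1 G k ↔ ∃ q c S,
    Decomp G k (join leaf (ofKids (edge :: List.replicate q pathEnd))) c S :=
  exists_congr fun q => isCycleJoin_iff hk (coded_glueList (.cons coded_P3 (branch_replicate q)))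

theorem inG2_iff (hk : 3 ≤ k) : InG2 G k ↔ ∃ l e q, P3List l e q ∧ ∃ c S,
    Decomp G k (join leaf (ofKids (leaf :: edge :: l))) c S := by
  constructor
  · rintro ⟨L, hL, h⟩
    obtain ⟨l, e, q, hl, hb⟩ := hL.exists_codes
    exact ⟨l, e, q, hl,
      (isCycleJoin_iff hk (coded_glueList (.cons coded_P2 (.cons coded_P3 hb)))).1 h⟩
  · rintro ⟨l, e, q, hl, h⟩
    obtain ⟨L, hL, hb⟩ := hl.exists_graphs
    exact ⟨L, hL,
      (isCycleJoin_iff hk (coded_glueList (.cons coded_P2 (.cons coded_P3 hb)))).2 h⟩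

theorem inG6_iff (hk : 3 ≤ k) : InG6 G k ↔ ∃ l e q, P3List l e q ∧ ∃ c S,
    Decomp G k (ofKids (edge :: l)) c S := by
  constructor
  · rintro ⟨L, hL, h⟩
    obtain ⟨l, e, q, hl, hb⟩ := hL.exists_codes
    exact ⟨l, e, q, hl, (isCycleGlue_iff hk (coded_glueList (.cons coded_P3 hb))).1 h⟩
  · rintro ⟨l, e, q, hl, h⟩
    obtain ⟨L, hL, hb⟩ := hl.exists_graphs
    exact ⟨L, hL, (isCycleGlue_iff hk (coded_glueList (.cons coded_P3 hb))).2 h⟩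

theorem inG7_iff (hk : 3 ≤ k) : InG7 G k ↔ ∃ l e q, P3List l e q ∧ ∃ c S,
    Decomp G k (ofKids (leaf :: leaf :: l)) c S := by
  constructor
  · rintro ⟨L, hL, h⟩
    obtain ⟨l, e, q, hl, hb⟩ := hL.exists_codes
    exact ⟨l, e, q, hl,
      (isCycleGlue_iff hk (coded_glueList (.cons coded_P2 (.cons coded_P2 hb)))).1 h⟩
  · rintro ⟨l, e, q, hl, h⟩
    obtain ⟨L, hL, hb⟩ := hl.exists_graphs
    exact ⟨L, hL, (isCycleGlue_iff hk (coded_glueList (.cons coded_P2 (.cons coded_P2 hb)))).2 h⟩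

theorem inG8_iff (hk : 3 ≤ k) : InG8 G k ↔ ∃ q, 1 ≤ q ∧ ∃ c S,
    Decomp G k (ofKids (List.replicate q pathEnd)) c S :=
  exists_congr fun q => and_congr_right fun _ =>
    isCycleGlue_iff hk (coded_glueList (branch_replicate q))

theorem inG9_iff (hk : 3 ≤ k) : InG9 G k ↔ ∃ l e q, P3List l e q ∧ ∃ c S,
    Decomp G k (ofKids (leaf :: l)) c S := by
  constructor
  · rintro ⟨L, hL, h⟩
    obtain ⟨l, e, q, hl, hb⟩ := hL.exists_codes
    exact ⟨l, e, q, hl, (isCycleGlue_iff hk (coded_glueList (.cons coded_P2 hb))).1 h⟩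
  · rintro ⟨l, e, q, hl, h⟩
    obtain ⟨L, hL, hb⟩ := hl.exists_graphs
    exact ⟨L, hL, (isCycleGlue_iff hk (coded_glueList (.cons coded_P2 hb))).2 h⟩

end

/-! ### Orders and weights of the extremal codes -/

section

variable {l : List RT} {e q : ℕ}

theorem P3List.size_cons_leaf (h : P3List l e q) : (ofKids (leaf :: l)).size = 3 * q + 2 := by
  simp [ofKids, RT.size, h.size]

theorem P3List.weight_cons_leaf (h : P3List l e q) (t : ℕ) :
    (ofKids (leaf :: l)).data.weight t = (t + 1) * 3 ^ q + 1 := by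
  simp [ofKids, RT.data, h.data, Data.join, Data.weight]

theorem P3List.size_cons_edge (h : P3List l e q) : (ofKids (edge :: l)).size = 3 * q + 3 := by
  simp [ofKids, RT.size, h.size, edge]

theorem P3List.weight_cons_edge (h : P3List l e q) (t : ℕ) :
    (ofKids (edge :: l)).data.weight t = (t + 1) * 3 ^ q := by
  simp [ofKids, RT.data, h.data, Data.join, Data.weight, edge]

theorem P3List.size_cons_leaf_leaf (h : P3List l e q) :
    (ofKids (leaf :: leaf :: l)).size = 3 * q + 3 := by
  simp [ofKids, RT.size, h.size]

theorem P3List.weight_cons_leaf_leaf (h : P3List l e q) (t : ℕ) :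
    (ofKids (leaf :: leaf :: l)).data.weight t = (t + 1) * 3 ^ q := by
  simp [ofKids, RT.data, h.data, Data.join, Data.weight]

theorem P3List.weight (h : P3List l e q) (t : ℕ) :
    (ofKids l).data.weight t = (t + 1) * 3 ^ q + (2 * t + 1) + e := by
  simp [h.data, Data.weight]

theorem P3List.size_join_edge (h : P3List l e q) :
    (join leaf (ofKids (edge :: l))).size = 3 * q + 4 := by
  simp only [ofKids, RT.size, h.size, edge]
  ring

theorem P3List.weight_join_edge (h : P3List l e q) (t : ℕ) :
    (join leaf (ofKids (edge :: l))).data.weight t =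
      (t + 1) * (3 ^ q + e + 1 + 1) + (2 * t + 1) * 3 ^ q + 1 := by
  simp [ofKids, RT.data, h.data, Data.join, Data.weight, edge]
  ring

theorem P3List.size_join_leaf_edge (h : P3List l e q) :
    (join leaf (ofKids (leaf :: edge :: l))).size = 3 * q + 5 := by
  simp only [ofKids, RT.size, h.size, edge]
  ring

theorem P3List.weight_join_leaf_edge (h : P3List l e q) (t : ℕ) :
    (join leaf (ofKids (leaf :: edge :: l))).data.weight t = (3 * t + 2) * 3 ^ q + (t + 1) := by
  simp [ofKids, RT.data, h.data, Data.join, Data.weight, edge]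
  ring

end

/-! ### Assembling the theorem -/

/-- Avoids deciding which of the two candidates is larger: being strictly below either one already
excludes equality with the maximum. -/
theorem le_max_and_eq_iff {w A B : ℚ} {P Q : Prop}
    (h : (w = B ∧ Q) ∨ (w = A ∧ P) ∨ w < B ∨ w < A) (hP : P → w = A) (hQ : Q → w = B) :
    w ≤ max A B ∧ (w = max A B ↔ (P ∧ A = max A B) ∨ (Q ∧ B = max A B)) := by
  refine ⟨?_, ?_, ?_⟩
  · rcases h with h | h | h | h
    · exact h.1.le.trans (le_max_right _ _)
    · exact h.1.le.trans (le_max_left _ _)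
    · exact h.le.trans (le_max_right _ _)
    · exact h.le.trans (le_max_left _ _)
  · intro hw
    rcases h with h | h | h | h
    · exact .inr ⟨h.2, h.1 ▸ hw⟩
    · exact .inl ⟨h.2, h.1 ▸ hw⟩
    · exact absurd hw (h.trans_le (le_max_right _ _)).ne
    · exact absurd hw (h.trans_le (le_max_left _ _)).ne
  · rintro (⟨hp, h⟩ | ⟨hq, h⟩)
    · rw [hP hp, ← h]
    · rw [hQ hq, ← h]

theorem three_zpow {a : ℤ} {s : ℕ} (h : a = s) : (3 : ℚ) ^ a = 3 ^ s := by
  rw [h, zpow_natCast]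

/-- Here `t = m + 1` and `n - k - 1 = 3 * s + 3`, so the exponent is `s`. -/
theorem x1_eq (m s : ℕ) :
    x1 (3 * m + 3 * s + 9) (3 * m + 5) = ((3 * (m + 1) + 2) * 3 ^ s + (m + 1 + 1) : ℕ) := by
  rw [x1, three_zpow (s := s) (by push_cast; omega)]
  push_cast
  ring

theorem x2_eq (m s : ℕ) :
    x2 (3 * m + 3 * s + 9) (3 * m + 5) = ((m + 1 + 1) * 3 ^ (s + 1) + 1 : ℕ) := by
  rw [x2, three_zpow (s := s) (by push_cast; omega)]
  push_cast
  ring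

theorem x3_eq (m s : ℕ) :
    x3 (3 * m + 3 * s + 8) (3 * m + 5) =
      ((m + 1 + 1) * (3 ^ s + s + 2) + (2 * (m + 1) + 1) * 3 ^ s + 1 : ℕ) := by
  rw [x3, three_zpow (s := s) (by push_cast; omega)]
  push_cast
  ring

theorem x4_eq (m s : ℕ) :
    x4 (3 * m + 3 * s + 8) (3 * m + 5) =
      ((m + 1 + 1) * 3 ^ (s + 1) + (2 * (m + 1) + 1) + (s + 1) : ℕ) := by
  rw [x4, three_zpow (s := s) (by push_cast; omega)]
  push_cast
  ring

theorem Realizes.join_leaf_perm {V : Type u} {G : SimpleGraph V} {a : RT} {l : List RT}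
    {S : Set V} {r : V} (h : Realizes G (join leaf a) S r) (hl : (kids a).Perm l) :
    Realizes G (join leaf (ofKids l)) S r := by
  obtain ⟨S₁, S₂, c, h1, h2, h3⟩ := h
  exact ⟨S₁, S₂, c, h1, h2.kids_perm hl, h3⟩

section

variable {V : Type u} [Fintype V] {G : SimpleGraph V} {m s : ℕ} {T : RT} {c : ℕ → V} {S : Set V}

theorem Decomp.bound_of_mod_zero (h : Decomp G (3 * m + 5) T c S) (hT : T.size = 3 * s + 5) :
    (numMaxDissociationSets G : ℚ) ≤ max (x1 (3 * m + 3 * s + 9) (3 * m + 5))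
        (x2 (3 * m + 3 * s + 9) (3 * m + 5)) ∧
      ((numMaxDissociationSets G : ℚ) = max (x1 (3 * m + 3 * s + 9) (3 * m + 5))
          (x2 (3 * m + 3 * s + 9) (3 * m + 5)) ↔
        (InG2 G (3 * m + 5) ∧ x1 (3 * m + 3 * s + 9) (3 * m + 5) =
          max (x1 (3 * m + 3 * s + 9) (3 * m + 5)) (x2 (3 * m + 3 * s + 9) (3 * m + 5))) ∨
        (InG9 G (3 * m + 5) ∧ x2 (3 * m + 3 * s + 9) (3 * m + 5) =
          max (x1 (3 * m + 3 * s + 9) (3 * m + 5)) (x2 (3 * m + 3 * s + 9) (3 * m + 5)))) := by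
  have hcard := h.card
  rw [x1_eq, x2_eq]
  refine le_max_and_eq_iff ?_ ?_ ?_
  · rw [inG2_iff (by omega), inG9_iff (by omega), h.numMax_eq]
    rcases weight_of_mod_one T (t := m + 1) (by omega) hT with
      ⟨hw, l, e, q, hl, hp⟩ | ⟨hw, a, l, e, q, rfl, hl, hp⟩ | hw | hw
    · exact .inl ⟨by rw [hw], l, e, q, hl, c, S, h.congr_code (h.realizes.kids_perm hp)⟩
    · exact .inr (.inl ⟨by rw [hw], l, e, q, hl, c, S,
        h.congr_code (h.realizes.join_leaf_perm hp)⟩)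
    · exact .inr (.inr (.inl (by exact_mod_cast hw)))
    · exact .inr (.inr (.inr (by exact_mod_cast hw)))
  · rw [inG2_iff (by omega)]
    rintro ⟨l, e, q, hl, d, S', h'⟩
    have hc := h'.card
    rw [hl.size_join_leaf_edge] at hc
    obtain rfl : q = s := by omega
    rw [h'.numMax_eq, hl.weight_join_leaf_edge]
  · rw [inG9_iff (by omega)]
    rintro ⟨l, e, q, hl, d, S', h'⟩
    have hc := h'.card
    rw [hl.size_cons_leaf] at hc
    obtain rfl : q = s + 1 := by omega
    rw [h'.numMax_eq, hl.weight_cons_leaf]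

theorem Decomp.bound_of_mod_two (h : Decomp G (3 * m + 5) T c S) (hT : T.size = 3 * s + 4) :
    (numMaxDissociationSets G : ℚ) ≤ max (x3 (3 * m + 3 * s + 8) (3 * m + 5))
        (x4 (3 * m + 3 * s + 8) (3 * m + 5)) ∧
      ((numMaxDissociationSets G : ℚ) = max (x3 (3 * m + 3 * s + 8) (3 * m + 5))
          (x4 (3 * m + 3 * s + 8) (3 * m + 5)) ↔
        (InG1 G (3 * m + 5) ∧ x3 (3 * m + 3 * s + 8) (3 * m + 5) =
          max (x3 (3 * m + 3 * s + 8) (3 * m + 5)) (x4 (3 * m + 3 * s + 8) (3 * m + 5))) ∨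
        (InG8 G (3 * m + 5) ∧ x4 (3 * m + 3 * s + 8) (3 * m + 5) =
          max (x3 (3 * m + 3 * s + 8) (3 * m + 5)) (x4 (3 * m + 3 * s + 8) (3 * m + 5)))) := by
  have hcard := h.card
  rw [x3_eq, x4_eq]
  refine le_max_and_eq_iff ?_ ?_ ?_
  · rw [inG1_iff (by omega), inG8_iff (by omega), h.numMax_eq]
    rcases weight_of_mod_zero T (t := m + 1) (by omega) hT with
      ⟨hw, hl⟩ | ⟨hw, a, l, rfl, hl, hp⟩ | hw | hw
    · refine .inl ⟨by rw [hw], s + 1, by omega, c, S, ?_⟩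
      rw [← hl.eq_replicate rfl, ofKids_kids]
      exact h
    · refine .inr (.inl ⟨by rw [hw], s, c, S, ?_⟩)
      rw [← hl.eq_replicate rfl]
      exact h.congr_code (h.realizes.join_leaf_perm hp)
    · exact .inr (.inr (.inl (by exact_mod_cast hw)))
    · exact .inr (.inr (.inr (by exact_mod_cast hw)))
  · rw [inG1_iff (by omega)]
    rintro ⟨q, d, S', h'⟩
    have hc := h'.card
    rw [(p3List_replicate q).size_join_edge] at hc
    obtain rfl : q = s := by omega
    rw [h'.numMax_eq, (p3List_replicate q).weight_join_edge]
  · rw [inG8_iff (by omega)]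
    rintro ⟨q, -, d, S', h'⟩
    have hc := h'.card
    rw [(p3List_replicate q).size] at hc
    obtain rfl : q = s + 1 := by omega
    rw [h'.numMax_eq, (p3List_replicate _).weight]

theorem Decomp.bound_of_mod_one (h : Decomp G (3 * m + 5) T c S) (hs : 1 ≤ s)
    (hT : T.size = 3 * s + 3) :
    numMaxDissociationSets G ≤ (m + 1 + 1) * 3 ^ s ∧
      (numMaxDissociationSets G = (m + 1 + 1) * 3 ^ s ↔
        InG6 G (3 * m + 5) ∨ InG7 G (3 * m + 5)) := by
  have hcard := h.card
  obtain ⟨hle, heq⟩ := weight_le_of_mod_two T (t := m + 1) hs (by omega) hT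
  rw [← h.numMax_eq] at hle heq
  rw [inG6_iff (by omega), inG7_iff (by omega)]
  refine ⟨hle, fun hw => ?_, ?_⟩
  · obtain ⟨l, e, q, hl, hp | hp⟩ := heq hw
    · exact .inl ⟨l, e, q, hl, c, S, h.congr_code (h.realizes.kids_perm hp)⟩
    · exact .inr ⟨l, e, q, hl, c, S, h.congr_code (h.realizes.kids_perm hp)⟩
  · rintro (⟨l, e, q, hl, d, S', h'⟩ | ⟨l, e, q, hl, d, S', h'⟩)
    · have hc := h'.card
      rw [hl.size_cons_edge] at hc
      obtain rfl : q = s := by omega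
      rw [h'.numMax_eq, hl.weight_cons_edge]
    · have hc := h'.card
      rw [hl.size_cons_leaf_leaf] at hc
      obtain rfl : q = s := by omega
      rw [h'.numMax_eq, hl.weight_cons_leaf_leaf]

end

end Potted

theorem theorem1p2 {V : Type*} [Fintype V] (G : SimpleGraph V) (n k : ℕ)
    (hk : k ≡ 2 [MOD 3]) (hnk : k + 3 ≤ n)
    (hn : Fintype.card V = n) (hG : Potted.IsPottedGraph G k) :
    (n ≡ 0 [MOD 3] →
      (Potted.numMaxDissociationSets G : ℚ) ≤ max (Potted.x1 n k) (Potted.x2 n k) ∧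
      ((Potted.numMaxDissociationSets G : ℚ) = max (Potted.x1 n k) (Potted.x2 n k) ↔
        (Potted.InG2 G k ∧ Potted.x1 n k = max (Potted.x1 n k) (Potted.x2 n k)) ∨
        (Potted.InG9 G k ∧ Potted.x2 n k = max (Potted.x1 n k) (Potted.x2 n k)))) ∧
    (n ≡ 1 [MOD 3] →
      (Potted.numMaxDissociationSets G : ℚ) ≤
        (k + 1) * (3 : ℚ) ^ (((n : ℤ) - k - 2) / 3 - 1) ∧
      ((Potted.numMaxDissociationSets G : ℚ) =
          (k + 1) * (3 : ℚ) ^ (((n : ℤ) - k - 2) / 3 - 1) ↔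
        Potted.InG6 G k ∨ Potted.InG7 G k)) ∧
    (n ≡ 2 [MOD 3] →
      (Potted.numMaxDissociationSets G : ℚ) ≤ max (Potted.x3 n k) (Potted.x4 n k) ∧
      ((Potted.numMaxDissociationSets G : ℚ) = max (Potted.x3 n k) (Potted.x4 n k) ↔
        (Potted.InG1 G k ∧ Potted.x3 n k = max (Potted.x3 n k) (Potted.x4 n k)) ∨
        (Potted.InG8 G k ∧ Potted.x4 n k = max (Potted.x3 n k) (Potted.x4 n k)))) := by
  obtain ⟨hk3, T, c, S, h⟩ := hG.exists_decomp
  unfold Nat.ModEq at *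
  -- A cycle has order at least three, so the congruence gives `k ≥ 5`.
  obtain ⟨m, rfl⟩ : ∃ m, k = 3 * m + 5 := ⟨(k - 5) / 3, by omega⟩
  have hcard : n = T.size + (3 * m + 4) := hn.symm.trans h.card
  refine ⟨fun hmod => ?_, fun hmod => ?_, fun hmod => ?_⟩
  · obtain ⟨s, hs⟩ : ∃ s, T.size = 3 * s + 5 := ⟨(T.size - 5) / 3, by omega⟩
    obtain rfl : n = 3 * m + 3 * s + 9 := by omega
    exact h.bound_of_mod_zero hs
  -- The tree has order `n - k + 1 ≥ 4`, hence at least 6 here; this supplies the hypothesis `1 ≤ s`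
  -- of `Decomp.bound_of_mod_one`.
  · obtain ⟨s, hs⟩ : ∃ s, T.size = 3 * (s + 1) + 3 := ⟨(T.size - 6) / 3, by omega⟩
    have hf : ((3 * m + 5 : ℕ) + 1 : ℚ) * (3 : ℚ) ^ (((n : ℤ) - (3 * m + 5 : ℕ) - 2) / 3 - 1) =
        ((m + 1 + 1) * 3 ^ (s + 1) : ℕ) := by
      rw [Potted.three_zpow (s := s) (by push_cast; omega)]
      push_cast
      ring
    rw [hf, Nat.cast_le, Nat.cast_inj]
    exact h.bound_of_mod_one (by omega) hs
  · obtain ⟨s, hs⟩ : ∃ s, T.size = 3 * s + 4 := ⟨(T.size - 4) / 3, by omega⟩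
    obtain rfl : n = 3 * m + 3 * s + 8 := by omega
    exact h.bound_of_mod_two hs
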